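/- **Theorem 3.1 ($U^5$-control in the vertical direction).** For a positive integer $M$ write $[M]=\{1,2,\dots,M\}$, and write $\mathbb{E}_{s\in S}F(s)=\frac{1}{|S|}\sum_{s\in S}F(s)$ for a finite non-empty set $S$. For $f:\mathbb{Z}\to\mathbb{C}$ and $h\in\mathbb{Z}$ let $\Delta_hf(x)=f(x)\overline{f(x+h)}$ and $\Delta_{h_1,\dots,h_s}f=\Delta_{h_1}\cdots\Delta_{h_s}f$; for $f$ of finite support define the (unnormalised) Gowers norm $$\|f\|_{U^5(\mathbb{Z})}=\Big(\sum_{x,h_1,\dots,h_5\in\mathbb{Z}}\Delta_{h_1,\dots,h_5}f(x)\Big)^{1/2^5}.$$ For a positive integer $N$ let $\mu_N(d)=\frac1N\max\{1-\frac{|d|}{N},0\}$ for $d\in\mathbb{Z}$, and for $f_0,f_1,g:\mathbb{Z}^2\to\mathbb{C}$ let $$\Lambda_N(f_0,f_1,g)=\mathbb{E}_{x\in[N]}\,\mathbb{E}_{y\in[N^2]}\,f_0(x,y)\sum_{d\in\mathbb{Z}}\mu_N(d)\,f_1(x+d,y)\,g(x,y+d^2).$$ There exist absolute constants $c>0$ and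 $C\in\{0,1,2,\dots\}$ such that the following holds for every positive integer $N$, every real $\delta>0$ and all functions $f_0,f_1,g:\mathbb{Z}^2\to\mathbb{C}$ whose modulus is everywhere at most $1$. If $|\Lambda_N(f_0,f_1,g)|\ge\delta$, then $$\mathbb{E}_{x\in[N]}\big\|g_x1_{[2N^2]}\big\|_{U^5(\mathbb{Z})}^{2^5}\;\ge\;c\,\delta^{C}\,\big\|1_{[2N^2]}\big\|_{U^5(\mathbb{Z})}^{2^5},$$ where $g_x(y)=g(x,y)$. -/

import Mathlib

open scoped BigOperators

/-- The multiplicative difference function `Δ_h f(x) = f(x) * conj (f(x + h))`. -/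
def multDiff {G : Type*} [AddCommGroup G] (h : G) (f : G → ℂ) : G → ℂ :=
  fun x => f x * (starRingEnd ℂ) (f (x + h))

/-- The iterated difference function `Δ_{h_1, …, h_s} f = Δ_{h_1} ⋯ Δ_{h_s} f`. -/
def iterMultDiff {G : Type*} [AddCommGroup G] : (s : ℕ) → (Fin s → G) → (G → ℂ) → G → ℂ
  | 0, _, f => f
  | s + 1, h, f => multDiff (h 0) (iterMultDiff s (Fin.tail h) f)

/-- The sum `∑_{x, h_1, …, h_s ∈ G} Δ_{h_1, …, h_s} f(x)` with respect to counting measure; it has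
only finitely many non-zero terms if `f` has finite support (see `iterMultDiff_finite`). -/
noncomputable def gowersSum {G : Type*} [AddCommGroup G] (s : ℕ) (f : G → ℂ) : ℂ :=
  ∑' p : G × (Fin s → G), iterMultDiff s p.2 f p.1

/-- The unnormalised Gowers norm
`‖f‖_{U^s(G)} = (∑_{x, h_1, …, h_s ∈ G} Δ_{h_1, …, h_s} f(x)) ^ (1 / 2 ^ s)`.
For `f` of finite support and `s ≥ 1` the sum is a non-negative real number
(see `gowersSum_nonneg`), so that taking its real part loses nothing. -/
noncomputable def gowersNorm {G : Type*} [AddCommGroup G] (s : ℕ) (f : G → ℂ) : ℝ :=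
  (gowersSum s f).re ^ ((1 : ℝ) / 2 ^ s)

theorem iterMultDiff_support {G : Type*} [AddCommGroup G] (f : G → ℂ) :
    ∀ (s : ℕ) (h : Fin s → G) (x : G), iterMultDiff s h f x ≠ 0 →
      f x ≠ 0 ∧ ∀ i, f (x + h i) ≠ 0
  | 0, _, _, hx => ⟨hx, fun i => i.elim0⟩
  | s + 1, h, x, hx => by
    have h1 : iterMultDiff s (Fin.tail h) f x ≠ 0 := left_ne_zero_of_mul hx
    have h2 : iterMultDiff s (Fin.tail h) f (x + h 0) ≠ 0 := fun h0 => hx (by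
      simp [iterMultDiff, multDiff, h0])
    have k1 := iterMultDiff_support f s _ _ h1
    have k2 := iterMultDiff_support f s _ _ h2
    refine ⟨k1.1, fun i => ?_⟩
    refine Fin.cases k2.1 (fun j => k1.2 j) i

theorem iterMultDiff_finite {G : Type*} [AddCommGroup G] (f : G → ℂ)
    (hf : (Function.support f).Finite) (s : ℕ) :
    (Function.support fun p : G × (Fin s → G) => iterMultDiff s p.2 f p.1).Finite := by
  have hfin := hf.prod (Set.Finite.pi' (fun _ : Fin s => hf))
  refine Set.Finite.subset (hfin.image (fun q => (q.1, fun i => q.2 i - q.1))) ?_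
  rintro ⟨x, h⟩ hx
  obtain ⟨h1, h2⟩ := iterMultDiff_support f s h x hx
  exact ⟨(x, fun i => x + h i), ⟨h1, h2⟩, by simp⟩

open scoped ComplexOrder in
/-- The sum defining the Gowers norm is real and non-negative. -/
theorem gowersSum_nonneg {G : Type*} [AddCommGroup G] (s : ℕ) (f : G → ℂ)
    (hf : (Function.support f).Finite) : 0 ≤ gowersSum (s + 1) f := by
  let e : (Fin s → G) × (G × G) ≃ G × (Fin (s + 1) → G) :=
    { toFun := fun q => (q.2.1, Fin.cons (q.2.2 - q.2.1) q.1)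
      invFun := fun p => (Fin.tail p.2, (p.1, p.1 + p.2 0))
      left_inv := fun q => by simp
      right_inv := fun p => by simp }
  have hsum : Summable fun q : (Fin s → G) × (G × G) =>
      iterMultDiff (s + 1) (e q).2 f (e q).1 :=
    (e.summable_iff (f := fun p : G × (Fin (s + 1) → G) => iterMultDiff (s + 1) p.2 f p.1)).2
      (summable_of_hasFiniteSupport (iterMultDiff_finite f hf (s + 1)))
  have hval : ∀ q : (Fin s → G) × (G × G), iterMultDiff (s + 1) (e q).2 f (e q).1 =
      iterMultDiff s q.1 f q.2.1 * (starRingEnd ℂ) (iterMultDiff s q.1 f q.2.2) := by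
    intro q
    simp [e, iterMultDiff, multDiff]
  rw [gowersSum, ← e.tsum_eq, hsum.tsum_prod]
  refine tsum_nonneg fun h => ?_
  have hfin : (Function.support (iterMultDiff s h f)).Finite :=
    hf.subset fun x hx => (iterMultDiff_support f s h x hx).1
  have hs1 : Summable fun x => ‖iterMultDiff s h f x‖ :=
    (summable_of_hasFiniteSupport hfin).norm
  have hs2 : Summable fun x => ‖(starRingEnd ℂ) (iterMultDiff s h f x)‖ := by simpa using hs1
  simp only [hval]
  rw [← tsum_mul_tsum_of_summable_norm hs1 hs2, ← Complex.conj_tsum, Complex.mul_conj]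
  exact_mod_cast Complex.normSq_nonneg _

/-- The Fejér-type probability weight `μ_N(d) = (1/N) (1 - |d|/N)_+` on the integers. -/
noncomputable def fejer (N : ℕ) (d : ℤ) : ℝ :=
  (1 / (N : ℝ)) * max (1 - |(d : ℝ)| / (N : ℝ)) 0

/-- The counting operator
`Λ_N(f₀, f₁, g) = 𝔼_{x ∈ [N]} 𝔼_{y ∈ [N²]} f₀(x, y) ∑_d μ_N(d) f₁(x + d, y) g(x, y + d²)`,
where `[M] = {1, …, M}`. -/
noncomputable def countingOp (N : ℕ) (f₀ f₁ g : ℤ × ℤ → ℂ) : ℂ :=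
  𝔼 x ∈ Finset.Icc (1 : ℤ) (N : ℤ), 𝔼 y ∈ Finset.Icc (1 : ℤ) ((N : ℤ) ^ 2),
    f₀ (x, y) * ∑' d : ℤ, (fejer N d : ℂ) * f₁ (x + d, y) * g (x, y + d ^ 2)

/-! The weight `μ_N` is an average of indicators of intervals, so `d` may be confined to one
interval. Substituting `z = x + d` and applying Cauchy–Schwarz over `(y, z)` removes `f₁`; then `f₀`
factors out, and a second Cauchy–Schwarz gives, for many columns `G = g_x 1_{[2N²]}`, a large value
of `∑_{k,y} |∑_d G(y + d²) R_k(y + (d - k)²)|²` (`le_sum_norm_sq_columns`). Here `R_k` is the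
conjugate of column `x + k`, and only its boundedness is used. It remains to bound the `U⁵`-norm of
such a `G` from below (`le_gowersRe_five`).

Expanding the square over `d`, `d + h` and centring at `s = y + d² + 2dh` makes one copy of `G`
independent of `d` and the other arguments linear in `d`. One more Cauchy–Schwarz, with step `c`,
shows that for many `(h, c)` the function `F = Δ_{-2ch} G` has large averages `∑_d ∑_z F(z) φ(z -
2dk) ψ(z - 2d(k - h))` for many `k`. Such an `F` has a large `U⁴`-norm (`le_gowersRe_four`), and
averaging over `(h, c)` yields `U⁵` for `G` (`gowersRe_concatenation`).

Concatenation: by Cauchy–Schwarz a large average of `U^s` sums of `Δ_{2la} f` gives a large average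
over the steps `2l'a' - 2la`. Unless `gcd(l, l')` is large, which is rare, these steps repeat so
little that their sum is controlled by the sum over all steps, the `U^{s+1}` sum.

The `U⁴` bound: put `l = k - h`. Shifting `d` by `i + j` and `z` by `2ki + 2lj` makes `φ` depend on
`j` alone and `ψ` on `i` alone. So `F` correlates on a two-dimensional progression with a product
`α_i β_j`, that is, on an interval with a `2l`-periodic function times a `2k`-periodic one; the
latter can be replaced by the conjugate of `v`, a multiple of the projection of `F u` to
`2k`-periodic functions (`PeriodicDatum`). Since one `F` serves many `k`, the data for two values
`k`, `k'` correlate: `v_k` correlates with a product of functions of periods `2(k - h)`, `2(k' -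
h)`, `2k'`, all almost coprime to `k`. Differencing along these periods removes them and leaves cube
sums of `v_k`. The projection property puts `F u` at the base vertex, periodicity spreads the sides
over dense sets of integers, and Cauchy–Schwarz removes the other seven vertices. This is `U³`
information on `F u`; differencing along the period of `u` turns it into large `U³` sums of `Δ_{2(k
- h)a} F`, and concatenation over `(k - h, a)` gives `U⁴`.

All losses are powers of a parameter `T` comparable to `δ⁻⁴`. When `N` is below a fixed power of
`T`, one large value of `G` suffices (`exists_column_control`). -/

open scoped ComplexConjugate

/-! ### Difference functions and Gowers sums. -/

section Gowers

variable {G : Type*} [AddCommGroup G]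

theorem multDiff_comm (a b : G) (f : G → ℂ) :
    multDiff a (multDiff b f) = multDiff b (multDiff a f) := by
  funext x
  simp only [multDiff, map_mul, Complex.conj_conj]
  rw [add_right_comm x a b]
  ring

theorem iterMultDiff_multDiff (n : G) (f : G → ℂ) : ∀ (s : ℕ) (h : Fin s → G),
    iterMultDiff s h (multDiff n f) = multDiff n (iterMultDiff s h f)
  | 0, _ => rfl
  | s + 1, h => by
    simp only [iterMultDiff]
    rw [iterMultDiff_multDiff n f s, multDiff_comm]

theorem multDiff_mul (n : G) (f g : G → ℂ) :
    multDiff n (fun x => f x * g x) = fun x => multDiff n f x * multDiff n g x := by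
  funext x
  simp only [multDiff, map_mul]
  ring

theorem multDiff_shift (n a : G) (f : G → ℂ) :
    multDiff n (fun x => f (x + a)) = fun x => multDiff n f (x + a) := by
  funext x
  simp only [multDiff]
  rw [add_right_comm x n a]

theorem multDiff_periodic {t : G} {f : G → ℂ} (hf : Function.Periodic f t) (n : G) :
    Function.Periodic (multDiff n f) t := by
  intro x
  simp only [multDiff]
  rw [hf, add_right_comm, hf]

theorem norm_multDiff_le {f : G → ℂ} (hf : ∀ x, ‖f x‖ ≤ 1) (n x : G) : ‖multDiff n f x‖ ≤ 1 := by
  simp only [multDiff, norm_mul, RCLike.norm_conj]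
  exact mul_le_one₀ (hf _) (norm_nonneg _) (hf _)

theorem norm_iterMultDiff_le {f : G → ℂ} (hf : ∀ x, ‖f x‖ ≤ 1) : ∀ (s : ℕ) (h : Fin s → G) (x : G),
    ‖iterMultDiff s h f x‖ ≤ 1
  | 0, _, x => hf x
  | s + 1, _, x => norm_multDiff_le (norm_iterMultDiff_le hf s _) _ x

theorem multDiff_support_subset (n : G) (f : G → ℂ) :
    Function.support (multDiff n f) ⊆ Function.support f := by
  intro x hx h0
  simp [multDiff, h0] at hx

theorem multDiff_finite_support {f : G → ℂ} (hf : (Function.support f).Finite) (n : G) :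
    (Function.support (multDiff n f)).Finite :=
  hf.subset (multDiff_support_subset n f)

/-- The real part of `gowersSum`. -/
noncomputable def gowersRe (s : ℕ) (f : G → ℂ) : ℝ := (gowersSum s f).re

/-- Differencing operators commute, so the outermost difference can be moved innermost and its step
summed last. -/
theorem gowersSum_succ (s : ℕ) {f : G → ℂ} (hf : (Function.support f).Finite) :
    HasSum (fun n => gowersSum s (multDiff n f)) (gowersSum (s + 1) f) := by
  let e : G × (G × (Fin s → G)) ≃ G × (Fin (s + 1) → G) :=
    { toFun := fun q => (q.2.1, Fin.cons q.1 q.2.2)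
      invFun := fun p => (p.2 0, (p.1, Fin.tail p.2))
      left_inv := fun q => by simp
      right_inv := fun p => by simp }
  have hval : ∀ q, iterMultDiff (s + 1) (e q).2 f (e q).1 =
      iterMultDiff s q.2.2 (multDiff q.1 f) q.2.1 := by
    intro q
    rw [iterMultDiff_multDiff]
    simp [e, iterMultDiff]
  have hs : Summable fun p : G × (Fin (s + 1) → G) => iterMultDiff (s + 1) p.2 f p.1 :=
    summable_of_hasFiniteSupport (iterMultDiff_finite f hf (s + 1))
  have h1 := (e.hasSum_iff (f := fun p : G × (Fin (s + 1) → G) =>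
    iterMultDiff (s + 1) p.2 f p.1)).2 hs.hasSum
  simp only [Function.comp_def, hval] at h1
  exact h1.prod_fiberwise fun n => (summable_of_hasFiniteSupport
    (iterMultDiff_finite _ (multDiff_finite_support hf n) s)).hasSum

theorem gowersRe_succ (s : ℕ) {f : G → ℂ} (hf : (Function.support f).Finite) :
    HasSum (fun n => gowersRe s (multDiff n f)) (gowersRe (s + 1) f) :=
  Complex.hasSum_re (gowersSum_succ s hf)

theorem gowersRe_nonneg {s : ℕ} (hs : 1 ≤ s) {f : G → ℂ} (hf : (Function.support f).Finite) :
    0 ≤ gowersRe s f := by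
  obtain ⟨s, rfl⟩ := Nat.exists_eq_add_of_le' hs
  exact (Complex.le_def.1 (gowersSum_nonneg s f hf)).1

theorem gowersNorm_pow {s : ℕ} (hs : 1 ≤ s) {f : G → ℂ} (hf : (Function.support f).Finite) :
    gowersNorm s f ^ (2 ^ s) = gowersRe s f := by
  have h := gowersRe_nonneg hs hf
  rw [gowersNorm, ← Real.rpow_natCast, ← Real.rpow_mul (by exact h)]
  push_cast
  rw [one_div, inv_mul_cancel₀ (by positivity), Real.rpow_one, gowersRe]

theorem iterMultDiff_shift_finite {f : G → ℂ} (hf : (Function.support f).Finite) (s : ℕ) (t : G) :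
    (Function.support fun p : G × (Fin s → G) => iterMultDiff s p.2 f (p.1 + t)).Finite := by
  refine ((iterMultDiff_finite f hf s).image (fun p => (p.1 - t, p.2))).subset ?_
  rintro ⟨x, h⟩ hx
  exact ⟨(x + t, h), hx, by simp⟩

/-- Translation by `a` reduces a correlation of two shifts to one difference with step `b - a`. Thus
Gowers sums of `multDiff n f` are inner products of shifts, open to Cauchy–Schwarz. -/
theorem hasSum_iterMultDiff_shift_mul {f : G → ℂ} (hf : (Function.support f).Finite) (s : ℕ)
    (a b : G) :
    HasSum (fun p : G × (Fin s → G) => iterMultDiff s p.2 f (p.1 + a) *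
      conj (iterMultDiff s p.2 f (p.1 + b))) (gowersSum s (multDiff (b - a) f)) := by
  have hs : Summable fun p : G × (Fin s → G) => iterMultDiff s p.2 (multDiff (b - a) f) p.1 :=
    summable_of_hasFiniteSupport (iterMultDiff_finite _ (multDiff_finite_support hf _) s)
  have h := ((Equiv.prodCongr (Equiv.addRight a) (Equiv.refl (Fin s → G))).hasSum_iff
    (f := fun p : G × (Fin s → G) => iterMultDiff s p.2 (multDiff (b - a) f) p.1)).2 hs.hasSum
  refine h.congr_fun ?_
  intro p
  simp [iterMultDiff_multDiff, multDiff]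

/-- A sum of squared moduli of sums of shifts of difference functions, in terms of Gowers sums. -/
theorem hasSum_norm_sq_shifts {ι : Type*} {f : G → ℂ} (hf : (Function.support f).Finite) (s : ℕ)
    (S : Finset ι) (t : ι → G) :
    HasSum (fun p : G × (Fin s → G) => ‖∑ j ∈ S, iterMultDiff s p.2 f (p.1 + t j)‖ ^ 2)
      (∑ j ∈ S, ∑ j' ∈ S, gowersRe s (multDiff (t j' - t j) f)) := by
  have h : HasSum (fun p : G × (Fin s → G) => ∑ j ∈ S, ∑ j' ∈ S,
      iterMultDiff s p.2 f (p.1 + t j) * conj (iterMultDiff s p.2 f (p.1 + t j')))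
      (∑ j ∈ S, ∑ j' ∈ S, gowersSum s (multDiff (t j' - t j) f)) :=
    hasSum_sum fun j _ => hasSum_sum fun j' _ => hasSum_iterMultDiff_shift_mul hf s _ _
  have h2 := Complex.hasSum_re h
  simp only [Complex.re_sum] at h2 ⊢
  refine h2.congr_fun ?_
  intro p
  rw [← Complex.normSq_eq_norm_sq, ← Complex.ofReal_re (Complex.normSq _), ← Complex.mul_conj,
    map_sum, Finset.sum_mul_sum]
  simp only [Complex.re_sum]

theorem norm_tsum_mul_conj_sq_le {ι : Type*} {f g : ι → ℂ} (hf : (Function.support f).Finite)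
    (hg : (Function.support g).Finite) :
    ‖∑' i, f i * conj (g i)‖ ^ 2 ≤ (∑' i, ‖f i‖ ^ 2) * ∑' i, ‖g i‖ ^ 2 := by
  classical
  set s := hf.toFinset ∪ hg.toFinset
  have h1 : ∀ i ∉ s, f i = 0 := fun i hi => by simp [s] at hi; exact hi.1
  have h2 : ∀ i ∉ s, g i = 0 := fun i hi => by simp [s] at hi; exact hi.2
  rw [tsum_eq_sum (s := s) (fun i hi => by simp [h1 i hi]),
    tsum_eq_sum (s := s) (fun i hi => by simp [h1 i hi]),
    tsum_eq_sum (s := s) (fun i hi => by simp [h2 i hi])]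
  calc ‖∑ i ∈ s, f i * conj (g i)‖ ^ 2 ≤ (∑ i ∈ s, ‖f i‖ * ‖g i‖) ^ 2 := by
        gcongr
        refine (norm_sum_le _ _).trans (le_of_eq (Finset.sum_congr rfl fun i _ => by simp))
    _ ≤ _ := Finset.sum_mul_sq_le_sq_mul_sq _ _ _

/-- Each term on the left is the inner product of the `s`-fold difference function with its shift by
`t j`. Cauchy–Schwarz separates the unshifted copy from the sum of the shifts. -/
theorem sq_sum_gowersRe_le {ι : Type*} {f : G → ℂ} (hf : (Function.support f).Finite) (s : ℕ)
    (S : Finset ι) (t : ι → G) :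
    (∑ j ∈ S, gowersRe s (multDiff (t j) f)) ^ 2 ≤ gowersRe s (multDiff 0 f) *
      ∑ j ∈ S, ∑ j' ∈ S, gowersRe s (multDiff (t j' - t j) f) := by
  have h0 := (hasSum_norm_sq_shifts hf s (Finset.univ : Finset Unit) (fun _ => (0 : G))).tsum_eq
  have h1 := (hasSum_norm_sq_shifts hf s S t).tsum_eq
  simp only [Finset.univ_unique, Finset.sum_singleton, sub_self, add_zero] at h0
  rw [← h0, ← h1]
  have hfin : (Function.support fun p : G × (Fin s → G) =>
      ∑ j ∈ S, iterMultDiff s p.2 f (p.1 + t j)).Finite := by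
    refine ((S.finite_toSet.biUnion fun j _ => iterMultDiff_shift_finite hf s (t j))).subset ?_
    intro p hp
    obtain ⟨j, hj, h⟩ := Finset.exists_ne_zero_of_sum_ne_zero hp
    exact Set.mem_biUnion hj h
  have key := norm_tsum_mul_conj_sq_le (iterMultDiff_finite f hf s) hfin
  refine le_trans ?_ key
  have h2 : HasSum (fun p : G × (Fin s → G) => iterMultDiff s p.2 f p.1 *
      conj (∑ j ∈ S, iterMultDiff s p.2 f (p.1 + t j))) (∑ j ∈ S, gowersSum s (multDiff (t j) f)) := by
    have : HasSum (fun p : G × (Fin s → G) => ∑ j ∈ S, iterMultDiff s p.2 f (p.1 + 0) *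
      conj (iterMultDiff s p.2 f (p.1 + t j))) (∑ j ∈ S, gowersSum s (multDiff (t j - 0) f)) :=
      hasSum_sum fun j _ => hasSum_iterMultDiff_shift_mul hf s _ _
    simpa [Finset.mul_sum] using this
  rw [h2.tsum_eq]
  have h3 : ∑ j ∈ S, gowersRe s (multDiff (t j) f) = (∑ j ∈ S, gowersSum s (multDiff (t j) f)).re := by
    simp [gowersRe]
  rw [h3, ← sq_abs]
  gcongr
  exact Complex.abs_re_le_norm _

end Gowers

/-- A non-zero term has `x` and every `x + h i` in the support, so all steps lie in `[-R, R]`, and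
`2R + 1 ≤ 3R`. -/
theorem gowersRe_le {R : ℕ} {f : ℤ → ℂ} (hf : ∀ x, ‖f x‖ ≤ 1)
    (hR : Function.support f ⊆ Set.Icc 1 (R : ℤ)) (s : ℕ) :
    gowersRe s f ≤ R * (3 * R) ^ s := by
  rcases Nat.eq_zero_or_pos R with rfl | hRpos
  · have : ∀ x, f x = 0 := fun x => by
      by_contra h
      have := hR h
      simp at this
    have h0 : gowersSum s f = 0 := by
      rw [gowersSum]
      refine (tsum_congr fun p => ?_).trans tsum_zero
      by_contra h
      exact (iterMultDiff_support f s _ _ h).1 (this _)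
    simp [gowersRe, h0]
  set B := Finset.Icc (1 : ℤ) R ×ˢ Fintype.piFinset fun _ : Fin s => Finset.Icc (-(R : ℤ)) R
  have hB : ∀ p : ℤ × (Fin s → ℤ), p ∉ B → iterMultDiff s p.2 f p.1 = 0 := by
    intro p hp
    by_contra h
    obtain ⟨h1, h2⟩ := iterMultDiff_support f s _ _ h
    refine hp ?_
    have h1' := hR h1
    simp only [Set.mem_Icc] at h1'
    simp only [B, Finset.mem_product, Finset.mem_Icc, Fintype.mem_piFinset]
    refine ⟨h1', fun i => ?_⟩
    have h2' := hR (h2 i)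
    simp only [Set.mem_Icc] at h2'
    constructor <;> linarith [h2'.1, h2'.2]
  have hle : gowersRe s f ≤ (B.card : ℝ) := by
    rw [gowersRe, gowersSum, tsum_eq_sum hB]
    refine (Complex.re_le_norm _).trans ((norm_sum_le _ _).trans ?_)
    refine (Finset.sum_le_sum fun p _ => norm_iterMultDiff_le hf s p.2 p.1).trans ?_
    simp
  refine hle.trans ?_
  have hc : B.card = R * (2 * R + 1) ^ s := by
    have h1 : ((R : ℤ) + 1 + R).toNat = 2 * R + 1 := by omega
    simp [B, Fintype.card_piFinset, h1]
  rw [hc]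
  have : (1 : ℝ) ≤ R := by exact_mod_cast hRpos
  push_cast
  gcongr
  linarith

/-! ### Counting: linear equations, common divisors, residue classes, popular terms. -/

/-- `k` divides `gcd(l, k) (a₁ - a₂)`, which is too small to be a non-zero multiple of `k`. -/
theorem eq_of_linear_eq {l k a₁ a₂ b₁ b₂ : ℤ} (hk : k ≠ 0)
    (h : l * a₁ + k * b₁ = l * a₂ + k * b₂) (ha : |a₁ - a₂| * Int.gcd l k < |k|) :
    a₁ = a₂ ∧ b₁ = b₂ := by
  have h1 : k ∣ l * (a₁ - a₂) := ⟨b₂ - b₁, by linarith⟩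
  have h2 : k ∣ (Int.gcd (l * (a₁ - a₂)) (k * (a₁ - a₂)) : ℤ) :=
    Int.dvd_coe_gcd h1 (Dvd.intro _ rfl)
  rw [Int.gcd_mul_right] at h2
  have h3 : a₁ = a₂ := by
    by_contra hne
    have hpos : 0 < Int.gcd l k * (a₁ - a₂).natAbs := by
      refine Nat.mul_pos (Int.gcd_pos_of_ne_zero_right _ hk) ?_
      rw [Int.natAbs_pos]
      exact sub_ne_zero.2 hne
    have h4 := Int.le_of_dvd (by exact_mod_cast hpos) ((abs_dvd _ _).2 h2)
    push_cast at h4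
    rw [mul_comm] at h4
    omega
  refine ⟨h3, ?_⟩
  subst h3
  exact mul_left_cancel₀ hk (by linarith)

theorem card_filter_dvd_ne_zero_le (R q : ℕ) (hq : 0 < q) :
    (((Finset.Icc (-(R : ℤ)) R).filter fun a => a ≠ 0 ∧ (q : ℤ) ∣ a).card : ℝ) ≤ 2 * R / q := by
  have hsub : ((Finset.Icc (-(R : ℤ)) R).filter fun a => a ≠ 0 ∧ (q : ℤ) ∣ a) ⊆
      ((Finset.Icc (-((R / q : ℕ) : ℤ)) ((R / q : ℕ) : ℤ)).erase 0).image fun a => (q : ℤ) * a := by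
    intro a ha
    simp only [Finset.mem_filter, Finset.mem_Icc] at ha
    obtain ⟨⟨h1, h2⟩, h3, c, rfl⟩ := ha
    have hq' : (0 : ℤ) < q := by exact_mod_cast hq
    refine Finset.mem_image.2 ⟨c, ?_, rfl⟩
    simp only [Finset.mem_erase, Finset.mem_Icc]
    refine ⟨by rintro rfl; simp at h3, ?_, ?_⟩
    · push_cast
      have : -c ≤ (R : ℤ) / q := (Int.le_ediv_iff_mul_le hq').2 (by linarith)
      linarith
    · push_cast
      exact (Int.le_ediv_iff_mul_le hq').2 (by linarith)
  have hc := (Finset.card_le_card hsub).trans Finset.card_image_le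
  have h4 : ((Finset.Icc (-((R / q : ℕ) : ℤ)) ((R / q : ℕ) : ℤ)).erase 0).card = 2 * (R / q) := by
    rw [Finset.card_erase_of_mem (by simp; positivity), Int.card_Icc]
    omega
  rw [h4] at hc
  calc _ ≤ ((2 * (R / q) : ℕ) : ℝ) := by exact_mod_cast hc
    _ ≤ 2 * R / q := by
      push_cast
      rw [mul_div_assoc]
      gcongr
      exact Nat.cast_div_le

/-- Few pairs of non-zero integers in a box have a large common divisor. -/
theorem card_large_gcd_le (R Q : ℕ) (hQ : 0 < Q) :
    (((Finset.Icc (-(R : ℤ)) R ×ˢ Finset.Icc (-(R : ℤ)) R).filter fun p : ℤ × ℤ =>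
      p.1 ≠ 0 ∧ p.2 ≠ 0 ∧ Q < Int.gcd p.1 p.2).card : ℝ) ≤ 4 * (R : ℝ) ^ 2 / Q := by
  -- Sort the pairs by their gcd `q > Q`: both entries are non-zero multiples of `q`, which leaves
  -- at most `(2R/q)²` pairs, and the sum of `q⁻²` over `q > Q` is at most `1/Q`.
  have hsub : ((Finset.Icc (-(R : ℤ)) R ×ˢ Finset.Icc (-(R : ℤ)) R).filter fun p : ℤ × ℤ =>
      p.1 ≠ 0 ∧ p.2 ≠ 0 ∧ Q < Int.gcd p.1 p.2) ⊆ (Finset.Ioc Q (Q + R)).biUnion fun q =>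
        ((Finset.Icc (-(R : ℤ)) R).filter fun a => a ≠ 0 ∧ (q : ℤ) ∣ a) ×ˢ
        ((Finset.Icc (-(R : ℤ)) R).filter fun a => a ≠ 0 ∧ (q : ℤ) ∣ a) := by
    rintro ⟨a, b⟩ h
    simp only [Finset.mem_filter, Finset.mem_product, Finset.mem_Icc] at h
    obtain ⟨⟨ha, hb⟩, ha0, hb0, hg⟩ := h
    refine Finset.mem_biUnion.2 ⟨Int.gcd a b, ?_, ?_⟩
    · rw [Finset.mem_Ioc]
      refine ⟨hg, ?_⟩
      have h1 : (Int.gcd a b : ℤ) ≤ |a| :=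
        Int.le_of_dvd (abs_pos.2 ha0) ((dvd_abs _ _).2 (Int.gcd_dvd_left _ _))
      have h2 : |a| ≤ R := abs_le.2 ha
      omega
    · simp only [Finset.mem_filter, Finset.mem_product, Finset.mem_Icc]
      exact ⟨⟨ha, ha0, Int.gcd_dvd_left _ _⟩, hb, hb0, Int.gcd_dvd_right _ _⟩
  calc _ ≤ (((Finset.Ioc Q (Q + R)).biUnion fun q =>
        ((Finset.Icc (-(R : ℤ)) R).filter fun a => a ≠ 0 ∧ (q : ℤ) ∣ a) ×ˢ
        ((Finset.Icc (-(R : ℤ)) R).filter fun a => a ≠ 0 ∧ (q : ℤ) ∣ a)).card : ℝ) := by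
        exact_mod_cast Finset.card_le_card hsub
    _ ≤ ∑ q ∈ Finset.Ioc Q (Q + R), ((((Finset.Icc (-(R : ℤ)) R).filter
        fun a => a ≠ 0 ∧ (q : ℤ) ∣ a) ×ˢ ((Finset.Icc (-(R : ℤ)) R).filter
        fun a => a ≠ 0 ∧ (q : ℤ) ∣ a)).card : ℝ) := by exact_mod_cast Finset.card_biUnion_le
    _ ≤ ∑ q ∈ Finset.Ioc Q (Q + R), 4 * (R : ℝ) ^ 2 * ((q : ℝ) ^ 2)⁻¹ := by
        refine Finset.sum_le_sum fun q hq => ?_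
        have hq0 : 0 < q := by rw [Finset.mem_Ioc] at hq; omega
        have := card_filter_dvd_ne_zero_le R q hq0
        rw [Finset.card_product, Nat.cast_mul]
        calc _ ≤ (2 * (R : ℝ) / q) * (2 * R / q) := by gcongr
          _ = _ := by field_simp; ring
    _ = 4 * (R : ℝ) ^ 2 * ∑ q ∈ Finset.Ioc Q (Q + R), ((q : ℝ) ^ 2)⁻¹ := by rw [Finset.mul_sum]
    _ ≤ 4 * (R : ℝ) ^ 2 * (Q : ℝ)⁻¹ := by
        gcongr
        refine (sum_Ioc_inv_sq_le_sub hQ.ne' (by omega)).trans ?_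
        simp
        positivity
    _ = _ := by rw [div_eq_mul_inv]

theorem abs_card_filter_dvd_sub_le {q : ℤ} (hq : 0 < q) {a b : ℤ} (hab : a ≤ b + 1) (r : ℤ) :
    |(((Finset.Icc a b).filter fun z => q ∣ r - z).card : ℝ) - (b - a + 1) / q| ≤ 1 := by
  have h := Int.Ico_filter_modEq_card a (b + 1) hq r
  have hI : (Finset.Icc a b).filter (fun z => q ∣ r - z) =
      (Finset.Ico a (b + 1)).filter (fun z => z ≡ r [ZMOD q]) := by
    ext z
    simp only [Finset.mem_filter, Finset.mem_Icc, Finset.mem_Ico, Int.modEq_iff_dvd,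
      Int.lt_add_one_iff]
  rw [hI]
  have hq' : (0 : ℝ) < q := by exact_mod_cast hq
  have hc : (⌈((a : ℚ) - r) / q⌉ : ℤ) ≤ ⌈(((b + 1 : ℤ) : ℚ) - r) / q⌉ := by
    have : (0 : ℚ) < q := by exact_mod_cast hq
    refine Int.ceil_mono ?_
    gcongr
  rw [max_eq_left (by linarith)] at h
  have h' : ((((Finset.Ico a (b + 1)).filter (fun z => z ≡ r [ZMOD q])).card : ℤ) : ℝ) =
    ((⌈(((b + 1 : ℤ) : ℚ) - r) / q⌉ - ⌈((a : ℚ) - r) / q⌉ : ℤ) : ℝ) := by rw [h]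
  rw [Int.cast_natCast] at h'
  rw [h']
  have k1 := Int.ceil_lt_add_one ((((b + 1 : ℤ) : ℚ) - r) / q)
  have k2 := Int.le_ceil ((((b + 1 : ℤ) : ℚ) - r) / q)
  have k3 := Int.ceil_lt_add_one (((a : ℚ) - r) / q)
  have k4 := Int.le_ceil (((a : ℚ) - r) / q)
  have e : (((b + 1 : ℤ) : ℚ) - r) / q - ((a : ℚ) - r) / q = (b - a + 1) / q := by
    push_cast; ring
  have m1 : ((⌈(((b + 1 : ℤ) : ℚ) - r) / q⌉ - ⌈((a : ℚ) - r) / q⌉ : ℤ) : ℚ) - (b - a + 1) / q ≤ 1 := by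
    push_cast at *; linarith
  have m2 : -1 ≤ ((⌈(((b + 1 : ℤ) : ℚ) - r) / q⌉ - ⌈((a : ℚ) - r) / q⌉ : ℤ) : ℚ) - (b - a + 1) / q := by
    push_cast at *; linarith
  rw [abs_le]
  constructor
  · exact_mod_cast m2
  · exact_mod_cast m1

/-- The terms below `X / (2n)` contribute at most `X / 2`; the remaining ones, each at most `Y`,
must supply the other half. -/
theorem le_card_popular {ι : Type*} (s : Finset ι) (x : ι → ℝ) {X Y n : ℝ} (hX : 0 ≤ X)
    (hn : 0 < n) (hs : (s.card : ℝ) ≤ n) (hY : ∀ i ∈ s, x i ≤ Y) (h : X ≤ ∑ i ∈ s, x i) :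
    X ≤ 2 * Y * ((s.filter fun i => X ≤ 2 * n * x i).card : ℝ) := by
  rw [← Finset.sum_filter_add_sum_filter_not s (fun i => X ≤ 2 * n * x i)] at h
  have h1 : ∑ i ∈ s.filter (fun i => X ≤ 2 * n * x i), x i ≤
      (s.filter fun i => X ≤ 2 * n * x i).card * Y := by
    rw [← nsmul_eq_mul]
    exact Finset.sum_le_card_nsmul _ _ _ fun i hi => hY i (Finset.mem_filter.1 hi).1
  have h2 : ∑ i ∈ s.filter (fun i => ¬ X ≤ 2 * n * x i), x i ≤
      (s.filter fun i => ¬ X ≤ 2 * n * x i).card * (X / (2 * n)) := by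
    rw [← nsmul_eq_mul]
    refine Finset.sum_le_card_nsmul _ _ _ fun i hi => ?_
    rw [le_div_iff₀ (by positivity)]
    linarith [(not_le.1 (Finset.mem_filter.1 hi).2).le]
  have h3 : ((s.filter fun i => ¬ X ≤ 2 * n * x i).card : ℝ) * (X / (2 * n)) ≤ n * (X / (2 * n)) := by
    gcongr
    exact le_trans (by exact_mod_cast Finset.card_filter_le _ _) hs
  have h4 : n * (X / (2 * n)) = X / 2 := by field_simp
  linarith

theorem exists_le_of_card_mul_le_sum {ι : Type*} {s : Finset ι} (hs : s.Nonempty) {x : ι → ℝ} {V : ℝ}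
    (h : s.card * V ≤ ∑ i ∈ s, x i) : ∃ i ∈ s, V ≤ x i := by
  by_contra! hc
  have := Finset.sum_lt_sum_of_nonempty hs hc
  rw [Finset.sum_const, nsmul_eq_mul] at this
  linarith

/-! ### Van der Corput and Cauchy–Schwarz inequalities on intervals. -/

theorem norm_sum_Icc_sub_shift_le (a b t : ℤ) {X : ℤ → ℂ} {R : ℝ} (hX : ∀ z, ‖X z‖ ≤ R) :
    ‖∑ z ∈ Finset.Icc a b, X z - ∑ z ∈ Finset.Icc a b, X (z + t)‖ ≤ 2 * |(t : ℝ)| * R := by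
  have h1 : ∑ z ∈ Finset.Icc a b, X (z + t) = ∑ z ∈ Finset.Icc (a + t) (b + t), X z := by
    rw [← Finset.image_add_right_Icc, Finset.sum_image (fun _ _ _ _ h => add_right_cancel h)]
  have hR : 0 ≤ R := (norm_nonneg _).trans (hX 0)
  have hb : ∀ S : Finset ℤ, ∀ n : ℕ, S.card ≤ n → ‖∑ z ∈ S, X z‖ ≤ n * R := by
    intro S n hS
    refine (norm_sum_le_of_le S (fun z _ => hX z)).trans ?_
    rw [Finset.sum_const, nsmul_eq_mul]
    gcongr
  have hc : ∀ c d e f : ℤ, c - e = d - f →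
      (Finset.Icc c d \ Finset.Icc e f).card ≤ (c - e).natAbs := by
    intro c d e f hcd
    rcases le_total c e with h | h
    · have hsub : Finset.Icc c d \ Finset.Icc e f ⊆ Finset.Ico c e := by
        intro z hz
        simp only [Finset.mem_sdiff, Finset.mem_Icc, Finset.mem_Ico] at hz ⊢
        omega
      refine (Finset.card_le_card hsub).trans ?_
      rw [Int.card_Ico]
      omega
    · have hsub : Finset.Icc c d \ Finset.Icc e f ⊆ Finset.Ioc f d := by
        intro z hz
        simp only [Finset.mem_sdiff, Finset.mem_Icc, Finset.mem_Ioc] at hz ⊢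
        omega
      refine (Finset.card_le_card hsub).trans ?_
      rw [Int.card_Ioc]
      omega
  rw [h1, ← Finset.sum_sdiff_sub_sum_sdiff]
  have e : ((t.natAbs : ℕ) : ℝ) = |(t : ℝ)| := by rw [Nat.cast_natAbs, Int.cast_abs]
  refine (norm_sub_le _ _).trans ?_
  have k1 := hb _ t.natAbs ((hc a b (a + t) (b + t) (by ring)).trans (by simp))
  have k2 := hb _ t.natAbs ((hc (a + t) (b + t) a b (by ring)).trans (by simp))
  rw [e] at k1 k2
  linarith

/-- Shifts by multiples of `t` do not change `u`, so after averaging over `A` shifts `u` factors out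
of the inner sum. The last term pays for the ends of the interval. -/
theorem vanDerCorput {a b t : ℤ} {A : ℕ} {u X : ℤ → ℂ} (hu : ∀ z, ‖u z‖ ≤ 1) (hX : ∀ z, ‖X z‖ ≤ 1)
    (hp : Function.Periodic u t) :
    A * ‖∑ z ∈ Finset.Icc a b, u z * X z‖ ≤
      ∑ z ∈ Finset.Icc a b, ‖∑ i ∈ Finset.range A, X (z + t * i)‖ + 2 * |(t : ℝ)| * A ^ 2 := by
  have hb : ∀ z, ‖u z * X z‖ ≤ 1 := fun z => by
    rw [norm_mul]; exact mul_le_one₀ (hu z) (norm_nonneg _) (hX z)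
  have h1 : ∀ i ∈ Finset.range A, ‖∑ z ∈ Finset.Icc a b, u z * X z -
      ∑ z ∈ Finset.Icc a b, u z * X (z + t * i)‖ ≤ 2 * |(t : ℝ)| * A := by
    intro i hi
    have h := norm_sum_Icc_sub_shift_le a b (t * i) hb
    have hper : ∀ z, u (z + t * i) = u z := fun z => by
      have := hp.int_mul i z
      rwa [mul_comm] at this
    simp only [hper] at h
    refine h.trans ?_
    push_cast
    rw [abs_mul, Nat.abs_cast, mul_one, mul_assoc]
    gcongr
    exact (Finset.mem_range.1 hi).le
  have h2 : (A : ℂ) * ∑ z ∈ Finset.Icc a b, u z * X z =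
      ∑ z ∈ Finset.Icc a b, u z * ∑ i ∈ Finset.range A, X (z + t * i) +
      ∑ i ∈ Finset.range A, (∑ z ∈ Finset.Icc a b, u z * X z -
        ∑ z ∈ Finset.Icc a b, u z * X (z + t * i)) := by
    rw [Finset.sum_sub_distrib, Finset.sum_const, Finset.card_range, nsmul_eq_mul]
    simp only [Finset.mul_sum]
    rw [Finset.sum_comm]
    ring
  have h3 : (A : ℝ) * ‖∑ z ∈ Finset.Icc a b, u z * X z‖ =
      ‖(A : ℂ) * ∑ z ∈ Finset.Icc a b, u z * X z‖ := by
    rw [norm_mul, Complex.norm_natCast]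
  rw [h3, h2]
  refine (norm_add_le _ _).trans (add_le_add ?_ ?_)
  · refine (norm_sum_le _ _).trans (Finset.sum_le_sum fun z _ => ?_)
    rw [norm_mul]
    exact mul_le_of_le_one_left (norm_nonneg _) (hu z)
  · refine (norm_sum_le_of_le _ h1).trans (le_of_eq ?_)
    rw [Finset.sum_const, Finset.card_range, nsmul_eq_mul]
    ring

/-- By `htA` the end error is at most half of the main term; Cauchy–Schwarz over all pairs `(θ, z)`
gives the squares. -/
theorem vanDerCorput_family {ι : Type*} (Θ : Finset ι) (α β : ι → ℤ) {t : ℤ} {A : ℕ}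
    {u X : ι → ℤ → ℂ} {b V : ℝ} (hu : ∀ θ z, ‖u θ z‖ ≤ 1) (hX : ∀ θ z, ‖X θ z‖ ≤ 1)
    (hp : ∀ θ, Function.Periodic (u θ) t)
    (hb : ∀ θ ∈ Θ, ((Finset.Icc (α θ) (β θ)).card : ℝ) ≤ b)
    (hV0 : 0 ≤ V) (htA : 4 * |(t : ℝ)| * A ≤ V)
    (hV : Θ.card * V ≤ ∑ θ ∈ Θ, ‖∑ z ∈ Finset.Icc (α θ) (β θ), u θ z * X θ z‖) :
    Θ.card * A ^ 2 * V ^ 2 ≤ 4 * b * ∑ θ ∈ Θ, ∑ z ∈ Finset.Icc (α θ) (β θ),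
      ‖∑ i ∈ Finset.range A, X θ (z + t * i)‖ ^ 2 := by
  rcases Θ.eq_empty_or_nonempty with rfl | hne
  · simp
  have hcard : (0 : ℝ) < Θ.card := by exact_mod_cast hne.card_pos
  have h1 : Θ.card * (A * V / 2) ≤ ∑ θ ∈ Θ, ∑ z ∈ Finset.Icc (α θ) (β θ),
      ‖∑ i ∈ Finset.range A, X θ (z + t * i)‖ := by
    have := Finset.sum_le_sum fun θ (_ : θ ∈ Θ) =>
      vanDerCorput (a := α θ) (b := β θ) (A := A) (hu θ) (hX θ) (hp θ)
    rw [← Finset.mul_sum, Finset.sum_add_distrib, Finset.sum_const, nsmul_eq_mul] at this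
    have h2 := mul_le_mul_of_nonneg_left hV (Nat.cast_nonneg (α := ℝ) A)
    have h3 := mul_le_mul_of_nonneg_left htA (by positivity : (0 : ℝ) ≤ Θ.card * A)
    nlinarith
  rw [Finset.sum_sigma'] at h1 ⊢
  set P := Θ.sigma fun θ => Finset.Icc (α θ) (β θ)
  have hP : (P.card : ℝ) ≤ Θ.card * b := by
    rw [Finset.card_sigma, Nat.cast_sum]
    refine (Finset.sum_le_sum hb).trans (by simp)
  have h4 := sq_sum_le_card_mul_sum_sq (s := P)
    (f := fun p => ‖∑ i ∈ Finset.range A, X p.1 (p.2 + t * i)‖)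
  have h5 : (Θ.card * (A * V / 2)) ^ 2 ≤ (Θ.card * b) * ∑ p ∈ P,
      ‖∑ i ∈ Finset.range A, X p.1 (p.2 + t * i)‖ ^ 2 :=
    (pow_le_pow_left₀ (by positivity) h1 2).trans (h4.trans (by gcongr))
  refine le_of_mul_le_mul_left ?_ hcard
  linarith

theorem sum_norm_sq_shifts {ι : Type*} (B : Finset ℤ) (X : ℤ → ℂ) (S : Finset ι) (t : ι → ℤ) :
    (((∑ z ∈ B, ‖∑ i ∈ S, X (z + t i)‖ ^ 2 : ℝ)) : ℂ) =
      ∑ i ∈ S, ∑ i' ∈ S, ∑ z ∈ B, multDiff (t i' - t i) X (z + t i) := by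
  have : ∀ z, ((‖∑ i ∈ S, X (z + t i)‖ ^ 2 : ℝ) : ℂ) =
      ∑ i ∈ S, ∑ i' ∈ S, multDiff (t i' - t i) X (z + t i) := by
    intro z
    rw [← Complex.normSq_eq_norm_sq, ← Complex.mul_conj, map_sum, Finset.sum_mul_sum]
    refine Finset.sum_congr rfl fun i _ => Finset.sum_congr rfl fun i' _ => ?_
    simp [multDiff]
  rw [Complex.ofReal_sum]
  simp only [this]
  rw [Finset.sum_comm]
  exact Finset.sum_congr rfl fun i _ => Finset.sum_comm

theorem gowersSum_zero (f : ℤ → ℂ) : gowersSum 0 f = ∑' z, f z := by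
  rw [gowersSum, ← (Equiv.prodUnique ℤ (Fin 0 → ℤ)).symm.tsum_eq]
  rfl

theorem hasSum_norm_sq_shifts_int {ι : Type*} {f : ℤ → ℂ} (hf : (Function.support f).Finite)
    (S : Finset ι) (t : ι → ℤ) :
    HasSum (fun z : ℤ => ‖∑ j ∈ S, f (z + t j)‖ ^ 2)
      (∑ j ∈ S, ∑ j' ∈ S, (∑' z, multDiff (t j' - t j) f z).re) := by
  have h := hasSum_norm_sq_shifts hf 0 S t
  simp only [gowersRe, gowersSum_zero] at h
  exact ((Equiv.prodUnique ℤ (Fin 0 → ℤ)).symm.hasSum_iff).2 h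

/-- Replacing `z` by `z - n` frees `c` from `n`, so Cauchy–Schwarz over `(θ, z)` removes it. The
window is widened by `r` to hold all the shifted supports. -/
theorem cube_cauchySchwarz_family {ι : Type*} (Θ : Finset ι) (𝒩 : Finset ℤ) {a b r : ℤ}
    {f c : ι → ℤ → ℂ} {w V : ℝ} (hf : ∀ θ, Function.support (f θ) ⊆ Set.Icc a b)
    (hc : ∀ θ z, ‖c θ z‖ ≤ 1) (hr : ∀ n ∈ 𝒩, |n| ≤ r)
    (hw : ((Finset.Icc (a - r) (b + r)).card : ℝ) ≤ w) (hV0 : 0 ≤ V)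
    (hV : Θ.card * 𝒩.card * V ≤ ∑ θ ∈ Θ, ‖∑ n ∈ 𝒩, ∑' z, f θ z * c θ (z + n)‖) :
    Θ.card * 𝒩.card ^ 2 * V ^ 2 ≤
      w * ∑ θ ∈ Θ, ∑ n ∈ 𝒩, ∑ n' ∈ 𝒩, (∑' z, multDiff (n - n') (f θ) z).re := by
  rcases Θ.eq_empty_or_nonempty with rfl | hne
  · simp
  have hcard : (0 : ℝ) < Θ.card := by exact_mod_cast hne.card_pos
  set W := Finset.Icc (a - r) (b + r)
  have hfin : ∀ θ, (Function.support (f θ)).Finite := fun θ => (Set.finite_Icc a b).subset (hf θ)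
  have h1 : ∀ θ, ‖∑ n ∈ 𝒩, ∑' z, f θ z * c θ (z + n)‖ ≤ ∑ z ∈ W, ‖∑ n ∈ 𝒩, f θ (z + -n)‖ := by
    intro θ
    have h2 : ∀ n ∈ 𝒩, ∑' z, f θ z * c θ (z + n) = ∑ z ∈ W, c θ z * f θ (z + -n) := by
      intro n hn
      rw [← (Equiv.addRight (-n)).tsum_eq, tsum_eq_sum (s := W)]
      · refine Finset.sum_congr rfl fun z _ => ?_
        simp [mul_comm]
      · intro z hz
        have : f θ (z + -n) = 0 := by
          by_contra h
          have h3 := hf θ h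
          have h4 := abs_le.1 (hr n hn)
          refine hz ?_
          simp only [Set.mem_Icc, W, Finset.mem_Icc] at h3 ⊢
          constructor <;> linarith [h3.1, h3.2]
        simp [this]
    rw [Finset.sum_congr rfl h2, Finset.sum_comm]
    refine (norm_sum_le _ _).trans (Finset.sum_le_sum fun z _ => ?_)
    rw [← Finset.mul_sum, norm_mul]
    exact mul_le_of_le_one_left (norm_nonneg _) (hc θ z)
  have h2 : Θ.card * 𝒩.card * V ≤ ∑ p ∈ Θ ×ˢ W, ‖∑ n ∈ 𝒩, f p.1 (p.2 + -n)‖ := by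
    rw [Finset.sum_product]
    exact hV.trans (Finset.sum_le_sum fun θ _ => h1 θ)
  have h3 := sq_sum_le_card_mul_sum_sq (s := Θ ×ˢ W) (f := fun p => ‖∑ n ∈ 𝒩, f p.1 (p.2 + -n)‖)
  have h4 : ∑ p ∈ Θ ×ˢ W, ‖∑ n ∈ 𝒩, f p.1 (p.2 + -n)‖ ^ 2 ≤
      ∑ θ ∈ Θ, ∑ n ∈ 𝒩, ∑ n' ∈ 𝒩, (∑' z, multDiff (n - n') (f θ) z).re := by
    rw [Finset.sum_product]
    refine Finset.sum_le_sum fun θ _ => ?_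
    have h := hasSum_norm_sq_shifts_int (hfin θ) 𝒩 (fun n => -n)
    refine (sum_le_hasSum W (fun _ _ => by positivity) h).trans ?_
    refine Finset.sum_le_sum fun n _ => Finset.sum_le_sum fun n' _ => ?_
    rw [show -n' - -n = n - n' by ring]
  have h5 : (Θ.card * 𝒩.card * V) ^ 2 ≤ (Θ.card * w) * ∑ θ ∈ Θ, ∑ n ∈ 𝒩, ∑ n' ∈ 𝒩,
      (∑' z, multDiff (n - n') (f θ) z).re := by
    refine (pow_le_pow_left₀ (by positivity) h2 2).trans (h3.trans ?_)
    have hw0 : 0 ≤ w := (Nat.cast_nonneg _).trans hw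
    rw [Finset.card_product, Nat.cast_mul]
    gcongr
  refine le_of_mul_le_mul_left ?_ hcard
  linarith

/-! ### Concatenation along products of two parameters. -/

/-- A sum of a nonnegative function over the values `l'a' - la` on a fibre with fixed `l`, `l'`. -/
theorem sum_fiber_le {c : ℤ → ℝ} {C : ℝ} (hc : HasSum c C) (hc0 : ∀ n, 0 ≤ c n) {N A : ℕ}
    (hA : 0 < A) (hAN : A ≤ N) {l l' : ℤ} (hll : (A : ℤ) * Int.gcd l l' ≤ |l'|) (hl' : l' ≠ 0)
    (P : Finset ((ℤ × ℤ) × (ℤ × ℤ)))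
    (hP : ∀ x ∈ P, x.1.1 = l ∧ x.2.1 = l' ∧ |x.1.2| ≤ 2 * N) :
    ∑ x ∈ P, c (2 * x.2.1 * x.2.2 - 2 * x.1.1 * x.1.2) ≤ (6 * N / A) * C := by
  have hA' : (0 : ℤ) < A := by exact_mod_cast hA
  have hC : 0 ≤ C := hc.nonneg hc0
  -- Cut the range of `a` into blocks of length `A`. Within a block the values `2l'a' - 2la` are
  -- distinct, so each block contributes at most the full sum `C`.
  set K : Finset ℤ := Finset.Icc ((-(2 * N : ℤ)) / A) ((2 * N : ℤ) / A)
  have hmap : ∀ x ∈ P, x.1.2 / (A : ℤ) ∈ K := by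
    intro x hx
    have h := abs_le.1 (hP x hx).2.2
    rw [Finset.mem_Icc]
    exact ⟨Int.ediv_le_ediv hA' h.1, Int.ediv_le_ediv hA' h.2⟩
  have hK : (K.card : ℝ) ≤ 6 * N / A := by
    rw [le_div_iff₀ (by exact_mod_cast hA), Int.card_Icc]
    have h1 : (2 * N : ℤ) / A * A ≤ 2 * N := Int.ediv_mul_le _ hA'.ne'
    have h2 : (-(2 * N : ℤ)) < ((-(2 * N : ℤ)) / A + 1) * A := Int.lt_ediv_add_one_mul_self _ hA'
    have h0 : (-(2 * N : ℤ)) / A ≤ (2 * N : ℤ) / A := Int.ediv_le_ediv hA' (by omega)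
    have h3 : (((2 * N : ℤ) / A + 1 - (-(2 * N : ℤ)) / A).toNat : ℤ) =
      (2 * N : ℤ) / A + 1 - (-(2 * N : ℤ)) / A := Int.toNat_of_nonneg (by linarith)
    have h4 : (((2 * N : ℤ) / A + 1 - (-(2 * N : ℤ)) / A).toNat : ℤ) * A ≤ 6 * N := by
      rw [h3]
      have : (A : ℤ) ≤ N := by exact_mod_cast hAN
      linarith
    exact_mod_cast h4
  rw [← Finset.sum_fiberwise_of_maps_to hmap]
  have hf : ∀ q ∈ K, ∑ x ∈ P.filter (fun x => x.1.2 / (A : ℤ) = q),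
      c (2 * x.2.1 * x.2.2 - 2 * x.1.1 * x.1.2) ≤ C := by
    intro q _
    rw [← Finset.sum_image (f := c) (g := fun x : (ℤ × ℤ) × (ℤ × ℤ) =>
      2 * x.2.1 * x.2.2 - 2 * x.1.1 * x.1.2)]
    · exact sum_le_hasSum _ (fun n _ => hc0 n) hc
    · rintro ⟨⟨x1, x2⟩, ⟨x3, x4⟩⟩ hx ⟨⟨y1, y2⟩, ⟨y3, y4⟩⟩ hy hxy
      simp only [Finset.coe_filter, Set.mem_ofPred_eq] at hx hy hxy
      obtain ⟨hx, hxq⟩ := hx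
      obtain ⟨hy, hyq⟩ := hy
      obtain ⟨hx1, hx3, _⟩ := hP _ hx
      obtain ⟨hy1, hy3, _⟩ := hP _ hy
      simp only at hx1 hx3 hy1 hy3
      subst hx1 hx3 hy1 hy3
      have hlt : |x2 - y2| < A := by
        have e1 := Int.emod_add_mul_ediv x2 A
        have e2 := Int.emod_add_mul_ediv y2 A
        rw [hxq] at e1
        rw [hyq] at e2
        have b1 := Int.emod_nonneg x2 hA'.ne'
        have b2 := Int.emod_lt_of_pos x2 hA'
        have b3 := Int.emod_nonneg y2 hA'.ne'
        have b4 := Int.emod_lt_of_pos y2 hA'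
        rw [abs_lt]
        constructor <;> linarith
      have hg : (0 : ℤ) < Int.gcd y1 y3 := by exact_mod_cast Int.gcd_pos_of_ne_zero_right _ hl'
      have := eq_of_linear_eq (l := y1) (k := y3) (a₁ := x2) (a₂ := y2) (b₁ := -x4) (b₂ := -y4) hl'
        (by linarith) (lt_of_lt_of_le (mul_lt_mul_of_pos_right hlt hg) hll)
      obtain ⟨h1, h2⟩ := this
      rw [h1, neg_injective h2]
  calc _ ≤ ∑ q ∈ K, C := Finset.sum_le_sum hf
    _ = K.card * C := by rw [Finset.sum_const, nsmul_eq_mul]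
    _ ≤ _ := by gcongr

/-- Averages of Gowers sums along multiples `2la` are controlled by a Gowers sum of one degree
more. -/
theorem gowersRe_concatenation {N U W s : ℕ} (hs : 1 ≤ s) (hU : 0 < U) (hW : 0 < W)
    (hN : U * (1800 * W ^ 2) ≤ N) {f : ℤ → ℂ} (hf : (Function.support f).Finite) {Y : ℝ} (hY : 0 < Y)
    (hfY : ∀ n, gowersRe s (multDiff n f) ≤ Y) (S : Finset (ℤ × ℤ))
    (hS : ∀ p ∈ S, (N : ℤ) ≤ U * |p.1| ∧ |p.1| ≤ 3 * N ∧ |p.2| ≤ 2 * N)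
    (h : N ^ 2 * Y ≤ W * ∑ p ∈ S, gowersRe s (multDiff (2 * p.1 * p.2) f)) :
    N ^ 2 * Y ≤ 2 ^ 22 * U * W ^ 4 * gowersRe (s + 1) f := by
  -- With this threshold the pairs of gcd above `Q` account for at most half of `(N² Y)²` after
  -- Cauchy–Schwarz.
  set Q := 1800 * W ^ 2 with hQ
  have hQ0 : 0 < Q := by positivity
  -- The largest block length with `A U Q ≤ N`, whence `A gcd(l, l') ≤ A Q ≤ |l'|` as the
  -- injectivity on blocks requires.
  set A := N / (U * Q) with hAdef
  have hUQ : 0 < U * Q := by positivity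
  have hA : 0 < A := Nat.div_pos hN hUQ
  have hN0 : 0 < N := hUQ.trans_le hN
  have hA1 : A * (U * Q) ≤ N := Nat.div_mul_le_self _ _
  have hA2 : N < 2 * A * (U * Q) := by
    have := Nat.lt_div_mul_add (a := N) hUQ
    rw [← hAdef] at this
    nlinarith
  set c : ℤ → ℝ := fun n => gowersRe s (multDiff n f) with hc
  have hcs : HasSum c (gowersRe (s + 1) f) := gowersRe_succ s hf
  have hc0 : ∀ n, 0 ≤ c n := fun n => gowersRe_nonneg hs (multDiff_finite_support hf n)
  set g := gowersRe (s + 1) f with hg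
  have hg0 : 0 ≤ g := hcs.nonneg hc0
  have hCS := sq_sum_gowersRe_le hf s S (fun p => 2 * p.1 * p.2)
  rw [← Finset.sum_product'] at hCS
  change _ ≤ c 0 * ∑ x ∈ S ×ˢ S, c (2 * x.2.1 * x.2.2 - 2 * x.1.1 * x.1.2) at hCS
  rw [← Finset.sum_filter_add_sum_filter_not (S ×ˢ S)
    (fun x => Q < Int.gcd x.1.1 x.2.1)] at hCS
  have hne : ∀ p ∈ S, p.1 ≠ 0 := by
    intro p hp h0
    have := (hS p hp).1
    rw [h0] at this
    simp at this
    omega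
  -- pairs with a large common divisor
  have hbad : ∑ x ∈ (S ×ˢ S).filter (fun x => Q < Int.gcd x.1.1 x.2.1),
      c (2 * x.2.1 * x.2.2 - 2 * x.1.1 * x.1.2) ≤ 900 * N ^ 4 / Q * Y := by
    have h1 : (((S ×ˢ S).filter (fun x => Q < Int.gcd x.1.1 x.2.1)).card : ℝ) ≤
        900 * N ^ 4 / Q := by
      set I := Finset.Icc (-(2 * N : ℤ)) (2 * N)
      set D := (Finset.Icc (-((3 * N : ℕ) : ℤ)) (3 * N : ℕ) ×ˢ
        Finset.Icc (-((3 * N : ℕ) : ℤ)) (3 * N : ℕ)).filter fun p : ℤ × ℤ =>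
        p.1 ≠ 0 ∧ p.2 ≠ 0 ∧ Q < Int.gcd p.1 p.2
      have hinj : ((S ×ˢ S).filter (fun x => Q < Int.gcd x.1.1 x.2.1)).card ≤
          (D ×ˢ (I ×ˢ I)).card := by
        refine Finset.card_le_card_of_injOn (fun x => ((x.1.1, x.2.1), (x.1.2, x.2.2))) ?_ ?_
        · rintro x hx
          simp only [Finset.coe_filter, Finset.mem_product, Set.mem_ofPred_eq] at hx
          obtain ⟨⟨h1, h2⟩, h3⟩ := hx
          have a1 := abs_le.1 (hS _ h1).2.1
          have a2 := abs_le.1 (hS _ h1).2.2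
          have a3 := abs_le.1 (hS _ h2).2.1
          have a4 := abs_le.1 (hS _ h2).2.2
          simp only [D, I, Finset.coe_product, Finset.coe_filter, Set.mem_prod, Set.mem_ofPred_eq,
            Finset.mem_product, Finset.mem_Icc, Finset.coe_Icc, Set.mem_Icc]
          push_cast
          exact ⟨⟨⟨a1, a3⟩, hne _ h1, hne _ h2, h3⟩, a2, a4⟩
        · rintro ⟨⟨x1, x2⟩, ⟨x3, x4⟩⟩ _ ⟨⟨y1, y2⟩, ⟨y3, y4⟩⟩ _ h
          simp only [Prod.mk.injEq] at h ⊢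
          tauto
      have hI : (I.card : ℝ) ≤ 5 * N := by
        have : I.card = 4 * N + 1 := by
          rw [Int.card_Icc]; omega
        rw [this]
        have : (1 : ℝ) ≤ N := by exact_mod_cast hN0
        push_cast
        linarith
      have hD := card_large_gcd_le (3 * N) Q hQ0
      calc _ ≤ ((D ×ˢ (I ×ˢ I)).card : ℝ) := by exact_mod_cast hinj
        _ = D.card * (I.card * I.card) := by rw [Finset.card_product, Finset.card_product]; push_cast; ring
        _ ≤ (4 * ((3 * N : ℕ) : ℝ) ^ 2 / Q) * ((5 * N) * (5 * N)) := by gcongr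
        _ = _ := by push_cast; ring
    calc _ ≤ ∑ x ∈ (S ×ˢ S).filter (fun x => Q < Int.gcd x.1.1 x.2.1), Y :=
          Finset.sum_le_sum fun x _ => hfY _
      _ = (((S ×ˢ S).filter (fun x => Q < Int.gcd x.1.1 x.2.1)).card : ℝ) * Y := by
          rw [Finset.sum_const, nsmul_eq_mul]
      _ ≤ _ := by gcongr
  -- pairs with a small common divisor
  have hgood : ∑ x ∈ (S ×ˢ S).filter (fun x => ¬ Q < Int.gcd x.1.1 x.2.1),
      c (2 * x.2.1 * x.2.2 - 2 * x.1.1 * x.1.2) ≤ 49 * N ^ 2 * ((6 * N / A) * g) := by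
    set I := Finset.Icc (-(3 * N : ℤ)) (3 * N)
    have hmap : ∀ x ∈ (S ×ˢ S).filter (fun x => ¬ Q < Int.gcd x.1.1 x.2.1),
        (x.1.1, x.2.1) ∈ I ×ˢ I := by
      intro x hx
      simp only [Finset.mem_filter, Finset.mem_product] at hx
      have a1 := abs_le.1 (hS _ hx.1.1).2.1
      have a3 := abs_le.1 (hS _ hx.1.2).2.1
      simp only [I, Finset.mem_product, Finset.mem_Icc]
      exact ⟨a1, a3⟩
    have hI : (I.card : ℝ) ≤ 7 * N := by
      have : I.card = 6 * N + 1 := by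
        rw [Int.card_Icc]; omega
      rw [this]
      have : (1 : ℝ) ≤ N := by exact_mod_cast hN0
      push_cast
      linarith
    rw [← Finset.sum_fiberwise_of_maps_to hmap]
    have hb : ∀ q ∈ I ×ˢ I, ∑ x ∈ ((S ×ˢ S).filter (fun x => ¬ Q < Int.gcd x.1.1 x.2.1)).filter
        (fun x => (x.1.1, x.2.1) = q), c (2 * x.2.1 * x.2.2 - 2 * x.1.1 * x.1.2) ≤ (6 * N / A) * g := by
      rintro ⟨l, l'⟩ _
      by_cases hll : Int.gcd l l' ≤ Q ∧ l' ≠ 0 ∧ (N : ℤ) ≤ U * |l'|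
      · obtain ⟨hll, hl', hNl⟩ := hll
        refine sum_fiber_le (l := l) hcs hc0 hA ?_ ?_ hl' _ ?_
        · nlinarith
        · have h1 : ((A * (U * Q) : ℕ) : ℤ) ≤ U * |l'| := le_trans (by exact_mod_cast hA1) hNl
          have h2 : (U : ℤ) * (A * Q) ≤ U * |l'| := by push_cast at h1 ⊢; linarith
          have h3 : (A : ℤ) * Q ≤ |l'| := le_of_mul_le_mul_left h2 (by exact_mod_cast hU)
          refine le_trans ?_ h3
          gcongr
        · intro x hx
          simp only [Finset.mem_filter, Finset.mem_product, Prod.mk.injEq] at hx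
          exact ⟨hx.2.1, hx.2.2, (hS _ hx.1.1.1).2.2⟩
      · rw [Finset.filter_false_of_mem, Finset.sum_empty]
        · positivity
        · intro x hx hxq
          simp only [Finset.mem_filter, Finset.mem_product, Prod.mk.injEq, not_lt] at hx hxq
          refine hll ⟨?_, ?_, ?_⟩
          · rw [← hxq.1, ← hxq.2]; exact hx.2
          · rw [← hxq.2]; exact hne _ hx.1.2
          · rw [← hxq.2]; exact (hS _ hx.1.2).1
    calc _ ≤ ∑ q ∈ I ×ˢ I, (6 * N / A) * g := Finset.sum_le_sum hb
      _ = (I.card * I.card) * ((6 * N / A) * g) := by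
        rw [Finset.sum_const, nsmul_eq_mul, Finset.card_product]; push_cast; ring
      _ ≤ ((7 * N) * (7 * N)) * ((6 * N / A) * g) := by gcongr
      _ = _ := by ring
  set X := ∑ p ∈ S, gowersRe s (multDiff (2 * p.1 * p.2) f)
  have hX : X ^ 2 ≤ Y * (900 * N ^ 4 / Q * Y + 49 * N ^ 2 * ((6 * N / A) * g)) := by
    refine hCS.trans ?_
    have h1 := add_le_add hbad hgood
    have h2 := hfY 0
    have h3 : 0 ≤ 900 * (N : ℝ) ^ 4 / Q * Y + 49 * N ^ 2 * ((6 * N / A) * g) := by positivity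
    exact (mul_le_mul_of_nonneg_left h1 (hc0 0)).trans (mul_le_mul_of_nonneg_right h2 h3)
  have hNr : (0 : ℝ) < N := by exact_mod_cast hN0
  have hAr : (0 : ℝ) < A := by exact_mod_cast hA
  have hWr : (0 : ℝ) < W := by exact_mod_cast hW
  have hUr : (0 : ℝ) < U := by exact_mod_cast hU
  have hQr : (Q : ℝ) = 1800 * W ^ 2 := by rw [hQ]; push_cast; ring
  have h2 : (N ^ 2 * Y) ^ 2 ≤ (W : ℝ) ^ 2 *
      (Y * (900 * N ^ 4 / Q * Y + 49 * N ^ 2 * ((6 * N / A) * g))) := by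
    calc (N ^ 2 * Y) ^ 2 ≤ (W * X) ^ 2 := pow_le_pow_left₀ (by positivity) h 2
      _ = W ^ 2 * X ^ 2 := by ring
      _ ≤ _ := by gcongr
  have h3 : (W : ℝ) ^ 2 * (Y * (900 * N ^ 4 / Q * Y + 49 * N ^ 2 * ((6 * N / A) * g))) =
      (N ^ 2 * Y) ^ 2 / 2 + 294 * W ^ 2 * Y * N ^ 3 * g / A := by
    rw [hQr]; field_simp; ring
  rw [h3] at h2
  have h4 : (N ^ 2 * Y) ^ 2 / 2 ≤ 294 * (W : ℝ) ^ 2 * Y * N ^ 3 * g / A := by linarith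
  rw [le_div_iff₀ hAr] at h4
  have h5 : (Y * N ^ 3) * (N * Y * A) ≤ (Y * N ^ 3) * (588 * (W : ℝ) ^ 2 * g) := by nlinarith
  have h6 := le_of_mul_le_mul_left h5 (by positivity)
  have h7 : (N : ℝ) ≤ 2 * A * (U * (1800 * W ^ 2)) := by
    rw [← hQr]; exact_mod_cast hA2.le
  calc (N : ℝ) ^ 2 * Y = N * (N * Y) := by ring
    _ ≤ (2 * A * (U * (1800 * W ^ 2))) * (N * Y) := by gcongr
    _ = (3600 * U * W ^ 2) * (N * Y * A) := by ring
    _ ≤ (3600 * U * W ^ 2) * (588 * (W : ℝ) ^ 2 * g) := by gcongr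
    _ = 2116800 * (U * W ^ 4 * g) := by ring
    _ ≤ 2 ^ 22 * (U * W ^ 4 * g) := by gcongr; norm_num
    _ = _ := by ring

/-! ### From linear averages to periodic functions. -/

/-- Replace `d` by `d + i + j` and `z` by `p + 2ki + 2lj`: in `z - 2dk` the terms in `i` cancel, in
`z - 2dl` those in `j`. Averaging over `i, j < M` costs only end errors in `d`, and some `(d, p)` is
as good as the average. -/
theorem exists_box_correlation {N M : ℕ} {T : ℝ} (hT : 0 < T) (hN : 0 < N) (hM : 0 < M)
    (hMN : 24 * M ≤ N) (hTM : 32 * T * M ≤ N) {F φ ψ : ℤ → ℂ} (hF : ∀ z, ‖F z‖ ≤ 1)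
    (hφ : ∀ z, ‖φ z‖ ≤ 1) (hψ : ∀ z, ‖ψ z‖ ≤ 1)
    (hsF : Function.support F ⊆ Set.Icc 1 (2 * (N : ℤ) ^ 2)) {k l : ℤ} (hk : |k| ≤ 3 * N)
    (hl : |l| ≤ 3 * N) {a b : ℤ} (hI : (Finset.Icc a b).card ≤ 2 * N)
    (h : N ^ 3 ≤ T * ‖∑ d ∈ Finset.Icc a b, ∑' z, F z * φ (z - 2 * d * k) * ψ (z - 2 * d * l)‖) :
    ∃ (p : ℤ) (α β : ℕ → ℂ), (∀ i, ‖α i‖ ≤ 1) ∧ (∀ i, ‖β i‖ ≤ 1) ∧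
      M ^ 2 ≤ 16 * T * ‖∑ i ∈ Finset.range M, ∑ j ∈ Finset.range M,
        F (p + 2 * k * i + 2 * l * j) * α i * β j‖ := by
  set Y : ℤ → ℂ := fun d => ∑' z, F z * φ (z - 2 * d * k) * ψ (z - 2 * d * l) with hY
  set J := Finset.Icc (1 : ℤ) (2 * (N : ℤ) ^ 2)
  have hF0 : ∀ z ∉ J, F z = 0 := fun z hz => by
    by_contra h0
    exact hz (by simpa [J] using hsF h0)
  have hJ : (J.card : ℝ) = 2 * N ^ 2 := by
    have : J.card = 2 * N ^ 2 := by
      rw [Int.card_Icc];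
      have : (2 * (N : ℤ) ^ 2 + 1 - 1) = ((2 * N ^ 2 : ℕ) : ℤ) := by push_cast; ring
      rw [this, Int.toNat_natCast]
    rw [this]; push_cast; ring
  have hYb : ∀ d, ‖Y d‖ ≤ 2 * N ^ 2 := by
    intro d
    rw [hY]
    simp only
    rw [tsum_eq_sum (s := J) (fun z hz => by simp [hF0 z hz])]
    refine (norm_sum_le_of_le (n := fun _ => (1 : ℝ)) _ fun z _ => ?_).trans ?_
    · rw [norm_mul, norm_mul]
      exact mul_le_one₀ (mul_le_one₀ (hF _) (norm_nonneg _) (hφ _)) (norm_nonneg _) (hψ _)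
    · simp [hJ]
  -- The shift `2ki + 2lj` is at most `12MN` in modulus.
  set P := Finset.Icc (1 - 12 * (M : ℤ) * N) (2 * (N : ℤ) ^ 2 + 12 * M * N)
  have hP : (P.card : ℝ) ≤ 3 * N ^ 2 := by
    have h1 : P.card = 2 * N ^ 2 + 24 * M * N := by
      rw [Int.card_Icc]
      have : (2 * (N : ℤ) ^ 2 + 12 * M * N + 1 - (1 - 12 * (M : ℤ) * N)) =
        ((2 * N ^ 2 + 24 * M * N : ℕ) : ℤ) := by push_cast; ring
      rw [this, Int.toNat_natCast]
    rw [h1]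
    have : 2 * N ^ 2 + 24 * M * N ≤ 3 * N ^ 2 := by nlinarith
    exact_mod_cast this
  set Z : ℤ → ℤ → ℂ := fun d p => ∑ i ∈ Finset.range M, ∑ j ∈ Finset.range M,
    F (p + 2 * k * i + 2 * l * j) * ψ (p - 2 * d * l + 2 * (k - l) * i) *
      φ (p - 2 * d * k + 2 * (l - k) * j) with hZ
  have hYshift : ∀ d, ∑ i ∈ Finset.range M, ∑ j ∈ Finset.range M, Y (d + (i + j : ℕ)) =
      ∑ p ∈ P, Z d p := by
    intro d
    rw [hZ, Finset.sum_comm]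
    simp only
    rw [Finset.sum_comm]
    rw [Finset.sum_comm (s := P)]
    refine Finset.sum_congr rfl fun i hi => ?_
    rw [Finset.sum_comm (s := P)]
    refine Finset.sum_congr rfl fun j hj => ?_
    rw [hY]
    simp only
    rw [← (Equiv.addRight (2 * k * (i : ℤ) + 2 * l * j)).tsum_eq, tsum_eq_sum (s := P)]
    · refine Finset.sum_congr rfl fun p _ => ?_
      simp only [Equiv.coe_addRight]
      push_cast
      rw [mul_right_comm, ← add_assoc]
      congr 3 <;> ring
    · intro p hp
      have : F (p + (2 * k * (i : ℤ) + 2 * l * j)) = 0 := by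
        refine hF0 _ fun hmem => hp ?_
        simp only [J, P, Finset.mem_Icc] at hmem ⊢
        have hb : ∀ (x : ℤ) (n : ℕ), |x| ≤ 3 * N → n ∈ Finset.range M →
            -(3 * N * M : ℤ) ≤ x * n ∧ x * n ≤ 3 * N * M := by
          intro x n hx hn
          rw [← abs_le, abs_mul, Nat.abs_cast]
          have : (n : ℤ) ≤ M := by exact_mod_cast (Finset.mem_range.1 hn).le
          gcongr
        have b1 := hb k i hk hi
        have b2 := hb l j hl hj
        constructor <;> nlinarith
      simp only [Equiv.coe_addRight, this, zero_mul]
  have hdiff : ∀ i ∈ Finset.range M, ∀ j ∈ Finset.range M, ‖∑ d ∈ Finset.Icc a b, Y d -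
      ∑ d ∈ Finset.Icc a b, Y (d + (i + j : ℕ))‖ ≤ 8 * M * N ^ 2 := by
    intro i hi j hj
    refine (norm_sum_Icc_sub_shift_le a b ((i + j : ℕ) : ℤ) hYb).trans ?_
    rw [Int.cast_natCast, Nat.abs_cast]
    have : ((i + j : ℕ) : ℝ) ≤ 2 * M := by
      have h1 := Finset.mem_range.1 hi
      have h2 := Finset.mem_range.1 hj
      exact_mod_cast (by omega : i + j ≤ 2 * M)
    nlinarith [sq_nonneg (N : ℝ)]
  set E := ∑ d ∈ Finset.Icc a b, Y d
  have hmain : (M : ℂ) ^ 2 * E = ∑ d ∈ Finset.Icc a b, ∑ p ∈ P, Z d p +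
      ∑ i ∈ Finset.range M, ∑ j ∈ Finset.range M,
        (E - ∑ d ∈ Finset.Icc a b, Y (d + (i + j : ℕ))) := by
    have h1 : ∑ i ∈ Finset.range M, ∑ j ∈ Finset.range M, ∑ d ∈ Finset.Icc a b, Y (d + (i + j : ℕ)) =
        ∑ d ∈ Finset.Icc a b, ∑ p ∈ P, Z d p := by
      rw [← Finset.sum_congr rfl fun d _ => hYshift d, Finset.sum_comm (s := Finset.Icc a b)]
      exact Finset.sum_congr rfl fun i _ => Finset.sum_comm
    simp only [Finset.sum_sub_distrib, Finset.sum_const, Finset.card_range, nsmul_eq_mul]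
    rw [h1]
    ring
  have hnorm : (M : ℝ) ^ 2 * ‖E‖ ≤ ∑ d ∈ Finset.Icc a b, ∑ p ∈ P, ‖Z d p‖ +
      M ^ 2 * (8 * M * N ^ 2) := by
    have : (M : ℝ) ^ 2 * ‖E‖ = ‖(M : ℂ) ^ 2 * E‖ := by
      rw [norm_mul, norm_pow, Complex.norm_natCast]
    rw [this, hmain]
    refine (norm_add_le _ _).trans (add_le_add ?_ ?_)
    · exact (norm_sum_le _ _).trans (Finset.sum_le_sum fun d _ => norm_sum_le _ _)
    · refine (norm_sum_le_of_le (n := fun _ => (M : ℝ) * (8 * M * N ^ 2)) _ fun i hi => ?_).trans ?_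
      · refine (norm_sum_le_of_le _ (hdiff i hi)).trans ?_
        simp
      · simp only [Finset.sum_const, Finset.card_range, nsmul_eq_mul]
        exact le_of_eq (by ring)
  have hMr : (0 : ℝ) < M := by exact_mod_cast hM
  have hNr : (0 : ℝ) < N := by exact_mod_cast hN
  suffices hex : ∃ d p, (M : ℝ) ^ 2 ≤ 16 * T * ‖Z d p‖ by
    obtain ⟨d, p, hdp⟩ := hex
    exact ⟨p, fun i => ψ (p - 2 * d * l + 2 * (k - l) * i),
      fun j => φ (p - 2 * d * k + 2 * (l - k) * j), fun i => hψ _, fun j => hφ _, hdp⟩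
  by_contra! hc
  -- If every box sum were small, the main term would be at most `3/8` and the end errors at most
  -- `1/4` of the required total.
  have hle : ∑ d ∈ Finset.Icc a b, ∑ p ∈ P, ‖Z d p‖ ≤ (2 * N) * ((3 * N ^ 2) * (M ^ 2 / (16 * T))) := by
    have h1 : ∀ d p, ‖Z d p‖ ≤ M ^ 2 / (16 * T) := fun d p => by
      rw [le_div_iff₀ (by positivity)]
      linarith [hc d p]
    have h2 : ∀ d ∈ Finset.Icc a b, ∑ p ∈ P, ‖Z d p‖ ≤ (3 * N ^ 2) * (M ^ 2 / (16 * T)) := by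
      intro d _
      refine (Finset.sum_le_sum fun p _ => h1 d p).trans ?_
      rw [Finset.sum_const, nsmul_eq_mul]
      gcongr
    refine (Finset.sum_le_sum h2).trans ?_
    rw [Finset.sum_const, nsmul_eq_mul]
    gcongr
    exact_mod_cast hI
  have h3 : (M : ℝ) ^ 2 * N ^ 3 ≤ T * (M ^ 2 * ‖E‖) := by
    calc (M : ℝ) ^ 2 * N ^ 3 ≤ M ^ 2 * (T * ‖E‖) := by gcongr
      _ = _ := by ring
  have h4 : T * ((2 * N) * ((3 * N ^ 2) * (M ^ 2 / (16 * T)))) = (3 / 8) * (M ^ 2 * (N : ℝ) ^ 3) := by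
    field_simp; ring
  have h5 : T * ((M : ℝ) ^ 2 * (8 * M * N ^ 2)) ≤ (1 / 4) * (M ^ 2 * (N : ℝ) ^ 3) := by
    calc T * ((M : ℝ) ^ 2 * (8 * M * (N : ℝ) ^ 2)) =
          (1 / 4) * ((M : ℝ) ^ 2 * (N : ℝ) ^ 2 * (32 * T * M)) := by ring
      _ ≤ (1 / 4) * ((M : ℝ) ^ 2 * (N : ℝ) ^ 2 * N) := by gcongr
      _ = _ := by ring
  have h6 : T * (M ^ 2 * ‖E‖) ≤ (3 / 8) * (M ^ 2 * (N : ℝ) ^ 3) + (1 / 4) * (M ^ 2 * (N : ℝ) ^ 3) := by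
    calc T * (M ^ 2 * ‖E‖) ≤ T * ((2 * N) * ((3 * N ^ 2) * (M ^ 2 / (16 * T))) +
          M ^ 2 * (8 * M * N ^ 2)) := by gcongr; linarith
      _ ≤ _ := by rw [mul_add, h4]; linarith
  have h7 : 0 < (M : ℝ) ^ 2 * (N : ℝ) ^ 3 := by positivity
  linarith

theorem Function.Periodic.eq_of_dvd_sub {w : ℤ → ℂ} {c : ℤ} (hw : Function.Periodic w c) {x y : ℤ}
    (h : c ∣ x - y) : w x = w y := by
  obtain ⟨n, hn⟩ := h
  have := hw.int_mul n y
  rw [← this, Int.cast_id, mul_comm, ← hn, add_sub_cancel]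

/-- The classes of the `w i` modulo `c` are distinct, so at most one term survives. -/
theorem norm_sum_ite_dvd_le {M : ℕ} {c z : ℤ} {w : ℕ → ℤ} {α : ℕ → ℂ} (hα : ∀ i, ‖α i‖ ≤ 1)
    (hw : ∀ i < M, ∀ j < M, c ∣ w i - w j → i = j) :
    ‖∑ i ∈ Finset.range M, if c ∣ z - w i then α i else 0‖ ≤ 1 := by
  by_cases h : ∃ i < M, c ∣ z - w i
  · obtain ⟨i, hi, hc⟩ := h
    rw [Finset.sum_eq_single i]
    · rw [if_pos hc]; exact hα i
    · intro j hj hji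
      rw [if_neg]
      intro hc'
      refine hji (hw j (Finset.mem_range.1 hj) i hi ?_)
      have := dvd_sub hc hc'
      rwa [sub_sub_sub_cancel_left] at this
    · intro h; exact absurd (Finset.mem_range.2 hi) h
  · push Not at h
    rw [Finset.sum_eq_zero fun i hi => if_neg (h i (Finset.mem_range.1 hi))]
    simp

theorem periodic_sum_ite_dvd (M : ℕ) (c : ℤ) (w : ℕ → ℤ) (α : ℕ → ℂ) :
    Function.Periodic (fun z => ∑ i ∈ Finset.range M, if c ∣ z - w i then α i else 0) c := by
  intro z
  refine Finset.sum_congr rfl fun i _ => ?_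
  have : c ∣ z + c - w i ↔ c ∣ z - w i := by
    rw [show z + c - w i = z - w i + c by ring]
    exact dvd_add_self_right
  simp only [this]

/-- Splitting a sum against a periodic function into residue classes. -/
theorem sum_mul_periodic_eq {c : ℤ} (hc : c ≠ 0) (J : Finset ℤ) (H : ℤ → ℂ) {w : ℤ → ℂ}
    (hw : Function.Periodic w c) :
    ∑ z ∈ J, H z * w z =
      ∑ r ∈ Finset.Ico 0 |c|, w r * ∑ y ∈ J, if c ∣ y - r then H y else 0 := by
  simp only [Finset.mul_sum]
  rw [Finset.sum_comm]
  refine Finset.sum_congr rfl fun y _ => ?_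
  have hdvd : c ∣ y - y % |c| := by
    refine (abs_dvd c _).1 ⟨y / |c|, ?_⟩
    have := Int.emod_add_mul_ediv y |c|
    linarith
  rw [Finset.sum_eq_single (y % |c|)]
  · rw [if_pos hdvd, hw.eq_of_dvd_sub hdvd, mul_comm]
  · intro r hr hne
    rw [if_neg, mul_zero]
    intro h
    refine hne ?_
    rw [Finset.mem_Ico] at hr
    have h1 : |c| ∣ y % |c| - r := (abs_dvd c _).2 (by
      have := dvd_sub h hdvd
      rwa [sub_sub_sub_cancel_left] at this)
    have h2 := Int.emod_nonneg y (abs_pos.2 hc).ne'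
    have h3 := Int.emod_lt_of_pos y (abs_pos.2 hc)
    have h4 : |y % |c| - r| < |c| := by rw [abs_lt]; constructor <;> linarith [hr.1, hr.2]
    have := Int.eq_zero_of_abs_lt_dvd h1 h4
    linarith
  · intro h
    refine absurd (Finset.mem_Ico.2 ⟨Int.emod_nonneg y (abs_pos.2 hc).ne',
      Int.emod_lt_of_pos y (abs_pos.2 hc)⟩) h

/-- A correlation of `F` on an interval with the product of a `2l`-periodic function `u` and the
conjugate of a `2k`-periodic function `v`, where `v` is a multiple of the projection of `F u`
onto `2k`-periodic functions. -/
structure PeriodicDatum (F : ℤ → ℂ) (k l : ℤ) (N : ℕ) (W : ℝ) where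
  a : ℤ
  b : ℤ
  u : ℤ → ℂ
  v : ℤ → ℂ
  L : ℝ
  L_pos : 0 < L
  a_le_b : a ≤ b
  length_le : (b - a + 1 : ℝ) ≤ N ^ 2
  length_le_L : (b - a + 1 : ℝ) ≤ 2 * N * L
  N_le : N ≤ W * L
  norm_u_le : ∀ z, ‖u z‖ ≤ 1
  norm_v_le : ∀ z, ‖v z‖ ≤ 1
  periodic_u : Function.Periodic u (2 * l)
  periodic_v : Function.Periodic v (2 * k)
  v_eq : ∀ z, (L : ℂ) * v z = ∑ y ∈ Finset.Icc a b, if 2 * k ∣ y - z then F y * u y else 0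
  le_correlation : N ^ 2 ≤ W * (∑ z ∈ Finset.Icc a b, F z * u z * conj (v z)).re

/-- Put `α i` on the class of `p + 2ki` modulo `2l` and `β j` on the class of `p + 2lj` modulo `2k`.
As `k` and `l` are almost coprime, these classes are distinct for distinct indices, and a pair of
classes meets the interval only at the box point `p + 2ki + 2lj`. -/
theorem exists_periodic_factors {N M T : ℕ} (hM : 0 < M) (hT : 25 ≤ T) (hMT : T ^ 4 * M ≤ N)
    (F : ℤ → ℂ) {k l : ℤ} (hk : |k| ≤ 3 * N)
    (hl : |l| ≤ 3 * N) (hkT : (N : ℤ) ≤ T * |k|) (hlT : (N : ℤ) ≤ T * |l|)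
    (hg : Int.gcd k l ≤ T) {p : ℤ} {α β : ℕ → ℂ} (hα : ∀ i, ‖α i‖ ≤ 1) (hβ : ∀ i, ‖β i‖ ≤ 1) :
    ∃ u v₀ : ℤ → ℂ, (∀ z, ‖u z‖ ≤ 1) ∧ (∀ z, ‖v₀ z‖ ≤ 1) ∧ Function.Periodic u (2 * l) ∧
      Function.Periodic v₀ (2 * k) ∧
      ∑ z ∈ Finset.Icc (p - 12 * M * N) (p + 12 * M * N), F z * u z * v₀ z =
        ∑ i ∈ Finset.range M, ∑ j ∈ Finset.range M, F (p + 2 * k * i + 2 * l * j) * α i * β j := by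
  have hT0 : 0 < T := by omega
  have hN0 : 0 < N := lt_of_lt_of_le (by positivity) hMT
  have hk0 : k ≠ 0 := by rintro rfl; simp at hkT; omega
  have hl0 : l ≠ 0 := by rintro rfl; simp at hlT; omega
  have hTZ : (25 : ℤ) ≤ T := by exact_mod_cast hT
  have hMZ : (1 : ℤ) ≤ M := by exact_mod_cast hM
  have hNZ : (1 : ℤ) ≤ N := by exact_mod_cast hN0
  have hMTZ : (T : ℤ) ^ 4 * M ≤ N := by exact_mod_cast hMT
  have h25 : 25 * (M : ℤ) * T ^ 3 ≤ N := by
    calc 25 * (M : ℤ) * (T : ℤ) ^ 3 ≤ T * M * (T : ℤ) ^ 3 := by gcongr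
      _ = (T : ℤ) ^ 4 * M := by ring
      _ ≤ N := hMTZ
  have hinj : ∀ {x y : ℤ}, y ≠ 0 → (N : ℤ) ≤ T * |y| → Int.gcd x y ≤ T →
      ∀ i < M, ∀ j < M, 2 * y ∣ (p + 2 * x * (i : ℤ)) - (p + 2 * x * (j : ℤ)) → i = j := by
    intro x y hy hNy hxy i hi j hj ⟨n, hn⟩
    have h1 : x * i + y * (-n) = x * j + y * 0 := by linarith
    refine Nat.cast_injective (R := ℤ) (eq_of_linear_eq hy h1 ?_).1
    have h2 : |(i : ℤ) - j| ≤ M := by rw [abs_le]; constructor <;> omega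
    have h3 : (Int.gcd x y : ℤ) ≤ T := by exact_mod_cast hxy
    have h4 : T * (|(i : ℤ) - j| * Int.gcd x y) < T * |y| := by
      calc T * (|(i : ℤ) - j| * Int.gcd x y) ≤ T * (M * T) := by gcongr
        _ = M * T ^ 2 * 1 := by ring
        _ < M * T ^ 2 * (25 * T) := by gcongr; linarith
        _ = 25 * M * T ^ 3 := by ring
        _ ≤ T * |y| := h25.trans hNy
    exact lt_of_mul_lt_mul_left h4 (by positivity)
  set a : ℤ := p - 12 * M * N with ha
  set b : ℤ := p + 12 * M * N with hb
  set J := Finset.Icc a b with hJ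
  set u : ℤ → ℂ := fun z => ∑ i ∈ Finset.range M,
    if 2 * l ∣ z - (p + 2 * k * (i : ℤ)) then α i else 0 with hu
  set v₀ : ℤ → ℂ := fun z => ∑ j ∈ Finset.range M,
    if 2 * k ∣ z - (p + 2 * l * (j : ℤ)) then β j else 0 with hv₀
  have hub : ∀ z, ‖u z‖ ≤ 1 := fun z => norm_sum_ite_dvd_le hα (hinj hl0 hlT hg)
  have hup : Function.Periodic u (2 * l) := periodic_sum_ite_dvd _ _ _ _
  have hv₀b : ∀ z, ‖v₀ z‖ ≤ 1 := fun z =>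
    norm_sum_ite_dvd_le hβ (hinj hk0 hkT (by rwa [Int.gcd_comm]))
  have hv₀p : Function.Periodic v₀ (2 * k) := periodic_sum_ite_dvd _ _ _ _
  have hbox : ∀ i ∈ Finset.range M, ∀ j ∈ Finset.range M,
      ∑ z ∈ J, (if 2 * l ∣ z - (p + 2 * k * (i : ℤ)) then (if 2 * k ∣ z - (p + 2 * l * (j : ℤ))
        then F z else 0) else 0) = F (p + 2 * k * i + 2 * l * j) := by
    intro i hi j hj
    have hbd : ∀ (x : ℤ) (n : ℕ), |x| ≤ 3 * N → n ∈ Finset.range M →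
        -(3 * N * M : ℤ) ≤ x * n ∧ x * n ≤ 3 * N * M := by
      intro x n hx hn
      rw [← abs_le, abs_mul, Nat.abs_cast]
      have : (n : ℤ) ≤ M := by exact_mod_cast (Finset.mem_range.1 hn).le
      gcongr
    have b1 := hbd k i hk hi
    have b2 := hbd l j hl hj
    rw [Finset.sum_eq_single (p + 2 * k * (i : ℤ) + 2 * l * j)]
    · rw [if_pos ⟨j, by ring⟩, if_pos ⟨i, by ring⟩]
    · intro z hz hne
      by_cases h1 : 2 * l ∣ z - (p + 2 * k * (i : ℤ))
      swap
      · rw [if_neg h1]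
      by_cases h2 : 2 * k ∣ z - (p + 2 * l * (j : ℤ))
      swap
      · rw [if_pos h1, if_neg h2]
      exfalso
      obtain ⟨x, hx⟩ := h1
      obtain ⟨y, hy⟩ := h2
      set e := l * (x - j) with he
      have e1 : z - (p + 2 * k * (i : ℤ) + 2 * l * j) = 2 * e := by rw [he]; linarith
      have e2 : e = k * (y - i) := by linarith
      have he0 : e ≠ 0 := by
        intro h0
        apply hne
        rw [h0] at e1
        linarith
      -- Two common points differ by `2e` with `e` a multiple of `k` and of `l`, hence of their
      -- least common multiple, which exceeds `12MN`.
      have hdvd : k * l ∣ Int.gcd k l * e := by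
        have h3 : k * l ∣ k * e := mul_dvd_mul_left k ⟨x - j, he⟩
        have h4 : k * l ∣ l * e := by
          rw [mul_comm k l]; exact mul_dvd_mul_left l ⟨y - i, e2⟩
        have h5 := Int.dvd_coe_gcd h3 h4
        rw [Int.gcd_mul_right] at h5
        push_cast at h5
        rcases abs_choice e with h6 | h6 <;> rw [h6] at h5
        · exact h5
        · rw [mul_neg] at h5; exact (dvd_neg).1 h5
      have hgpos : 0 < (Int.gcd k l : ℤ) := by exact_mod_cast Int.gcd_pos_of_ne_zero_left _ hk0
      have hle : |k * l| ≤ |Int.gcd k l * e| :=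
        Int.le_of_dvd (abs_pos.2 (mul_ne_zero hgpos.ne' he0))
          ((abs_dvd_abs _ _).2 hdvd)
      rw [abs_mul, abs_mul, abs_of_pos hgpos] at hle
      have hez : |e| ≤ 12 * M * N := by
        rw [hJ, Finset.mem_Icc] at hz
        rw [abs_le]
        constructor <;> nlinarith [hz.1, hz.2]
      have hgT : (Int.gcd k l : ℤ) ≤ T := by exact_mod_cast hg
      have : (N : ℤ) * N ≤ (12 * M * T ^ 3) * N := by
        calc (N : ℤ) * N ≤ (T * |k|) * (T * |l|) := by gcongr
          _ = T ^ 2 * (|k| * |l|) := by ring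
          _ ≤ T ^ 2 * (Int.gcd k l * |e|) := by gcongr
          _ ≤ T ^ 2 * (T * (12 * M * N)) := by gcongr
          _ = _ := by ring
      have h7 := le_of_mul_le_mul_right this (by linarith)
      have h8 : 0 < (M : ℤ) * T ^ 3 := by positivity
      linarith
    · intro hne
      refine absurd ?_ hne
      rw [hJ, Finset.mem_Icc]
      constructor <;> nlinarith
  have hsum : ∑ z ∈ J, F z * u z * v₀ z = ∑ i ∈ Finset.range M, ∑ j ∈ Finset.range M,
      F (p + 2 * k * i + 2 * l * j) * α i * β j := by
    have h1 : ∀ z, F z * u z * v₀ z = ∑ i ∈ Finset.range M, ∑ j ∈ Finset.range M,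
        (if 2 * l ∣ z - (p + 2 * k * (i : ℤ)) then (if 2 * k ∣ z - (p + 2 * l * (j : ℤ))
        then F z else 0) else 0) * α i * β j := by
      intro z
      rw [mul_assoc, hu, hv₀]
      simp only
      rw [Finset.sum_mul_sum, Finset.mul_sum]
      refine Finset.sum_congr rfl fun i _ => ?_
      rw [Finset.mul_sum]
      refine Finset.sum_congr rfl fun j _ => ?_
      split_ifs <;> ring
    simp only [h1]
    rw [Finset.sum_comm]
    refine Finset.sum_congr rfl fun i hi => ?_
    rw [Finset.sum_comm]
    refine Finset.sum_congr rfl fun j hj => ?_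
    rw [← Finset.sum_mul, ← Finset.sum_mul, hbox i hi j hj]
  exact ⟨u, v₀, hub, hv₀b, hup, hv₀p, hsum⟩

/-- Correlation with the `2k`-periodic `v₀` sees only the sums of `F u` over classes modulo `2k`. By
Cauchy–Schwarz over the classes, `v₀` may be replaced by the conjugate of those sums, normalised by
`L`. -/
theorem nonempty_periodicDatum {N M T : ℕ} (hM : 0 < M) (hT : 25 ≤ T) (hMT : T ^ 4 * M ≤ N)
    (hNM : N ≤ 2 * T ^ 4 * M) {F : ℤ → ℂ} (hF : ∀ z, ‖F z‖ ≤ 1) {k l : ℤ} (hk : |k| ≤ 3 * N)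
    (hkT : (N : ℤ) ≤ T * |k|) {p : ℤ} {u v₀ : ℤ → ℂ} (hub : ∀ z, ‖u z‖ ≤ 1)
    (hv₀b : ∀ z, ‖v₀ z‖ ≤ 1) (hup : Function.Periodic u (2 * l))
    (hv₀p : Function.Periodic v₀ (2 * k))
    (h : M ^ 2 ≤ 16 * (T : ℝ) * ‖∑ z ∈ Finset.Icc (p - 12 * M * N) (p + 12 * M * N),
      F z * u z * v₀ z‖) :
    Nonempty (PeriodicDatum F k l N (2 ^ 18 * T ^ 15)) := by
  have hN0 : 0 < N := lt_of_lt_of_le (by positivity) hMT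
  have hk0 : k ≠ 0 := by rintro rfl; simp at hkT; omega
  set a : ℤ := p - 12 * M * N with ha
  set b : ℤ := p + 12 * M * N with hb
  set J := Finset.Icc a b with hJ
  have hk2 : 2 * k ≠ 0 := by omega
  -- A class modulo `2k` meets the interval in at most `(24MN + 1) / (2|k|) + 1 ≤ 12MT + 2` points,
  -- because `N ≤ T|k|`; dividing by `L` therefore keeps `v` bounded by `1`.
  set L : ℝ := 14 * M * T with hL
  have hMr : (1 : ℝ) ≤ M := by exact_mod_cast hM
  have hNr : (1 : ℝ) ≤ N := by exact_mod_cast hN0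
  have hTr : (25 : ℝ) ≤ T := by exact_mod_cast hT
  have hLpos : 0 < L := by positivity
  set v : ℤ → ℂ := fun z => (L : ℂ)⁻¹ * ∑ y ∈ J, if 2 * k ∣ y - z then F y * u y else 0 with hv
  have hLC : (L : ℂ) ≠ 0 := by exact_mod_cast hLpos.ne'
  have hveq : ∀ z, (L : ℂ) * v z = ∑ y ∈ J, if 2 * k ∣ y - z then F y * u y else 0 := fun z => by
    rw [hv]; simp only; rw [mul_inv_cancel_left₀ hLC]
  have hvp : Function.Periodic v (2 * k) := by
    intro z
    simp only [hv]
    congr 1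
    refine Finset.sum_congr rfl fun y _ => ?_
    have : 2 * k ∣ y - (z + 2 * k) ↔ 2 * k ∣ y - z := by
      rw [show y - (z + 2 * k) = y - z - 2 * k by ring]
      exact dvd_sub_self_right
    simp only [this]
  have hlen : ((b : ℝ) - a + 1) = 24 * M * N + 1 := by
    rw [ha, hb]; push_cast; ring
  have hMN1 : (1 : ℝ) ≤ M * N := by nlinarith
  have h25r : 25 * (M : ℝ) ≤ N := by
    have h1 : 25 ≤ T ^ 4 := hT.trans (Nat.le_self_pow (by norm_num) T)
    have : 25 * M ≤ N := (Nat.mul_le_mul_right M h1).trans hMT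
    exact_mod_cast this
  have hab : a ≤ b := by
    have : 0 ≤ 12 * (M : ℤ) * N := by positivity
    rw [ha, hb]; linarith
  have hkr : (N : ℝ) ≤ T * |(k : ℝ)| := by exact_mod_cast hkT
  have hkpos : (1 : ℝ) ≤ |(k : ℝ)| := by
    have : (1 : ℤ) ≤ |k| := Int.one_le_abs hk0
    exact_mod_cast this
  have hvb : ∀ z, ‖v z‖ ≤ 1 := by
    intro z
    have hc : ((J.filter fun y => 2 * k ∣ y - z).card : ℝ) ≤ L := by
      have h1 := abs_card_filter_dvd_sub_le (q := |2 * k|) (abs_pos.2 hk2)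
        (show a ≤ b + 1 by linarith) z
      have h2 : (Finset.Icc a b).filter (fun y => |2 * k| ∣ z - y) =
          J.filter fun y => 2 * k ∣ y - z := by
        ext y
        simp only [Finset.mem_filter, abs_dvd, hJ]
        rw [← dvd_neg, neg_sub]
      rw [h2, hlen] at h1
      have h3 := (abs_le.1 h1).2
      have h4 : (24 * M * N + 1 : ℝ) / (|2 * k| : ℤ) ≤ 12 * M * T + 1 := by
        push_cast
        rw [abs_mul, abs_two, div_le_iff₀ (by positivity)]
        have : 12 * (M : ℝ) * N ≤ 12 * M * (T * |(k : ℝ)|) := by gcongr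
        nlinarith
      have : 2 ≤ 2 * M * (T : ℝ) := by nlinarith
      rw [hL]
      linarith
    simp only [hv]
    rw [norm_mul, norm_inv, Complex.norm_real, Real.norm_of_nonneg hLpos.le,
      inv_mul_le_iff₀ hLpos, mul_one, ← Finset.sum_filter]
    refine (norm_sum_le_of_le (n := fun _ => (1 : ℝ)) _ fun y _ => ?_).trans ?_
    · rw [norm_mul]; exact mul_le_one₀ (hF _) (norm_nonneg _) (hub _)
    · simpa using hc
  set S₁ := ∑ r ∈ Finset.Ico 0 |2 * k|, ‖v r‖
  set S₂ := ∑ r ∈ Finset.Ico 0 |2 * k|, ‖v r‖ ^ 2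
  have hS₁ : ‖∑ z ∈ J, F z * u z * v₀ z‖ ≤ L * S₁ := by
    rw [sum_mul_periodic_eq hk2 J (fun z => F z * u z) hv₀p, Finset.mul_sum]
    refine norm_sum_le_of_le _ fun r _ => ?_
    rw [← hveq, norm_mul, norm_mul, Complex.norm_real, Real.norm_of_nonneg hLpos.le]
    exact mul_le_of_le_one_left (by positivity) (hv₀b r)
  have hcv : Function.Periodic (fun z => conj (v z)) (2 * k) := fun z => by simp only [hvp z]
  have hS₂ : (∑ z ∈ J, F z * u z * conj (v z)).re = L * S₂ := by
    rw [sum_mul_periodic_eq hk2 J (fun z => F z * u z) hcv, Finset.mul_sum, Complex.re_sum]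
    refine Finset.sum_congr rfl fun r _ => ?_
    rw [← hveq, mul_left_comm, mul_comm (conj (v r)), Complex.mul_conj,
      Complex.normSq_eq_norm_sq, ← Complex.ofReal_mul, Complex.ofReal_re]
  have hCS : S₁ ^ 2 ≤ 6 * N * S₂ := by
    refine (sq_sum_le_card_mul_sum_sq (s := Finset.Ico 0 |2 * k|) (f := fun r => ‖v r‖)).trans ?_
    gcongr
    rw [Int.card_Ico, sub_zero]
    have h1 : ((|2 * k|).toNat : ℤ) = |2 * k| := Int.toNat_of_nonneg (abs_nonneg _)
    have h2 : ((|2 * k|).toNat : ℤ) ≤ 6 * N := by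
      rw [h1, abs_mul]; norm_num; linarith
    exact_mod_cast h2
  have hS₂0 : 0 ≤ S₂ := Finset.sum_nonneg fun _ _ => by positivity
  have hfin : (N : ℝ) ^ 2 ≤ 2 ^ 18 * (T : ℝ) ^ 15 * (L * S₂) := by
    have h1 : (M : ℝ) ^ 2 ≤ 16 * T * (L * S₁) := by
      exact h.trans (by gcongr)
    have h2 : ((M : ℝ) ^ 2) ^ 2 ≤ (16 * T * L) ^ 2 * (6 * N * S₂) := by
      calc ((M : ℝ) ^ 2) ^ 2 ≤ (16 * T * (L * S₁)) ^ 2 := pow_le_pow_left₀ (by positivity) h1 2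
        _ = (16 * T * L) ^ 2 * S₁ ^ 2 := by ring
        _ ≤ _ := by gcongr
    have h3 : (M : ℝ) * M ^ 3 ≤ M * (21504 * T ^ 3 * N * (L * S₂)) := by
      calc (M : ℝ) * M ^ 3 = ((M : ℝ) ^ 2) ^ 2 := by ring
        _ ≤ (16 * T * L) ^ 2 * (6 * N * S₂) := h2
        _ = M * (21504 * T ^ 3 * N * (L * S₂)) := by
          have : (16 * T * L) ^ 2 * (6 * N * S₂) = 256 * T ^ 2 * L * (6 * N * (L * S₂)) := by ring
          rw [this]
          conv_lhs => rw [show 256 * (T : ℝ) ^ 2 * L = 256 * (T : ℝ) ^ 2 * (14 * M * T) by rw [hL]]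
          ring
    have h4 := le_of_mul_le_mul_left h3 (by linarith)
    have hNMr : (N : ℝ) ≤ 2 * T ^ 4 * M := by exact_mod_cast hNM
    have h5 : (N : ℝ) * N ^ 2 ≤ N * (2 ^ 18 * (T : ℝ) ^ 15 * (L * S₂)) := by
      calc (N : ℝ) * N ^ 2 = (N : ℝ) ^ 3 := by ring
        _ ≤ (2 * (T : ℝ) ^ 4 * M) ^ 3 := by gcongr
        _ = 8 * (T : ℝ) ^ 12 * (M : ℝ) ^ 3 := by ring
        _ ≤ 8 * (T : ℝ) ^ 12 * (21504 * (T : ℝ) ^ 3 * N * (L * S₂)) := by gcongr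
        _ = 172032 * ((T : ℝ) ^ 15 * N * (L * S₂)) := by ring
        _ ≤ 2 ^ 18 * ((T : ℝ) ^ 15 * N * (L * S₂)) := by gcongr; norm_num
        _ = _ := by ring
    exact le_of_mul_le_mul_left h5 (by linarith)
  refine ⟨⟨a, b, u, v, L, hLpos, hab, ?_, ?_, ?_, hub, hvb, hup, hvp, hveq, ?_⟩⟩
  · rw [hlen]
    nlinarith
  · rw [hlen, hL]
    nlinarith
  · have hNMr : (N : ℝ) ≤ 2 * T ^ 4 * M := by exact_mod_cast hNM
    calc (N : ℝ) ≤ 2 * T ^ 4 * M := hNMr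
      _ ≤ (2 ^ 18 * T ^ 4) * (14 * M * T) := by
        have : 0 ≤ (T : ℝ) ^ 4 * M := by positivity
        nlinarith
      _ ≤ (2 ^ 18 * T ^ 15) * L := by
        rw [hL]
        gcongr
        · linarith
        · norm_num
  · rw [hS₂]; exact hfin

/-! ### Removing periodic factors by differencing. -/

/-- The difference function with step `t (x.2 - x.1)`, shifted by `t x.1`. -/
def shiftDiff (t : ℤ) (x : ℕ × ℕ) (X : ℤ → ℂ) (z : ℤ) : ℂ :=
  multDiff (t * x.2 - t * x.1) X (z + t * x.1)

theorem shiftDiff_mul (t : ℤ) (x : ℕ × ℕ) (f g : ℤ → ℂ) (z : ℤ) :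
    shiftDiff t x (fun z => f z * g z) z = shiftDiff t x f z * shiftDiff t x g z := by
  simp only [shiftDiff, multDiff_mul]

theorem norm_shiftDiff_le {f : ℤ → ℂ} (hf : ∀ z, ‖f z‖ ≤ 1) (t : ℤ) (x : ℕ × ℕ) (z : ℤ) :
    ‖shiftDiff t x f z‖ ≤ 1 :=
  norm_multDiff_le hf _ _

theorem shiftDiff_periodic {f : ℤ → ℂ} {c : ℤ} (hf : Function.Periodic f c) (t : ℤ) (x : ℕ × ℕ) :
    Function.Periodic (shiftDiff t x f) c := fun z => by
  simp only [shiftDiff]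
  rw [add_right_comm, multDiff_periodic hf]

theorem vanDerCorput_step {ι : Type*} (Θ : Finset ι) {α β : ℤ} {t : ℤ} {A : ℕ}
    {u X : ι → ℤ → ℂ} {b V : ℝ} (hb0 : 0 < b) (hu : ∀ θ z, ‖u θ z‖ ≤ 1) (hX : ∀ θ z, ‖X θ z‖ ≤ 1)
    (hp : ∀ θ, Function.Periodic (u θ) t)
    (hb : ((Finset.Icc α β).card : ℝ) ≤ b) (hV0 : 0 ≤ V) (htA : 4 * |(t : ℝ)| * A ≤ V)
    (hV : Θ.card * V ≤ ∑ θ ∈ Θ, ‖∑ z ∈ Finset.Icc α β, u θ z * X θ z‖) :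
    ((Θ ×ˢ (Finset.range A ×ˢ Finset.range A)).card : ℝ) * (V ^ 2 / (4 * b)) ≤
      (∑ p ∈ Θ ×ˢ (Finset.range A ×ˢ Finset.range A),
        ∑ z ∈ Finset.Icc α β, shiftDiff t p.2 (X p.1) z).re := by
  have h := vanDerCorput_family Θ (fun _ => α) (fun _ => β) hu hX hp (fun _ _ => hb) hV0 htA hV
  have h1 : (((∑ θ ∈ Θ, ∑ z ∈ Finset.Icc α β, ‖∑ i ∈ Finset.range A, X θ (z + t * i)‖ ^ 2 : ℝ)) : ℂ) =
      ∑ p ∈ Θ ×ˢ (Finset.range A ×ˢ Finset.range A),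
        ∑ z ∈ Finset.Icc α β, shiftDiff t p.2 (X p.1) z := by
    rw [Finset.sum_product, Complex.ofReal_sum]
    refine Finset.sum_congr rfl fun θ _ => ?_
    rw [sum_norm_sq_shifts (Finset.Icc α β) (X θ) (Finset.range A) (fun i => t * (i : ℤ)),
      Finset.sum_product]
    rfl
  rw [← h1, Complex.ofReal_re, Finset.card_product, Finset.card_product, Finset.card_range,
    ← mul_div_assoc, div_le_iff₀ (by positivity)]
  push_cast
  linarith

theorem vanDerCorput_step_norm {ι : Type*} (Θ : Finset ι) {α β : ℤ} {t : ℤ} {A : ℕ}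
    {u X : ι → ℤ → ℂ} {b V : ℝ} (hb0 : 0 < b) (hu : ∀ θ z, ‖u θ z‖ ≤ 1) (hX : ∀ θ z, ‖X θ z‖ ≤ 1)
    (hp : ∀ θ, Function.Periodic (u θ) t)
    (hb : ((Finset.Icc α β).card : ℝ) ≤ b) (hV0 : 0 ≤ V) (htA : 4 * |(t : ℝ)| * A ≤ V)
    (hV : Θ.card * V ≤ ∑ θ ∈ Θ, ‖∑ z ∈ Finset.Icc α β, u θ z * X θ z‖) :
    ((Θ ×ˢ (Finset.range A ×ˢ Finset.range A)).card : ℝ) * (V ^ 2 / (4 * b)) ≤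
      ∑ p ∈ Θ ×ˢ (Finset.range A ×ˢ Finset.range A),
        ‖∑ z ∈ Finset.Icc α β, shiftDiff t p.2 (X p.1) z‖ :=
  (vanDerCorput_step Θ hb0 hu hX hp hb hV0 htA hV).trans
    ((Complex.re_le_norm _).trans (norm_sum_le _ _))

/-- Removing three periodic factors from a sum over an interval. -/
theorem vanDerCorput_three {α β : ℤ} {t₁ t₂ t₃ : ℤ} {A : ℕ} {q₁ q₂ q₃ v : ℤ → ℂ} {b V V₁ V₂ V₃ : ℝ}
    (hb0 : 0 < b) (h₁ : ∀ z, ‖q₁ z‖ ≤ 1) (h₂ : ∀ z, ‖q₂ z‖ ≤ 1) (h₃ : ∀ z, ‖q₃ z‖ ≤ 1)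
    (hv : ∀ z, ‖v z‖ ≤ 1) (p₁ : Function.Periodic q₁ t₁) (p₂ : Function.Periodic q₂ t₂)
    (p₃ : Function.Periodic q₃ t₃) (hb : ((Finset.Icc α β).card : ℝ) ≤ b) (hV0 : 0 ≤ V)
    (hV₁ : V₁ = V ^ 2 / (4 * b)) (hV₂ : V₂ = V₁ ^ 2 / (4 * b)) (hV₃ : V₃ = V₂ ^ 2 / (4 * b))
    (ht₁ : 4 * |(t₁ : ℝ)| * A ≤ V) (ht₂ : 4 * |(t₂ : ℝ)| * A ≤ V₁) (ht₃ : 4 * |(t₃ : ℝ)| * A ≤ V₂)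
    (hV : V ≤ ‖∑ z ∈ Finset.Icc α β, q₁ z * (q₂ z * (q₃ z * v z))‖) :
    (A : ℝ) ^ 6 * V₃ ≤ ∑ x₁ ∈ Finset.range A ×ˢ Finset.range A,
      ∑ x₂ ∈ Finset.range A ×ˢ Finset.range A, ∑ x₃ ∈ Finset.range A ×ˢ Finset.range A,
        (∑ z ∈ Finset.Icc α β, shiftDiff t₃ x₃ (shiftDiff t₂ x₂ (shiftDiff t₁ x₁ v)) z).re := by
  have mul_le : ∀ {f g : ℤ → ℂ}, (∀ z, ‖f z‖ ≤ 1) → (∀ z, ‖g z‖ ≤ 1) → ∀ z, ‖f z * g z‖ ≤ 1 := by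
    intro f g hf hg z
    rw [norm_mul]; exact mul_le_one₀ (hf z) (norm_nonneg _) (hg z)
  have hV₁0 : 0 ≤ V₁ := by rw [hV₁]; positivity
  have hV₂0 : 0 ≤ V₂ := by rw [hV₂]; positivity
  set R := Finset.range A ×ˢ Finset.range A with hR
  have hRc : (R.card : ℝ) = (A : ℝ) ^ 2 := by
    rw [hR, Finset.card_product, Finset.card_range]; push_cast; ring
  -- Differencing preserves both the bound and the period of the factors not yet removed, so each
  -- further step applies to the family produced by the previous one.
  have s₁ : (R.card : ℝ) * V₁ ≤ ∑ x ∈ R, ‖∑ z ∈ Finset.Icc α β, shiftDiff t₁ x q₂ z *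
      (shiftDiff t₁ x q₃ z * shiftDiff t₁ x v z)‖ := by
    have s := vanDerCorput_step_norm (Finset.univ : Finset Unit) (A := A) hb0 (fun _ => h₁)
      (fun _ => mul_le h₂ (mul_le h₃ hv)) (fun _ => p₁) hb hV0 ht₁ (by simpa using hV)
    rw [← hV₁, ← hR, Finset.sum_product, Finset.card_product] at s
    simpa only [Finset.univ_unique, Finset.sum_singleton, Finset.card_singleton, one_mul,
      shiftDiff_mul] using s
  have s₂ : ((R ×ˢ R).card : ℝ) * V₂ ≤ ∑ x ∈ R ×ˢ R, ‖∑ z ∈ Finset.Icc α β,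
      shiftDiff t₂ x.2 (shiftDiff t₁ x.1 q₃) z * shiftDiff t₂ x.2 (shiftDiff t₁ x.1 v) z‖ := by
    have s := vanDerCorput_step_norm R (A := A)
      (u := fun x => shiftDiff t₁ x q₂)
      (X := fun x z => shiftDiff t₁ x q₃ z * shiftDiff t₁ x v z) hb0
      (fun x => norm_shiftDiff_le h₂ t₁ x)
      (fun x => mul_le (norm_shiftDiff_le h₃ t₁ x) (norm_shiftDiff_le hv t₁ x))
      (fun x => shiftDiff_periodic p₂ t₁ x) hb hV₁0 ht₂ s₁
    rw [← hV₂, ← hR] at s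
    simpa only [shiftDiff_mul] using s
  have s₃ := vanDerCorput_step (R ×ˢ R) (A := A)
    (u := fun x => shiftDiff t₂ x.2 (shiftDiff t₁ x.1 q₃))
    (X := fun x => shiftDiff t₂ x.2 (shiftDiff t₁ x.1 v)) hb0
    (fun x => norm_shiftDiff_le (norm_shiftDiff_le h₃ t₁ x.1) t₂ x.2)
    (fun x => norm_shiftDiff_le (norm_shiftDiff_le hv t₁ x.1) t₂ x.2)
    (fun x => shiftDiff_periodic (shiftDiff_periodic p₃ t₁ x.1) t₂ x.2) hb hV₂0 ht₃ s₂
  rw [← hV₃, ← hR, Finset.card_product, Finset.card_product, Finset.sum_product,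
    Finset.sum_product, Complex.re_sum] at s₃
  push_cast at s₃
  rw [hRc] at s₃
  calc (A : ℝ) ^ 6 * V₃ = (A : ℝ) ^ 2 * (A : ℝ) ^ 2 * (A : ℝ) ^ 2 * V₃ := by ring
    _ ≤ _ := s₃
    _ = _ := by
      refine Finset.sum_congr rfl fun x₁ _ => ?_
      rw [Complex.re_sum]
      refine Finset.sum_congr rfl fun x₂ _ => ?_
      rw [Complex.re_sum]

theorem shiftDiff_three (t₁ t₂ t₃ : ℤ) (x₁ x₂ x₃ : ℕ × ℕ) (v : ℤ → ℂ) (z : ℤ) :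
    shiftDiff t₃ x₃ (shiftDiff t₂ x₂ (shiftDiff t₁ x₁ v)) z =
      multDiff (t₃ * x₃.2 - t₃ * x₃.1) (multDiff (t₂ * x₂.2 - t₂ * x₂.1)
        (multDiff (t₁ * x₁.2 - t₁ * x₁.1) v)) (z + (t₁ * x₁.1 + t₂ * x₂.1 + t₃ * x₃.1)) := by
  have h1 : shiftDiff t₁ x₁ v = fun z => multDiff (t₁ * x₁.2 - t₁ * x₁.1) v (z + t₁ * x₁.1) := rfl
  have h2 : shiftDiff t₂ x₂ (shiftDiff t₁ x₁ v) = fun z => multDiff (t₂ * x₂.2 - t₂ * x₂.1)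
      (multDiff (t₁ * x₁.2 - t₁ * x₁.1) v) (z + (t₁ * x₁.1 + t₂ * x₂.1)) := by
    funext z
    rw [shiftDiff, h1, multDiff_shift]
    simp only
    rw [show z + t₂ * x₂.1 + t₁ * x₁.1 = z + (t₁ * x₁.1 + t₂ * x₂.1) by ring]
  rw [shiftDiff, h2, multDiff_shift]
  simp only
  rw [show z + t₃ * x₃.1 + (t₁ * x₁.1 + t₂ * x₂.1) =
    z + (t₁ * x₁.1 + t₂ * x₂.1 + t₃ * x₃.1) by ring]

/-! ### Cubes of periodic functions and the projection property. -/

/-- The product over the vertices other than `z` of the cube based at `z` with sides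
`n₁`, `n₂`, `n₃`. -/
noncomputable def cubeRest (v : ℤ → ℂ) (n₁ n₂ n₃ z : ℤ) : ℂ :=
  conj (v (z + n₁)) * (conj (multDiff n₁ v (z + n₂)) * conj (multDiff n₂ (multDiff n₁ v) (z + n₃)))

theorem multDiff_three_eq (v : ℤ → ℂ) (n₁ n₂ n₃ z : ℤ) :
    multDiff n₃ (multDiff n₂ (multDiff n₁ v)) z = v z * cubeRest v n₁ n₂ n₃ z := by
  simp only [multDiff, cubeRest]
  ring

theorem norm_cubeRest_le {v : ℤ → ℂ} (hv : ∀ z, ‖v z‖ ≤ 1) (n₁ n₂ n₃ z : ℤ) :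
    ‖cubeRest v n₁ n₂ n₃ z‖ ≤ 1 := by
  simp only [cubeRest, norm_mul, RCLike.norm_conj]
  exact mul_le_one₀ (hv _) (by positivity) (mul_le_one₀ (norm_multDiff_le hv _ _) (norm_nonneg _)
    (norm_multDiff_le (norm_multDiff_le hv _) _ _))

theorem multDiff_congr {v : ℤ → ℂ} {c : ℤ} (hv : Function.Periodic v c) {n m : ℤ} (h : c ∣ n - m) :
    multDiff n v = multDiff m v := by
  funext z
  simp only [multDiff]
  rw [hv.eq_of_dvd_sub (x := z + n) (y := z + m) (by rwa [add_sub_add_left_eq_sub])]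

/-- This allows multiples of the period to be added to the sides, which is how they come to fill
dense sets of integers. -/
theorem cubeRest_congr {v : ℤ → ℂ} {c : ℤ} (hv : Function.Periodic v c) {n₁ n₂ n₃ m₁ m₂ m₃ : ℤ}
    (h₁ : c ∣ n₁ - m₁) (h₂ : c ∣ n₂ - m₂) (h₃ : c ∣ n₃ - m₃) (z : ℤ) :
    cubeRest v n₁ n₂ n₃ z = cubeRest v m₁ m₂ m₃ z := by
  have p₁ := multDiff_periodic hv m₁
  simp only [cubeRest]
  rw [multDiff_congr hv h₁, multDiff_congr p₁ h₂,
    hv.eq_of_dvd_sub (x := z + n₁) (y := z + m₁) (by rwa [add_sub_add_left_eq_sub]),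
    p₁.eq_of_dvd_sub (x := z + n₂) (y := z + m₂) (by rwa [add_sub_add_left_eq_sub]),
    (multDiff_periodic p₁ m₂).eq_of_dvd_sub (x := z + n₃) (y := z + m₃)
      (by rwa [add_sub_add_left_eq_sub])]

theorem cubeRest_periodic {v : ℤ → ℂ} {c : ℤ} (hv : Function.Periodic v c) (n₁ n₂ n₃ : ℤ) :
    Function.Periodic (cubeRest v n₁ n₂ n₃) c := by
  intro z
  have p₁ := multDiff_periodic hv n₁
  have p₂ := multDiff_periodic p₁ n₂
  simp only [cubeRest, add_right_comm z c]
  rw [hv, p₁, p₂]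

/-- Unfolding `D.v` as a class sum of `F u` and using the periodicity of `Ψ`, each `y` is weighted
by the number of `z` in `[α, β]` with `z + s ≡ y` modulo `2k`. That number is the length over
`2|k|`, up to an error of `1`. -/
theorem PeriodicDatum.norm_sum_sub_le {F : ℤ → ℂ} {k l : ℤ} {N : ℕ} {W : ℝ}
    (D : PeriodicDatum F k l N W) (hF : ∀ z, ‖F z‖ ≤ 1) (hk : k ≠ 0) {Ψ : ℤ → ℂ}
    (hΨ : ∀ z, ‖Ψ z‖ ≤ 1) (hp : Function.Periodic Ψ (2 * k)) {α β : ℤ} (hαβ : α ≤ β + 1) (s : ℤ) :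
    ‖∑ z ∈ Finset.Icc α β, D.v (z + s) * Ψ (z + s) -
      ((((β - α + 1 : ℝ) / (|2 * k| : ℤ)) / D.L : ℝ) : ℂ) *
        ∑ y ∈ Finset.Icc D.a D.b, F y * D.u y * Ψ y‖ ≤ (D.b - D.a + 1) / D.L := by
  have hL := D.L_pos
  have hk2 : 2 * k ≠ 0 := by omega
  have hLC : (D.L : ℂ) ≠ 0 := by exact_mod_cast hL.ne'
  set ρ : ℝ := (β - α + 1 : ℝ) / (|2 * k| : ℤ) with hρ
  set cnt : ℤ → ℝ := fun y => (((Finset.Icc α β).filter fun z => |2 * k| ∣ y - s - z).card : ℝ)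
  have hcnt : ∀ y, |cnt y - ρ| ≤ 1 := fun y =>
    abs_card_filter_dvd_sub_le (abs_pos.2 hk2) hαβ (y - s)
  have h1 : (D.L : ℂ) * ∑ z ∈ Finset.Icc α β, D.v (z + s) * Ψ (z + s) =
      ∑ y ∈ Finset.Icc D.a D.b, F y * D.u y * Ψ y * cnt y := by
    rw [Finset.mul_sum]
    have h2 : ∀ z, (D.L : ℂ) * (D.v (z + s) * Ψ (z + s)) = ∑ y ∈ Finset.Icc D.a D.b,
        if |2 * k| ∣ y - s - z then F y * D.u y * Ψ y else 0 := by
      intro z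
      rw [← mul_assoc, D.v_eq, Finset.sum_mul]
      refine Finset.sum_congr rfl fun y _ => ?_
      have e : |2 * k| ∣ y - s - z ↔ 2 * k ∣ y - (z + s) := by
        rw [abs_dvd, show y - s - z = y - (z + s) by ring]
      by_cases h : 2 * k ∣ y - (z + s)
      · rw [if_pos h, if_pos (e.2 h), hp.eq_of_dvd_sub h]
      · rw [if_neg h, if_neg (mt e.1 h), zero_mul]
    simp only [h2]
    rw [Finset.sum_comm]
    refine Finset.sum_congr rfl fun y _ => ?_
    rw [← Finset.sum_filter, Finset.sum_const, nsmul_eq_mul, mul_comm]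
    simp [cnt]
  have h3 : (D.L : ℂ) * (∑ z ∈ Finset.Icc α β, D.v (z + s) * Ψ (z + s) -
      (((ρ / D.L : ℝ)) : ℂ) * ∑ y ∈ Finset.Icc D.a D.b, F y * D.u y * Ψ y) =
      ∑ y ∈ Finset.Icc D.a D.b, F y * D.u y * Ψ y * ((cnt y - ρ : ℝ) : ℂ) := by
    rw [mul_sub, h1, ← mul_assoc]
    push_cast
    rw [mul_div_cancel₀ _ hLC, Finset.mul_sum, ← Finset.sum_sub_distrib]
    refine Finset.sum_congr rfl fun y _ => ?_
    ring
  rw [le_div_iff₀ hL, mul_comm]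
  calc D.L * ‖∑ z ∈ Finset.Icc α β, D.v (z + s) * Ψ (z + s) -
      (((ρ / D.L : ℝ)) : ℂ) * ∑ y ∈ Finset.Icc D.a D.b, F y * D.u y * Ψ y‖ =
      ‖(D.L : ℂ) * (∑ z ∈ Finset.Icc α β, D.v (z + s) * Ψ (z + s) -
      (((ρ / D.L : ℝ)) : ℂ) * ∑ y ∈ Finset.Icc D.a D.b, F y * D.u y * Ψ y)‖ := by
        rw [norm_mul, Complex.norm_real, Real.norm_of_nonneg hL.le]
    _ ≤ ∑ y ∈ Finset.Icc D.a D.b, (1 : ℝ) := by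
        rw [h3]
        refine norm_sum_le_of_le _ fun y _ => ?_
        rw [norm_mul, norm_mul, norm_mul, Complex.norm_real]
        exact mul_le_one₀ (mul_le_one₀ (mul_le_one₀ (hF y) (norm_nonneg _) (D.norm_u_le y))
          (norm_nonneg _) (hΨ y)) (norm_nonneg _) (hcnt y)
    _ = _ := by
        have := D.a_le_b
        rw [Finset.sum_const, Int.card_Icc, nsmul_eq_mul, mul_one]
        have h4 : ((D.b + 1 - D.a).toNat : ℤ) = D.b + 1 - D.a := Int.toNat_of_nonneg (by linarith)
        have h5 : ((D.b + 1 - D.a).toNat : ℝ) = ((D.b + 1 - D.a : ℤ) : ℝ) := by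
          exact_mod_cast congrArg (Int.cast (R := ℝ)) h4
        rw [h5]; push_cast; ring

theorem exists_fixed_left {A : ℕ} (hA : 0 < A) {V : ℝ} {g : ℕ × ℕ → ℕ × ℕ → ℕ × ℕ → ℝ}
    (h : (A : ℝ) ^ 6 * V ≤ ∑ x₁ ∈ Finset.range A ×ˢ Finset.range A,
      ∑ x₂ ∈ Finset.range A ×ˢ Finset.range A, ∑ x₃ ∈ Finset.range A ×ˢ Finset.range A,
        g x₁ x₂ x₃) :
    ∃ i₁ ∈ Finset.range A, ∃ i₂ ∈ Finset.range A, ∃ i₃ ∈ Finset.range A,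
      (A : ℝ) ^ 3 * V ≤ ∑ j₁ ∈ Finset.range A, ∑ j₂ ∈ Finset.range A,
      ∑ j₃ ∈ Finset.range A, g (i₁, j₁) (i₂, j₂) (i₃, j₃) := by
  have hne : (Finset.range A).Nonempty := ⟨0, Finset.mem_range.2 hA⟩
  rw [Finset.sum_product] at h
  obtain ⟨i₁, hi₁, h⟩ := exists_le_of_card_mul_le_sum hne (V := (A : ℝ) ^ 5 * V)
    (le_trans (le_of_eq (by rw [Finset.card_range]; ring)) h)
  simp only [Finset.sum_product (s := Finset.range A)] at h
  rw [Finset.sum_comm] at h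
  obtain ⟨i₂, hi₂, h⟩ := exists_le_of_card_mul_le_sum hne (V := (A : ℝ) ^ 4 * V)
    (le_trans (le_of_eq (by rw [Finset.card_range]; ring)) h)
  have h' : (A : ℝ) ^ 4 * V ≤ ∑ i₃ ∈ Finset.range A, ∑ j₁ ∈ Finset.range A, ∑ j₂ ∈ Finset.range A,
      ∑ j₃ ∈ Finset.range A, g (i₁, j₁) (i₂, j₂) (i₃, j₃) := by
    refine h.trans (le_of_eq ?_)
    rw [Finset.sum_comm (s := Finset.range A) (t := Finset.range A)
      (f := fun i₃ j₁ => ∑ j₂ ∈ Finset.range A, ∑ j₃ ∈ Finset.range A,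
        g (i₁, j₁) (i₂, j₂) (i₃, j₃))]
    exact Finset.sum_congr rfl fun j₁ _ => Finset.sum_comm
  obtain ⟨i₃, hi₃, h⟩ := exists_le_of_card_mul_le_sum hne (V := (A : ℝ) ^ 3 * V)
    (le_trans (le_of_eq (by rw [Finset.card_range]; ring)) h')
  exact ⟨i₁, hi₁, i₂, hi₂, i₃, hi₃, h⟩

/-- The set of integers `2m(j - i) + 2kγ` with `0 ≤ j, γ < A`. -/
def sideSet (A : ℕ) (m k : ℤ) (i : ℕ) : Finset ℤ :=
  (Finset.range A ×ˢ Finset.range A).image fun x => (2 * m * x.1 - 2 * m * i) + 2 * k * x.2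

theorem sideSet_injOn {A : ℕ} {m k : ℤ} (hk : k ≠ 0)
    (hg : (A : ℤ) * Int.gcd m k ≤ |k|) (i : ℕ) :
    Set.InjOn (fun x : ℕ × ℕ => (2 * m * x.1 - 2 * m * i) + 2 * k * x.2)
      (Finset.range A ×ˢ Finset.range A : Finset (ℕ × ℕ)) := by
  rintro ⟨a, b⟩ hx ⟨c, d⟩ hy h
  simp only [Finset.coe_product, Set.mem_prod, Finset.mem_coe, Finset.mem_range] at hx hy
  simp only at h
  have hlt : |(a : ℤ) - c| < A := by rw [abs_lt]; constructor <;> omega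
  have hgpos : (0 : ℤ) < Int.gcd m k := by exact_mod_cast Int.gcd_pos_of_ne_zero_right _ hk
  have := eq_of_linear_eq (l := m) (a₁ := a) (a₂ := c) (b₁ := b) (b₂ := d) hk (by linarith)
    (lt_of_lt_of_le (mul_lt_mul_of_pos_right hlt hgpos) hg)
  rw [Nat.cast_injective this.1, Nat.cast_injective this.2]

theorem card_sideSet {A : ℕ} {m k : ℤ} (hk : k ≠ 0)
    (hg : (A : ℤ) * Int.gcd m k ≤ |k|) (i : ℕ) : (sideSet A m k i).card = A ^ 2 := by
  rw [sideSet, Finset.card_image_of_injOn (sideSet_injOn hk hg i), Finset.card_product,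
    Finset.card_range, sq]

theorem abs_le_of_mem_sideSet {A N : ℕ} {m k : ℤ} (hm : |m| ≤ 3 * N) (hk : |k| ≤ 3 * N) {i : ℕ}
    (hi : i ∈ Finset.range A) {n : ℤ} (hn : n ∈ sideSet A m k i) : |n| ≤ 12 * N * A := by
  obtain ⟨⟨j, γ⟩, hx, rfl⟩ := Finset.mem_image.1 hn
  simp only [Finset.mem_product, Finset.mem_range] at hx hi
  have h1 : |(2 * m * (j : ℤ) - 2 * m * i)| ≤ 2 * (3 * N) * A := by
    rw [← mul_sub, abs_mul, abs_mul, abs_two]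
    have : |(j : ℤ) - i| ≤ A := by rw [abs_le]; constructor <;> omega
    gcongr
  have h2 : |(2 * k * (γ : ℤ))| ≤ 2 * (3 * N) * A := by
    rw [abs_mul, abs_mul, abs_two, Nat.abs_cast]
    have : (γ : ℤ) ≤ A := by omega
    gcongr
  refine (abs_add_le _ _).trans ?_
  linarith

theorem sum_sideSet_eq {A : ℕ} {m k : ℤ} (hk : k ≠ 0)
    (hg : (A : ℤ) * Int.gcd m k ≤ |k|) (i : ℕ) (f : ℤ → ℝ)
    (hf : ∀ n n', 2 * k ∣ n - n' → f n = f n') :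
    ∑ n ∈ sideSet A m k i, f n = A * ∑ j ∈ Finset.range A, f (2 * m * j - 2 * m * i) := by
  rw [sideSet, Finset.sum_image (sideSet_injOn hk hg i), Finset.sum_product, Finset.mul_sum]
  refine Finset.sum_congr rfl fun j _ => ?_
  have : ∀ γ ∈ Finset.range A, f ((2 * m * j - 2 * m * i) + 2 * k * γ) =
      f (2 * m * j - 2 * m * i) := fun γ _ => hf _ _ ⟨γ, by ring⟩
  rw [Finset.sum_congr rfl this, Finset.sum_const, Finset.card_range, nsmul_eq_mul]

/-- The base vertex of each cube is `D.v` against a `2k`-periodic product of the other vertices, so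
the projection property puts `F u` in its place. The error is at most `2N` per cube, which `hV`
bounds by half of `V`. -/
theorem PeriodicDatum.le_sum_cubeRest {F : ℤ → ℂ} {k l : ℤ} {N A : ℕ} {W R V : ℝ}
    (D : PeriodicDatum F k l N W) (hF : ∀ z, ‖F z‖ ≤ 1) (hk : k ≠ 0) (hA : 0 < A) (hN : 0 < N) {α β m₁ m₂ m₃ : ℤ}
    (hαβ : α ≤ β + 1) (hR0 : 0 < R) (hR : (β - α + 1 : ℝ) / (|2 * k| : ℤ) / D.L ≤ R)
    (hV : 4 * N ≤ V)
    (h : (A : ℝ) ^ 6 * V ≤ ∑ x₁ ∈ Finset.range A ×ˢ Finset.range A,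
      ∑ x₂ ∈ Finset.range A ×ˢ Finset.range A, ∑ x₃ ∈ Finset.range A ×ˢ Finset.range A,
        (∑ z ∈ Finset.Icc α β,
          shiftDiff (2 * m₃) x₃ (shiftDiff (2 * m₂) x₂ (shiftDiff (2 * m₁) x₁ D.v)) z).re) :
    (A : ℝ) ^ 6 * (V / (2 * R)) ≤ ∑ x₁ ∈ Finset.range A ×ˢ Finset.range A,
      ∑ x₂ ∈ Finset.range A ×ˢ Finset.range A, ∑ x₃ ∈ Finset.range A ×ˢ Finset.range A,
        (∑ y ∈ Finset.Icc D.a D.b, F y * D.u y *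
          cubeRest D.v (2 * m₁ * x₁.2 - 2 * m₁ * x₁.1) (2 * m₂ * x₂.2 - 2 * m₂ * x₂.1)
            (2 * m₃ * x₃.2 - 2 * m₃ * x₃.1) y).re := by
  have hL := D.L_pos
  set κ : ℝ := (β - α + 1 : ℝ) / (|2 * k| : ℤ) / D.L with hκ
  have hκ0 : 0 ≤ κ := by
    have h1 : (0 : ℝ) ≤ β - α + 1 := by
      have : (α : ℝ) ≤ β + 1 := by exact_mod_cast hαβ
      linarith
    have h2 : (0 : ℝ) ≤ (|2 * k| : ℤ) := by exact_mod_cast abs_nonneg _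
    positivity
  set X : ℕ × ℕ → ℕ × ℕ → ℕ × ℕ → ℝ := fun x₁ x₂ x₃ =>
    (∑ y ∈ Finset.Icc D.a D.b, F y * D.u y *
      cubeRest D.v (2 * m₁ * x₁.2 - 2 * m₁ * x₁.1) (2 * m₂ * x₂.2 - 2 * m₂ * x₂.1)
        (2 * m₃ * x₃.2 - 2 * m₃ * x₃.1) y).re with hX
  have h1 : ∀ x₁ x₂ x₃, (∑ z ∈ Finset.Icc α β,
      shiftDiff (2 * m₃) x₃ (shiftDiff (2 * m₂) x₂ (shiftDiff (2 * m₁) x₁ D.v)) z).re ≤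
      κ * X x₁ x₂ x₃ + 2 * N := by
    intro x₁ x₂ x₃
    have h2 := D.norm_sum_sub_le hF hk (norm_cubeRest_le D.norm_v_le
      (2 * m₁ * x₁.2 - 2 * m₁ * x₁.1) (2 * m₂ * x₂.2 - 2 * m₂ * x₂.1)
      (2 * m₃ * x₃.2 - 2 * m₃ * x₃.1)) (cubeRest_periodic D.periodic_v _ _ _) hαβ
      (2 * m₁ * x₁.1 + 2 * m₂ * x₂.1 + 2 * m₃ * x₃.1)
    have h3 := (Complex.re_le_norm _).trans h2
    simp only [Complex.sub_re, Complex.re_ofReal_mul, ← multDiff_three_eq] at h3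
    simp only [shiftDiff_three]
    have h4 : (D.b - D.a + 1 : ℝ) / D.L ≤ 2 * N := by
      rw [div_le_iff₀ hL]; exact D.length_le_L
    have h5 : (κ : ℝ) = (β - α + 1 : ℝ) / (|2 * k| : ℤ) / D.L := hκ
    rw [← h5] at h3
    simp only [hX]
    linarith
  set S : ℝ := ∑ x₁ ∈ Finset.range A ×ˢ Finset.range A,
      ∑ x₂ ∈ Finset.range A ×ˢ Finset.range A, ∑ x₃ ∈ Finset.range A ×ˢ Finset.range A,
        X x₁ x₂ x₃ with hS
  have h6 : (A : ℝ) ^ 6 * V ≤ κ * S + (A : ℝ) ^ 6 * (2 * N) := by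
    refine h.trans ((Finset.sum_le_sum fun x₁ _ => Finset.sum_le_sum fun x₂ _ =>
      Finset.sum_le_sum fun x₃ _ => h1 x₁ x₂ x₃).trans (le_of_eq ?_))
    simp only [Finset.sum_add_distrib, Finset.sum_const, Finset.card_product, Finset.card_range,
      ← Finset.mul_sum, nsmul_eq_mul, hS]
    push_cast
    ring
  have h7 : (A : ℝ) ^ 6 * (V / 2) ≤ κ * S := by
    have : (A : ℝ) ^ 6 * (2 * N) ≤ (A : ℝ) ^ 6 * (V / 2) := by
      gcongr
      linarith
    linarith
  have hV0 : 0 < V := lt_of_lt_of_le (by positivity) hV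
  -- The sign of `S` is needed before `κ` can be replaced by its upper bound `R`.
  have hS0 : 0 < S := pos_of_mul_pos_right (lt_of_lt_of_le (by positivity) h7) hκ0
  have h8 : (A : ℝ) ^ 6 * (V / 2) ≤ R * S := h7.trans (mul_le_mul_of_nonneg_right hR hS0.le)
  have h13 : (A : ℝ) ^ 6 * (V / (2 * R)) = ((A : ℝ) ^ 6 * (V / 2)) / R := by
    field_simp
  rw [h13, div_le_iff₀ hR0]
  linarith

/-- A sum over three cube sides, each in arithmetic progression, of a periodic correlation may be
replaced by a sum over sides in sets of distinct integers. -/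
theorem PeriodicDatum.exists_le_sum_sideSet {F : ℤ → ℂ} {k l : ℤ} {N A : ℕ} {W V : ℝ}
    (D : PeriodicDatum F k l N W) (hk : k ≠ 0) (hA : 0 < A) {m₁ m₂ m₃ : ℤ}
    (hg₁ : (A : ℤ) * Int.gcd m₁ k ≤ |k|) (hg₂ : (A : ℤ) * Int.gcd m₂ k ≤ |k|)
    (hg₃ : (A : ℤ) * Int.gcd m₃ k ≤ |k|)
    (h : (A : ℝ) ^ 6 * V ≤ ∑ x₁ ∈ Finset.range A ×ˢ Finset.range A,
      ∑ x₂ ∈ Finset.range A ×ˢ Finset.range A, ∑ x₃ ∈ Finset.range A ×ˢ Finset.range A,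
        (∑ y ∈ Finset.Icc D.a D.b, F y * D.u y *
          cubeRest D.v (2 * m₁ * x₁.2 - 2 * m₁ * x₁.1) (2 * m₂ * x₂.2 - 2 * m₂ * x₂.1)
            (2 * m₃ * x₃.2 - 2 * m₃ * x₃.1) y).re) :
    ∃ i₁ ∈ Finset.range A, ∃ i₂ ∈ Finset.range A, ∃ i₃ ∈ Finset.range A,
      (A : ℝ) ^ 6 * V ≤ ∑ n₁ ∈ sideSet A m₁ k i₁, ∑ n₂ ∈ sideSet A m₂ k i₂,
        ∑ n₃ ∈ sideSet A m₃ k i₃,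
          (∑ y ∈ Finset.Icc D.a D.b, F y * D.u y * cubeRest D.v n₁ n₂ n₃ y).re := by
  obtain ⟨i₁, hi₁, i₂, hi₂, i₃, hi₃, h⟩ := exists_fixed_left hA h
  refine ⟨i₁, hi₁, i₂, hi₂, i₃, hi₃, ?_⟩
  have hc : ∀ {n₁ n₂ n₃ n₁' n₂' n₃' : ℤ}, 2 * k ∣ n₁ - n₁' → 2 * k ∣ n₂ - n₂' →
      2 * k ∣ n₃ - n₃' →
      (∑ y ∈ Finset.Icc D.a D.b, F y * D.u y * cubeRest D.v n₁ n₂ n₃ y).re =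
      (∑ y ∈ Finset.Icc D.a D.b, F y * D.u y * cubeRest D.v n₁' n₂' n₃' y).re := by
    intro n₁ n₂ n₃ n₁' n₂' n₃' h₁ h₂ h₃
    refine congrArg Complex.re (Finset.sum_congr rfl fun y _ => ?_)
    rw [cubeRest_congr D.periodic_v h₁ h₂ h₃]
  have e₃ : ∀ n₁ n₂, _ := fun n₁ n₂ => sum_sideSet_eq hk hg₃ i₃
    (fun n₃ => (∑ y ∈ Finset.Icc D.a D.b, F y * D.u y * cubeRest D.v n₁ n₂ n₃ y).re)
    (fun n n' hn => hc (by simp) (by simp) hn)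
  simp only [e₃]
  have e₂ : ∀ n₁, _ := fun n₁ => sum_sideSet_eq hk hg₂ i₂
    (fun n₂ => (A : ℝ) * ∑ j ∈ Finset.range A, (∑ y ∈ Finset.Icc D.a D.b,
      F y * D.u y * cubeRest D.v n₁ n₂ (2 * m₃ * j - 2 * m₃ * i₃) y).re)
    (fun n n' hn => congrArg _ (Finset.sum_congr rfl fun j _ => hc (by simp) hn (by simp)))
  simp only [e₂]
  rw [sum_sideSet_eq hk hg₁ i₁ _ (fun n n' hn => congrArg _ (Finset.sum_congr rfl fun j _ =>
    congrArg _ (Finset.sum_congr rfl fun j' _ => hc hn (by simp) (by simp))))]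
  calc (A : ℝ) ^ 6 * V = (A : ℝ) ^ 3 * ((A : ℝ) ^ 3 * V) := by ring
    _ ≤ _ := mul_le_mul_of_nonneg_left h (by positivity)
    _ = _ := by
      simp only [Finset.mul_sum]
      refine Finset.sum_congr rfl fun j₁ _ => Finset.sum_congr rfl fun j₂ _ =>
        Finset.sum_congr rfl fun j₃ _ => ?_
      ring

/-! ### Cauchy–Schwarz on cubes, and Gowers sums of the differences of `F`. -/

theorem cube_cauchySchwarz_step {ι : Type*} (Θ : Finset ι) (𝒩 : Finset ℤ) {a b r : ℤ}
    {f c : ι → ℤ → ℂ} {w V : ℝ} (hf : ∀ θ, Function.support (f θ) ⊆ Set.Icc a b)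
    (hc : ∀ θ z, ‖c θ z‖ ≤ 1) (hr : ∀ n ∈ 𝒩, |n| ≤ r) (hw0 : 0 < w)
    (hw : ((Finset.Icc (a - r) (b + r)).card : ℝ) ≤ w) (hV0 : 0 ≤ V)
    (hV : Θ.card * 𝒩.card * V ≤ ∑ θ ∈ Θ, ∑ n ∈ 𝒩, (∑' z, f θ z * c θ (z + n)).re) :
    Θ.card * 𝒩.card ^ 2 * (V ^ 2 / w) ≤
      ∑ θ ∈ Θ, ∑ n ∈ 𝒩, ∑ n' ∈ 𝒩, (∑' z, multDiff (n - n') (f θ) z).re := by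
  rw [← mul_div_assoc, div_le_iff₀ hw0, mul_comm _ w]
  refine cube_cauchySchwarz_family Θ 𝒩 hf hc hr hw hV0 (hV.trans ?_)
  refine Finset.sum_le_sum fun θ _ => ?_
  rw [← Complex.re_sum]
  exact Complex.re_le_norm _

theorem conj_multDiff (n : ℤ) (f : ℤ → ℂ) :
    multDiff n (fun z => conj (f z)) = fun z => conj (multDiff n f z) := by
  funext z
  simp [multDiff]

/-- The seven vertices of a cube other than its base point are removed by three applications of
the Cauchy-Schwarz inequality. -/
theorem cube_cauchySchwarz {𝒩₁ 𝒩₂ 𝒩₃ : Finset ℤ} {K : ℕ} (hK₁ : 𝒩₁.card = K) (hK₂ : 𝒩₂.card = K)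
    (hK₃ : 𝒩₃.card = K) {a b r : ℤ} {H v : ℤ → ℂ} {w V V₁ V₂ V₃ : ℝ}
    (hH : Function.support H ⊆ Set.Icc a b)
    (hv : ∀ z, ‖v z‖ ≤ 1) (hr₁ : ∀ n ∈ 𝒩₁, |n| ≤ r) (hr₂ : ∀ n ∈ 𝒩₂, |n| ≤ r)
    (hr₃ : ∀ n ∈ 𝒩₃, |n| ≤ r) (hw0 : 0 < w)
    (hw : ((Finset.Icc (a - r) (b + r)).card : ℝ) ≤ w) (hV0 : 0 ≤ V)
    (hV₁ : V₁ = V ^ 2 / w) (hV₂ : V₂ = V₁ ^ 2 / w) (hV₃ : V₃ = V₂ ^ 2 / w)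
    (h : (K : ℝ) ^ 3 * V ≤ ∑ n₁ ∈ 𝒩₁, ∑ n₂ ∈ 𝒩₂, ∑ n₃ ∈ 𝒩₃,
      (∑' z, H z * cubeRest v n₁ n₂ n₃ z).re) :
    (K : ℝ) ^ 6 * V₃ ≤ ∑ n₁ ∈ 𝒩₁, ∑ n₁' ∈ 𝒩₁, ∑ n₂ ∈ 𝒩₂, ∑ n₂' ∈ 𝒩₂, ∑ n₃ ∈ 𝒩₃, ∑ n₃' ∈ 𝒩₃,
      (∑' z, multDiff (n₁ - n₁') (multDiff (n₂ - n₂') (multDiff (n₃ - n₃') H)) z).re := by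
  have hV₁0 : 0 ≤ V₁ := by rw [hV₁]; positivity
  have hV₂0 : 0 ≤ V₂ := by rw [hV₂]; positivity
  have hcv : ∀ {f : ℤ → ℂ}, (∀ z, ‖f z‖ ≤ 1) → ∀ z, ‖conj (f z)‖ ≤ 1 := fun hf z => by
    rw [RCLike.norm_conj]; exact hf z
  have hsup : ∀ {f g : ℤ → ℂ}, Function.support f ⊆ Set.Icc a b →
      Function.support (fun z => f z * g z) ⊆ Set.Icc a b := fun hf =>
    (Function.support_mul_subset_left _ _).trans hf
  -- For fixed `n₁`, `n₂` the four vertices involving `n₃` form one bounded function of `z + n₃` and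
  -- go together. Of the remaining vertices two then involve `n₂`, and the last one only `n₁`.
  have step₃ : (K : ℝ) ^ 4 * V₁ ≤ ∑ n₁ ∈ 𝒩₁, ∑ n₂ ∈ 𝒩₂, ∑ n₃ ∈ 𝒩₃, ∑ n₃' ∈ 𝒩₃,
      (∑' z, multDiff (n₃ - n₃') (fun z => H z * conj (v (z + n₁))) z *
        conj (multDiff (n₃ - n₃') (multDiff n₁ v) (z + n₂))).re := by
    have := cube_cauchySchwarz_step (𝒩₁ ×ˢ 𝒩₂) 𝒩₃ (a := a) (b := b) (r := r) (w := w) (V := V)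
      (f := fun θ z => H z * conj (v (z + θ.1)) * conj (multDiff θ.1 v (z + θ.2)))
      (c := fun θ z => conj (multDiff θ.2 (multDiff θ.1 v) z))
      (fun θ => hsup (hsup hH))
      (fun θ => hcv (norm_multDiff_le (norm_multDiff_le hv _) _)) hr₃ hw0 hw hV0
      (by
        rw [Finset.card_product, hK₁, hK₂, hK₃, Finset.sum_product]
        refine le_trans (le_of_eq (by push_cast; ring)) (h.trans (le_of_eq ?_))
        refine Finset.sum_congr rfl fun n₁ _ => Finset.sum_congr rfl fun n₂ _ =>
          Finset.sum_congr rfl fun n₃ _ => ?_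
        refine congrArg Complex.re (tsum_congr fun z => ?_)
        simp only [cubeRest]
        ring)
    rw [Finset.card_product, hK₁, hK₂, hK₃, Finset.sum_product, ← hV₁] at this
    refine le_trans (le_of_eq (by push_cast; ring)) (this.trans (le_of_eq ?_))
    refine Finset.sum_congr rfl fun n₁ _ => Finset.sum_congr rfl fun n₂ _ =>
          Finset.sum_congr rfl fun n₃ _ => Finset.sum_congr rfl fun n₃' _ => ?_
    refine congrArg Complex.re (tsum_congr fun z => ?_)
    have e := multDiff_mul (n₃ - n₃') (fun z => H z * conj (v (z + n₁)))
      (fun z => conj (multDiff n₁ v (z + n₂)))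
    rw [e, conj_multDiff, multDiff_shift]
  have step₂ : (K : ℝ) ^ 5 * V₂ ≤ ∑ n₁ ∈ 𝒩₁, ∑ n₂ ∈ 𝒩₂, ∑ n₂' ∈ 𝒩₂, ∑ n₃ ∈ 𝒩₃, ∑ n₃' ∈ 𝒩₃,
      (∑' z, multDiff (n₂ - n₂') (multDiff (n₃ - n₃') H) z *
        conj (multDiff (n₂ - n₂') (multDiff (n₃ - n₃') v) (z + n₁))).re := by
    have := cube_cauchySchwarz_step (𝒩₁ ×ˢ (𝒩₃ ×ˢ 𝒩₃)) 𝒩₂ (a := a) (b := b) (r := r) (w := w)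
      (V := V₁)
      (f := fun θ => multDiff (θ.2.1 - θ.2.2) (fun z => H z * conj (v (z + θ.1))))
      (c := fun θ z => conj (multDiff (θ.2.1 - θ.2.2) (multDiff θ.1 v) z))
      (fun θ => (multDiff_support_subset _ _).trans (hsup hH))
      (fun θ => hcv (norm_multDiff_le (norm_multDiff_le hv _) _)) hr₂ hw0 hw hV₁0
      (by
        rw [Finset.card_product, Finset.card_product, hK₁, hK₂, hK₃]
        simp only [Finset.sum_product]
        refine le_trans (le_of_eq (by push_cast; ring)) (step₃.trans (le_of_eq ?_))
        refine Finset.sum_congr rfl fun n₁ _ => ?_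
        rw [Finset.sum_comm]
        refine Finset.sum_congr rfl fun n₃ _ => ?_
        rw [Finset.sum_comm])
    rw [Finset.card_product, Finset.card_product, hK₁, hK₂, hK₃, ← hV₂] at this
    simp only [Finset.sum_product] at this
    refine le_trans (le_of_eq (by push_cast; ring)) (this.trans (le_of_eq ?_))
    refine Finset.sum_congr rfl fun n₁ _ => ?_
    have e : ∀ n₂ n₂' n₃ n₃' : ℤ, (∑' z, multDiff (n₂ - n₂') (multDiff (n₃ - n₃')
        (fun z => H z * conj (v (z + n₁)))) z) =
        ∑' z, multDiff (n₂ - n₂') (multDiff (n₃ - n₃') H) z *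
        conj (multDiff (n₂ - n₂') (multDiff (n₃ - n₃') v) (z + n₁)) := by
      intro n₂ n₂' n₃ n₃'
      refine tsum_congr fun z => ?_
      rw [multDiff_mul, multDiff_mul, conj_multDiff, conj_multDiff, multDiff_shift, multDiff_shift]
    simp only [e]
    rw [Finset.sum_congr rfl fun n₃ _ => Finset.sum_comm, Finset.sum_comm]
    refine Finset.sum_congr rfl fun n₂ _ => ?_
    rw [Finset.sum_congr rfl fun n₃ _ => Finset.sum_comm, Finset.sum_comm]
  have := cube_cauchySchwarz_step ((𝒩₂ ×ˢ 𝒩₂) ×ˢ (𝒩₃ ×ˢ 𝒩₃)) 𝒩₁ (a := a) (b := b) (r := r) (w := w)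
    (V := V₂)
    (f := fun θ => multDiff (θ.1.1 - θ.1.2) (multDiff (θ.2.1 - θ.2.2) H))
    (c := fun θ z => conj (multDiff (θ.1.1 - θ.1.2) (multDiff (θ.2.1 - θ.2.2) v) z))
    (fun θ => (multDiff_support_subset _ _).trans ((multDiff_support_subset _ _).trans hH))
    (fun θ => hcv (norm_multDiff_le (norm_multDiff_le hv _) _)) hr₁ hw0 hw hV₂0
    (by
      rw [Finset.card_product, Finset.card_product, Finset.card_product, hK₁, hK₂, hK₃,
        Finset.sum_comm]
      simp only [Finset.sum_product]
      exact le_trans (le_of_eq (by push_cast; ring)) step₂)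
  rw [Finset.card_product, Finset.card_product, Finset.card_product, hK₁, hK₂, hK₃, ← hV₃,
    Finset.sum_comm, Finset.sum_congr rfl fun n₁ _ => Finset.sum_comm] at this
  simp only [Finset.sum_product] at this
  exact le_trans (le_of_eq (by push_cast; ring)) this

theorem multDiff_indicator_Icc (n a b : ℤ) :
    multDiff n ((Set.Icc a b).indicator fun _ => (1 : ℂ)) =
      (Set.Icc (max a (a - n)) (min b (b - n))).indicator fun _ => (1 : ℂ) := by
  funext z
  simp only [multDiff, Set.indicator_apply, Set.mem_Icc]
  split_ifs <;> first | omega | simp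

theorem exists_multDiff_three_indicator_Icc (n₁ n₂ n₃ a b : ℤ) :
    ∃ a' b', a ≤ a' ∧ b' ≤ b ∧
      multDiff n₁ (multDiff n₂ (multDiff n₃ ((Set.Icc a b).indicator fun _ => (1 : ℂ)))) =
        (Set.Icc a' b').indicator fun _ => (1 : ℂ) := by
  simp only [multDiff_indicator_Icc]
  exact ⟨_, _, by simp, by simp, rfl⟩

/-- If a function agrees with `F` times a `t`-periodic function on an interval, then correlation of
its third differences yields `U³`-type control of the differences of `F` by multiples of `t`. -/
theorem le_sum_gowersRe_multDiff {𝒩₁ 𝒩₂ 𝒩₃ : Finset ℤ} {K A : ℕ} (hK₁ : 𝒩₁.card = K)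
    (hK₂ : 𝒩₂.card = K) (hK₃ : 𝒩₃.card = K) {a b t : ℤ} {F u : ℤ → ℂ} {w V : ℝ}
    (hfin : (Function.support F).Finite) (hF : ∀ z, ‖F z‖ ≤ 1) (hu : ∀ z, ‖u z‖ ≤ 1)
    (hp : Function.Periodic u t) (hw0 : 0 < w) (hw : ((Finset.Icc a b).card : ℝ) ≤ w) (hV0 : 0 ≤ V)
    (htA : 4 * |(t : ℝ)| * A ≤ V) {c₁ c₂ c₃ : ℤ}
    (h : (K : ℝ) ^ 3 * V ≤ ∑ n₁ ∈ 𝒩₁, ∑ n₂ ∈ 𝒩₂, ∑ n₃ ∈ 𝒩₃,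
      (∑' z, multDiff (n₁ - c₁) (multDiff (n₂ - c₂) (multDiff (n₃ - c₃)
        (fun z => F z * u z * (Set.Icc a b).indicator (fun _ => (1 : ℂ)) z))) z).re) :
    (K : ℝ) ^ 3 * A ^ 2 * (V ^ 2 / (4 * w)) ≤ ∑ i ∈ Finset.range A, ∑ i' ∈ Finset.range A,
      gowersRe 3 (multDiff (t * i' - t * i) F) := by
  set Θ := 𝒩₁ ×ˢ (𝒩₂ ×ˢ 𝒩₃) with hΘ
  have hcard : (Θ.card : ℝ) = (K : ℝ) ^ 3 := by
    rw [hΘ, Finset.card_product, Finset.card_product, hK₁, hK₂, hK₃]; push_cast; ring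
  set D : ℤ × (ℤ × ℤ) → (ℤ → ℂ) → ℤ → ℂ := fun θ f =>
    multDiff (θ.1 - c₁) (multDiff (θ.2.1 - c₂) (multDiff (θ.2.2 - c₃) f)) with hD
  choose a' b' ha' hb' hab using fun θ : ℤ × (ℤ × ℤ) =>
    exists_multDiff_three_indicator_Icc (θ.1 - c₁) (θ.2.1 - c₂) (θ.2.2 - c₃) a b
  have hsum : ∀ θ, (∑' z, D θ (fun z => F z * u z * (Set.Icc a b).indicator (fun _ => (1 : ℂ)) z) z) =
      ∑ z ∈ Finset.Icc (a' θ) (b' θ), D θ u z * D θ F z := by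
    intro θ
    have e : D θ (fun z => F z * u z * (Set.Icc a b).indicator (fun _ => (1 : ℂ)) z) =
        fun z => D θ F z * D θ u z * (Set.Icc (a' θ) (b' θ)).indicator (fun _ => (1 : ℂ)) z := by
      simp only [hD, multDiff_mul]
      rw [hab]
    rw [e, tsum_eq_sum (s := Finset.Icc (a' θ) (b' θ))]
    · refine Finset.sum_congr rfl fun z hz => ?_
      rw [Set.indicator_of_mem (by simpa using hz), mul_one, mul_comm]
    · intro z hz
      rw [Set.indicator_of_notMem (by simpa using hz), mul_zero]
  have hb : ∀ f : ℤ → ℂ, (∀ z, ‖f z‖ ≤ 1) → ∀ θ z, ‖D θ f z‖ ≤ 1 := fun f hf θ =>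
    norm_multDiff_le (norm_multDiff_le (norm_multDiff_le hf _) _) _
  have h1 := vanDerCorput_family Θ a' b' (t := t) (A := A) (u := fun θ => D θ u)
    (X := fun θ => D θ F) (b := w) (V := V) (hb u hu) (hb F hF)
    (fun θ => multDiff_periodic (multDiff_periodic (multDiff_periodic hp _) _) _)
    (fun θ _ => le_trans (Nat.cast_le.2 (Finset.card_le_card
      (Finset.Icc_subset_Icc (ha' θ) (hb' θ)))) hw) hV0 htA (by
      rw [hcard]
      refine h.trans ?_
      rw [hΘ]
      simp only [Finset.sum_product]
      refine Finset.sum_le_sum fun n₁ _ => Finset.sum_le_sum fun n₂ _ =>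
        Finset.sum_le_sum fun n₃ _ => ?_
      rw [← hsum]
      exact Complex.re_le_norm _)
  have h2 := hasSum_norm_sq_shifts hfin 3 (Finset.range A) (fun i => t * (i : ℤ))
  -- After `u` is removed the terms are squares, so the sum over the sides in the given sets embeds
  -- in the unrestricted sum over all points and all steps.
  set e : (_ : ℤ × (ℤ × ℤ)) × ℤ → ℤ × (Fin 3 → ℤ) := fun p =>
    (p.2, ![p.1.1 - c₁, p.1.2.1 - c₂, p.1.2.2 - c₃]) with he
  have hinj : Function.Injective e := by
    rintro ⟨⟨x₁, x₂, x₃⟩, z⟩ ⟨⟨y₁, y₂, y₃⟩, z'⟩ hxy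
    simp only [he, Prod.mk.injEq] at hxy
    obtain ⟨rfl, hv⟩ := hxy
    have q₀ := congrFun hv 0
    have q₁ := congrFun hv 1
    have q₂ := congrFun hv 2
    simp at q₀ q₁ q₂
    subst q₀ q₁ q₂
    rfl
  have h3 : ∑ θ ∈ Θ, ∑ z ∈ Finset.Icc (a' θ) (b' θ), ‖∑ i ∈ Finset.range A, D θ F (z + t * i)‖ ^ 2 ≤
      ∑ i ∈ Finset.range A, ∑ i' ∈ Finset.range A, gowersRe 3 (multDiff (t * i' - t * i) F) := by
    rw [Finset.sum_sigma']
    refine le_trans (le_of_eq ?_)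
      (sum_le_hasSum ((Θ.sigma fun θ => Finset.Icc (a' θ) (b' θ)).map ⟨e, hinj⟩)
        (fun _ _ => by positivity) h2)
    rw [Finset.sum_map]
    rfl
  rw [hcard] at h1
  rw [← mul_div_assoc, div_le_iff₀ (by positivity)]
  calc (K : ℝ) ^ 3 * A ^ 2 * V ^ 2 ≤ _ := h1
    _ ≤ _ := mul_le_mul_of_nonneg_left h3 (by positivity)
    _ = _ := mul_comm _ _

theorem exists_fixed_right {𝒩₁ 𝒩₂ 𝒩₃ : Finset ℤ} {K : ℕ} (hK : 0 < K) (hK₁ : 𝒩₁.card = K)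
    (hK₂ : 𝒩₂.card = K) (hK₃ : 𝒩₃.card = K) {V : ℝ} {g : ℤ → ℤ → ℤ → ℤ → ℤ → ℤ → ℝ}
    (h : (K : ℝ) ^ 6 * V ≤ ∑ n₁ ∈ 𝒩₁, ∑ n₁' ∈ 𝒩₁, ∑ n₂ ∈ 𝒩₂, ∑ n₂' ∈ 𝒩₂, ∑ n₃ ∈ 𝒩₃, ∑ n₃' ∈ 𝒩₃,
      g n₁ n₁' n₂ n₂' n₃ n₃') :
    ∃ c₁ c₂ c₃, (K : ℝ) ^ 3 * V ≤ ∑ n₁ ∈ 𝒩₁, ∑ n₂ ∈ 𝒩₂, ∑ n₃ ∈ 𝒩₃, g n₁ c₁ n₂ c₂ n₃ c₃ := by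
  have ne : ∀ {𝒩 : Finset ℤ}, 𝒩.card = K → 𝒩.Nonempty := fun h => Finset.card_pos.1 (h ▸ hK)
  rw [Finset.sum_comm] at h
  obtain ⟨c₁, _, h⟩ := exists_le_of_card_mul_le_sum (ne hK₁) (V := (K : ℝ) ^ 5 * V)
    (le_trans (le_of_eq (by rw [hK₁]; ring)) h)
  have h' : (K : ℝ) ^ 5 * V ≤ ∑ n₂' ∈ 𝒩₂, ∑ n₁ ∈ 𝒩₁, ∑ n₂ ∈ 𝒩₂, ∑ n₃ ∈ 𝒩₃, ∑ n₃' ∈ 𝒩₃,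
      g n₁ c₁ n₂ n₂' n₃ n₃' := by
    rw [Finset.sum_comm]
    refine h.trans (le_of_eq (Finset.sum_congr rfl fun _ _ => ?_))
    rw [Finset.sum_comm]
  obtain ⟨c₂, _, h⟩ := exists_le_of_card_mul_le_sum (ne hK₂) (V := (K : ℝ) ^ 4 * V)
    (le_trans (le_of_eq (by rw [hK₂]; ring)) h')
  have h'' : (K : ℝ) ^ 4 * V ≤ ∑ n₃' ∈ 𝒩₃, ∑ n₁ ∈ 𝒩₁, ∑ n₂ ∈ 𝒩₂, ∑ n₃ ∈ 𝒩₃,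
      g n₁ c₁ n₂ c₂ n₃ n₃' := by
    rw [Finset.sum_comm]
    refine h.trans (le_of_eq (Finset.sum_congr rfl fun _ _ => ?_))
    symm
    rw [Finset.sum_comm]
    refine Finset.sum_congr rfl fun _ _ => ?_
    rw [Finset.sum_comm]
  obtain ⟨c₃, _, h⟩ := exists_le_of_card_mul_le_sum (ne hK₃) (V := (K : ℝ) ^ 3 * V)
    (le_trans (le_of_eq (by rw [hK₃]; ring)) h'')
  exact ⟨c₁, c₂, c₃, h⟩

/-- Control of a correlation of `D.v` with three periodic functions by Gowers sums. -/
theorem PeriodicDatum.exists_le_sum_gowersRe {F : ℤ → ℂ} {k l : ℤ} {N T A : ℕ} {W : ℝ}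
    (D : PeriodicDatum F k l N W) (hT : 2 ^ 10 ≤ T) (hA : 0 < A) (hAT : A * T ^ 2548 ≤ N)
    (hW0 : 0 < W) (hW : W ≤ (T : ℝ) ^ 17) (hF : ∀ z, ‖F z‖ ≤ 1)
    (hfin : (Function.support F).Finite) {l' k' : ℤ} (hk : |k| ≤ 3 * N) (hl : |l| ≤ 3 * N)
    (hl' : |l'| ≤ 3 * N) (hk' : |k'| ≤ 3 * N) (hkT : (N : ℤ) ≤ T * |k|)
    (hg₁ : Int.gcd l k ≤ T ^ 37) (hg₂ : Int.gcd l' k ≤ T ^ 37) (hg₃ : Int.gcd k' k ≤ T ^ 37)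
    {q₁ q₂ q₃ : ℤ → ℂ} (h₁ : ∀ z, ‖q₁ z‖ ≤ 1) (h₂ : ∀ z, ‖q₂ z‖ ≤ 1) (h₃ : ∀ z, ‖q₃ z‖ ≤ 1)
    (p₁ : Function.Periodic q₁ (2 * l)) (p₂ : Function.Periodic q₂ (2 * l'))
    (p₃ : Function.Periodic q₃ (2 * k')) {α β : ℤ} (hαβ : α ≤ β + 1)
    (hlen : (β - α + 1 : ℝ) ≤ 2 * N ^ 2)
    (h : (N : ℝ) ^ 2 / T ^ 37 ≤ ‖∑ z ∈ Finset.Icc α β, q₁ z * (q₂ z * (q₃ z * D.v z))‖) :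
    ∃ i ∈ Finset.range A, (A : ℝ) ^ 7 * (N ^ 2 / T ^ 5093) ≤
      ∑ i' ∈ Finset.range A, gowersRe 3 (multDiff (2 * l * i' - 2 * l * i) F) := by
  have hTR : (2 : ℝ) ^ 10 ≤ T := by exact_mod_cast hT
  have hT0 : (0 : ℝ) < T := lt_of_lt_of_le (by norm_num) hTR
  have hT1 : (1 : ℝ) ≤ T := le_trans (by norm_num) hTR
  have hATR : (A : ℝ) * T ^ 2548 ≤ N := by exact_mod_cast hAT
  have hAR : (1 : ℝ) ≤ A := by exact_mod_cast hA
  have hN0 : (0 : ℝ) < N := lt_of_lt_of_le (by positivity) hATR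
  have hNpos : 0 < N := by exact_mod_cast hN0
  have hk0 : k ≠ 0 := by rintro rfl; simp at hkT; omega
  have hkR : (N : ℝ) ≤ T * |(k : ℝ)| := by exact_mod_cast hkT
  have hcast : ∀ m : ℤ, |m| ≤ 3 * N → |((2 * m : ℤ) : ℝ)| ≤ 6 * N := by
    intro m hm
    have : |(m : ℝ)| ≤ 3 * N := by exact_mod_cast hm
    push_cast
    rw [abs_mul, abs_two]
    linarith
  have hNA : 24 * (N : ℝ) * A ≤ (N : ℝ) ^ 2 / T ^ 2546 := by
    rw [le_div_iff₀ (by positivity)]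
    calc 24 * (N : ℝ) * A * T ^ 2546 = N * (A * (24 * (T : ℝ) ^ 2546)) := by ring
      _ ≤ N * (A * ((T : ℝ) ^ 2 * T ^ 2546)) := by
        gcongr
        nlinarith
      _ = N * (A * (T : ℝ) ^ 2548) := by ring
      _ ≤ (N : ℝ) * N := by gcongr
      _ = (N : ℝ) ^ 2 := by ring
  have ht : ∀ m : ℤ, |m| ≤ 3 * N → 4 * |((2 * m : ℤ) : ℝ)| * A ≤ (N : ℝ) ^ 2 / T ^ 2546 := by
    intro m hm
    refine le_trans ?_ hNA
    have := hcast m hm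
    calc 4 * |((2 * m : ℤ) : ℝ)| * A ≤ 4 * (6 * N) * A := by gcongr
      _ = 24 * (N : ℝ) * A := by ring
  have hle : ∀ (c : ℝ) (e : ℕ), 0 < c → c ≤ (T : ℝ) ^ 3 → e + 3 ≤ 2546 →
      (N : ℝ) ^ 2 / T ^ 2546 ≤ (N : ℝ) ^ 2 / (c * T ^ e) := by
    intro c e hc0 hc he
    have h4 : c * (T : ℝ) ^ e ≤ T ^ 2546 :=
      calc c * (T : ℝ) ^ e ≤ T ^ 3 * T ^ e := by gcongr
        _ = (T : ℝ) ^ (e + 3) := by ring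
        _ ≤ T ^ 2546 := pow_le_pow_right₀ hT1 he
    gcongr
  have hT3 : (2 : ℝ) ^ 30 ≤ T ^ 3 := by
    calc (2 : ℝ) ^ 30 = (2 ^ 10) ^ 3 := by norm_num
      _ ≤ _ := by gcongr
  have hcardαβ : ((Finset.Icc α β).card : ℝ) ≤ 2 * N ^ 2 := by
    rw [Int.card_Icc]
    have h4 : ((β + 1 - α).toNat : ℤ) = β + 1 - α := Int.toNat_of_nonneg (by linarith)
    have h5 : ((β + 1 - α).toNat : ℝ) = ((β + 1 - α : ℤ) : ℝ) := by
      exact_mod_cast congrArg (Int.cast (R := ℝ)) h4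
    rw [h5]; push_cast; linarith
  -- Each of the three steps squares the value and divides it by `4b = 8N²`.
  have s1 := vanDerCorput_three (A := A) (b := 2 * (N : ℝ) ^ 2) (V := (N : ℝ) ^ 2 / T ^ 37)
    (V₁ := (N : ℝ) ^ 2 / (8 * T ^ 74)) (V₂ := (N : ℝ) ^ 2 / (8 ^ 3 * T ^ 148))
    (V₃ := (N : ℝ) ^ 2 / (8 ^ 7 * T ^ 296))
    (by positivity) h₁ h₂ h₃ D.norm_v_le p₁ p₂ p₃ hcardαβ (by positivity)
    (by field_simp; ring) (by field_simp; ring) (by field_simp; ring)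
    ((ht l hl).trans (by simpa using hle 1 37 one_pos (one_le_pow₀ hT1) (by norm_num)))
    ((ht l' hl').trans (hle 8 74 (by norm_num) (le_trans (by norm_num) hT3) (by norm_num)))
    ((ht k' hk').trans (hle (8 ^ 3) 148 (by norm_num) (le_trans (by norm_num) hT3) (by norm_num)))
    h
  have hRpos : (0 : ℝ) < T * W := by positivity
  have s2 := D.le_sum_cubeRest (R := T * W) hF hk0 hA hNpos hαβ hRpos
    (by
      have hL := D.L_pos
      have hk1 : (0 : ℝ) < |(k : ℝ)| := abs_pos.2 (by exact_mod_cast hk0)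
      push_cast
      rw [abs_mul, abs_two, div_div, div_le_iff₀ (by positivity)]
      have := D.N_le
      calc (β - α + 1 : ℝ) ≤ 2 * (N * N) := by linarith
        _ ≤ 2 * ((T * |(k : ℝ)|) * (W * D.L)) := by gcongr
        _ = _ := by ring)
    (by
      rw [le_div_iff₀ (by positivity)]
      calc 4 * (N : ℝ) * (8 ^ 7 * T ^ 296) = N * (1 * (2 ^ 23 * (T : ℝ) ^ 296)) := by ring
        _ ≤ N * (A * ((T : ℝ) ^ 3 * T ^ 296)) := by
          gcongr
          exact le_trans (by norm_num) hT3
        _ = N * (A * (T : ℝ) ^ 299) := by ring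
        _ ≤ N * (A * (T : ℝ) ^ 2548) := by
          gcongr
          norm_num
        _ ≤ (N : ℝ) * N := by gcongr
        _ = (N : ℝ) ^ 2 := by ring) s1
  have hV4 : (N : ℝ) ^ 2 / T ^ 318 ≤ (N : ℝ) ^ 2 / (8 ^ 7 * T ^ 296) / (2 * (T * W)) := by
    rw [div_div]
    have : 8 ^ 7 * T ^ 296 * (2 * (T * W)) ≤ (T : ℝ) ^ 318 :=
      calc 8 ^ 7 * T ^ 296 * (2 * (T * W)) ≤ 8 ^ 7 * T ^ 296 * (2 * (T * (T : ℝ) ^ 17)) := by gcongr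
        _ = 2 ^ 22 * (T : ℝ) ^ 314 := by ring
        _ ≤ (T : ℝ) ^ 3 * T ^ 314 := by
          gcongr
          exact le_trans (by norm_num) hT3
        _ = (T : ℝ) ^ 317 := by ring
        _ ≤ (T : ℝ) ^ 318 := pow_le_pow_right₀ hT1 (by norm_num)
    gcongr
  have hgcd : ∀ m : ℤ, Int.gcd m k ≤ T ^ 37 → (A : ℤ) * Int.gcd m k ≤ |k| := by
    intro m hm
    have h4 : (Int.gcd m k : ℤ) ≤ (T : ℤ) ^ 37 := by exact_mod_cast hm
    have hTZ : (1 : ℤ) ≤ T := by exact_mod_cast hT1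
    have h5 : (T : ℤ) * (A * Int.gcd m k) ≤ T * |k| := by
      calc (T : ℤ) * (A * Int.gcd m k) ≤ T * (A * T ^ 37) := by gcongr
        _ = A * T ^ 38 := by ring
        _ ≤ A * (T : ℤ) ^ 2548 := by
          gcongr
          norm_num
        _ ≤ N := by exact_mod_cast hAT
        _ ≤ T * |k| := hkT
    exact le_of_mul_le_mul_left h5 (by linarith)
  obtain ⟨i₁, hi₁, i₂, hi₂, i₃, hi₃, s3⟩ := D.exists_le_sum_sideSet (V := (N : ℝ) ^ 2 / T ^ 318)
    hk0 hA (hgcd l hg₁) (hgcd l' hg₂) (hgcd k' hg₃)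
    ((mul_le_mul_of_nonneg_left hV4 (by positivity)).trans s2)
  set J := (Set.Icc D.a D.b).indicator (fun _ => (1 : ℂ)) with hJ
  set H : ℤ → ℂ := fun z => F z * D.u z * J z with hH
  have hsupH : Function.support H ⊆ Set.Icc D.a D.b := by
    intro z hz
    by_contra hc
    exact hz (by simp only [hH, hJ, Set.indicator_of_notMem hc, mul_zero])
  have hsumH : ∀ n₁ n₂ n₃, ∑ y ∈ Finset.Icc D.a D.b, F y * D.u y * cubeRest D.v n₁ n₂ n₃ y =
      ∑' y, H y * cubeRest D.v n₁ n₂ n₃ y := by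
    intro n₁ n₂ n₃
    rw [tsum_eq_sum (s := Finset.Icc D.a D.b)]
    · refine Finset.sum_congr rfl fun z hz => ?_
      simp only [hH, hJ, Set.indicator_of_mem (show z ∈ Set.Icc D.a D.b by simpa using hz), mul_one]
    · intro z hz
      simp only [hH, hJ, Set.indicator_of_notMem (show z ∉ Set.Icc D.a D.b by simpa using hz),
        mul_zero, zero_mul]
  have hcard : ∀ a b : ℤ, a ≤ b + 1 → ((Finset.Icc a b).card : ℝ) = b - a + 1 := by
    intro a b hab
    rw [Int.card_Icc]
    have h4 : ((b + 1 - a).toNat : ℤ) = b + 1 - a := Int.toNat_of_nonneg (by linarith)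
    have h5 : ((b + 1 - a).toNat : ℝ) = ((b + 1 - a : ℤ) : ℝ) := by
      exact_mod_cast congrArg (Int.cast (R := ℝ)) h4
    rw [h5]; push_cast; ring
  have hab := D.a_le_b
  have hlenJ := D.length_le
  have hNA2 : 24 * (N : ℝ) * A ≤ (N : ℝ) ^ 2 :=
    hNA.trans (div_le_self (by positivity) (one_le_pow₀ hT1))
  simp only [hsumH] at s3
  -- The sides now run over `A²` distinct integers of size at most `12NA ≤ N²/2`, so a window of
  -- length `4N²` suffices.
  have s4 := cube_cauchySchwarz (r := 12 * N * A) (w := 4 * (N : ℝ) ^ 2) (V := (N : ℝ) ^ 2 / T ^ 318)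
    (V₁ := (N : ℝ) ^ 2 / (4 * T ^ 636)) (V₂ := (N : ℝ) ^ 2 / (4 ^ 3 * T ^ 1272))
    (V₃ := (N : ℝ) ^ 2 / (4 ^ 7 * T ^ 2544))
    (card_sideSet hk0 (hgcd l hg₁) i₁) (card_sideSet hk0 (hgcd l' hg₂) i₂)
    (card_sideSet hk0 (hgcd k' hg₃) i₃) hsupH D.norm_v_le
    (fun n hn => abs_le_of_mem_sideSet hl hk hi₁ hn)
    (fun n hn => abs_le_of_mem_sideSet hl' hk hi₂ hn)
    (fun n hn => abs_le_of_mem_sideSet hk' hk hi₃ hn) (by positivity)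
    (by
      rw [hcard _ _ (by nlinarith)]
      push_cast
      linarith)
    (by positivity) (by field_simp) (by field_simp) (by field_simp)
    (le_trans (le_of_eq (by push_cast; ring)) s3)
  have hV7 : (N : ℝ) ^ 2 / T ^ 2546 ≤ (N : ℝ) ^ 2 / (4 ^ 7 * T ^ 2544) := by
    have : 4 ^ 7 * T ^ 2544 ≤ (T : ℝ) ^ 2546 :=
      calc 4 ^ 7 * T ^ 2544 ≤ (T : ℝ) ^ 2 * T ^ 2544 := by
            gcongr
            nlinarith
        _ = (T : ℝ) ^ 2546 := by ring
    gcongr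
  obtain ⟨c₁, c₂, c₃, s5⟩ := exists_fixed_right (by positivity)
    (card_sideSet hk0 (hgcd l hg₁) i₁) (card_sideSet hk0 (hgcd l' hg₂) i₂)
    (card_sideSet hk0 (hgcd k' hg₃) i₃)
    (V := (N : ℝ) ^ 2 / T ^ 2546) ((mul_le_mul_of_nonneg_left hV7 (by positivity)).trans s4)
  have s6 := le_sum_gowersRe_multDiff (A := A) (w := (N : ℝ) ^ 2)
    (card_sideSet hk0 (hgcd l hg₁) i₁) (card_sideSet hk0 (hgcd l' hg₂) i₂)
    (card_sideSet hk0 (hgcd k' hg₃) i₃) hfin hF D.norm_u_le D.periodic_u (by positivity)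
    (by rw [hcard _ _ (by linarith)]; exact hlenJ) (by positivity) (ht l hl) s5
  refine exists_le_of_card_mul_le_sum ⟨0, Finset.mem_range.2 hA⟩ (le_trans ?_ s6)
  have hV8 : (N : ℝ) ^ 2 / T ^ 5093 ≤ ((N : ℝ) ^ 2 / T ^ 2546) ^ 2 / (4 * N ^ 2) := by
    have e : ((N : ℝ) ^ 2 / T ^ 2546) ^ 2 / (4 * N ^ 2) = (N : ℝ) ^ 2 / (4 * T ^ 5092) := by
      field_simp
    rw [e]
    have : 4 * T ^ 5092 ≤ (T : ℝ) ^ 5093 :=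
      calc 4 * T ^ 5092 ≤ (T : ℝ) * T ^ 5092 := by
            gcongr
            linarith
        _ = (T : ℝ) ^ 5093 := by ring
    gcongr
  rw [Finset.card_range]
  calc (A : ℝ) * (A ^ 7 * (N ^ 2 / T ^ 5093)) = A ^ 8 * ((N : ℝ) ^ 2 / T ^ 5093) := by ring
    _ ≤ A ^ 8 * (((N : ℝ) ^ 2 / T ^ 2546) ^ 2 / (4 * N ^ 2)) := by gcongr
    _ = _ := by push_cast; ring

/-! ### Comparing the data of two values of `k`. -/

/-- If `F` correlates with many functions on intervals, then these functions correlate with one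
another. -/
theorem sq_le_sum_norm_pairs {ι : Type*} {F : ℤ → ℂ} {M : ℕ} (hF : ∀ z, ‖F z‖ ≤ 1)
    (hsupp : Function.support F ⊆ Set.Icc 1 (M : ℤ)) (𝒦 : Finset ι) (a b : ι → ℤ)
    (q : ι → ℤ → ℂ) {X : ℝ} (hX : 0 ≤ X)
    (h : X ≤ ∑ k ∈ 𝒦, (∑ z ∈ Finset.Icc (a k) (b k), F z * q k z).re) :
    X ^ 2 ≤ M * ∑ k ∈ 𝒦, ∑ k' ∈ 𝒦,
      ‖∑ z ∈ Finset.Icc (max 1 (max (a k) (a k'))) (min (M : ℤ) (min (b k) (b k'))),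
        conj (q k z) * q k' z‖ := by
  set I := Finset.Icc (1 : ℤ) M
  set Q : ι → ℤ → ℂ := fun k z => if z ∈ Finset.Icc (a k) (b k) then q k z else 0 with hQ
  have h1 : ∀ k, ∑ z ∈ Finset.Icc (a k) (b k), F z * q k z = ∑ z ∈ I, F z * Q k z := by
    intro k
    have e1 : ∑ z ∈ Finset.Icc (a k) (b k), F z * q k z =
        ∑ z ∈ I ∩ Finset.Icc (a k) (b k), F z * q k z := by
      symm
      refine Finset.sum_subset Finset.inter_subset_right fun z hz hz' => ?_
      have : F z = 0 := by
        by_contra hc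
        have := hsupp hc
        exact hz' (Finset.mem_inter.2 ⟨by simpa [I] using this, hz⟩)
      rw [this, zero_mul]
    rw [e1, ← Finset.filter_mem_eq_inter, Finset.sum_filter]
    refine Finset.sum_congr rfl fun z _ => ?_
    simp only [hQ]
    split_ifs <;> simp
  have h2 : X ≤ ∑ z ∈ I, ‖∑ k ∈ 𝒦, Q k z‖ := by
    refine h.trans ?_
    rw [← Complex.re_sum]
    refine (Complex.re_le_norm _).trans ?_
    simp only [h1]
    rw [Finset.sum_comm]
    refine (norm_sum_le _ _).trans (Finset.sum_le_sum fun z _ => ?_)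
    rw [← Finset.mul_sum, norm_mul]
    exact mul_le_of_le_one_left (norm_nonneg _) (hF z)
  have h3 := sq_sum_le_card_mul_sum_sq (s := I) (f := fun z => ‖∑ k ∈ 𝒦, Q k z‖)
  have hI : (I.card : ℝ) = M := by simp [I]
  rw [hI] at h3
  refine (pow_le_pow_left₀ hX h2 2).trans (h3.trans ?_)
  gcongr
  have h4 : ((∑ z ∈ I, ‖∑ k ∈ 𝒦, Q k z‖ ^ 2 : ℝ) : ℂ) =
      ∑ k ∈ 𝒦, ∑ k' ∈ 𝒦, ∑ z ∈ Finset.Icc (max 1 (max (a k) (a k'))) (min (M : ℤ) (min (b k) (b k'))),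
        conj (q k z) * q k' z := by
    have e2 : ∀ k k', ∑ z ∈ Finset.Icc (max 1 (max (a k) (a k'))) (min (M : ℤ) (min (b k) (b k'))),
        conj (q k z) * q k' z = ∑ z ∈ I, conj (Q k z) * Q k' z := by
      intro k k'
      have e3 : Finset.Icc (max 1 (max (a k) (a k'))) (min (M : ℤ) (min (b k) (b k'))) =
          I.filter (fun z => z ∈ Finset.Icc (a k) (b k) ∧ z ∈ Finset.Icc (a k') (b k')) := by
        ext z
        simp only [I, Finset.mem_filter, Finset.mem_Icc]
        omega
      rw [e3, Finset.sum_filter]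
      refine Finset.sum_congr rfl fun z _ => ?_
      simp only [hQ]
      split_ifs with c1 c2 c3 c4 c5 <;> simp_all
    simp only [e2]
    rw [Complex.ofReal_sum, Finset.sum_congr rfl fun k _ => Finset.sum_comm, Finset.sum_comm]
    refine Finset.sum_congr rfl fun z _ => ?_
    rw [Complex.ofReal_pow, ← Complex.conj_mul', map_sum, Finset.sum_mul_sum]
  have h5 := congrArg Complex.re h4
  rw [Complex.ofReal_re] at h5
  rw [h5]
  refine (Complex.re_le_norm _).trans ((norm_sum_le _ _).trans (Finset.sum_le_sum fun k _ => ?_))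
  exact norm_sum_le _ _

theorem card_le_of_abs_le {ι : Type*} {κ : ι → ℤ} (hκ : Function.Injective κ) (𝒦 : Finset ι)
    {N : ℕ} (h : ∀ k ∈ 𝒦, |κ k| ≤ N) : 𝒦.card ≤ 2 * N + 1 := by
  have := Finset.card_le_card_of_injOn (s := 𝒦) (t := Finset.Icc (-(N : ℤ)) N) κ
    (fun k hk => by simpa [abs_le] using h k hk) hκ.injOn
  rw [Int.card_Icc] at this
  omega

theorem card_pairs_large_gcd_le {ι : Type*} {κ μ : ι → ℤ} (hκ : Function.Injective κ)
    (hμ : Function.Injective μ) (𝒦 : Finset ι) {R Q : ℕ} (hQ : 0 < Q)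
    (h : ∀ k ∈ 𝒦, |κ k| ≤ R ∧ |μ k| ≤ R ∧ κ k ≠ 0 ∧ μ k ≠ 0) :
    (((𝒦 ×ˢ 𝒦).filter fun p => Q < Int.gcd (μ p.2) (κ p.1)).card : ℝ) ≤ 4 * (R : ℝ) ^ 2 / Q := by
  refine le_trans ?_ (card_large_gcd_le R Q hQ)
  refine Nat.cast_le.2 (Finset.card_le_card_of_injOn (fun p => (μ p.2, κ p.1)) ?_ ?_)
  · rintro ⟨k, k'⟩ hp
    simp only [Finset.coe_filter, Set.mem_ofPred_eq, Finset.mem_product] at hp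
    obtain ⟨⟨hk, hk'⟩, hg⟩ := hp
    have h1 := h k hk
    have h2 := h k' hk'
    simp only [Finset.coe_filter, Set.mem_ofPred_eq, Finset.mem_product, Finset.mem_Icc, ← abs_le]
    exact ⟨⟨h2.2.1, h1.1⟩, h2.2.2.2, h1.2.2.1, hg⟩
  · rintro ⟨k, k'⟩ _ ⟨j, j'⟩ _ hp
    simp only [Prod.mk.injEq] at hp
    rw [hκ hp.2, hμ hp.1]

/-- Discarding the pairs with a large greatest common divisor from a large sum over pairs. -/
theorem exists_popular_coprime_pairs {ι : Type*} [DecidableEq ι] {κ : ι → ℤ}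
    (hκ : Function.Injective κ) (h : ℤ)
    (𝒦 : Finset ι) {N T : ℕ} (hT : 2 ^ 10 ≤ T) (hN : 0 < N)
    (hk : ∀ k ∈ 𝒦, |κ k| ≤ 3 * N ∧ |κ k - h| ≤ 3 * N ∧ κ k ≠ 0 ∧ κ k - h ≠ 0) {x : ι → ι → ℝ}
    (hx : ∀ k k', x k k' ≤ 2 * N ^ 2)
    (hX : (N : ℝ) ^ 4 / (2 * T ^ 36) ≤ ∑ k ∈ 𝒦, ∑ k' ∈ 𝒦, x k k') :
    ∃ 𝒦' ⊆ 𝒦, (N : ℝ) ≤ T ^ 37 * 𝒦'.card ∧ ∀ k ∈ 𝒦', ∃ k' ∈ 𝒦, Int.gcd (κ k') (κ k) ≤ T ^ 37 ∧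
      Int.gcd (κ k' - h) (κ k) ≤ T ^ 37 ∧ (N : ℝ) ^ 2 / T ^ 37 ≤ x k k' := by
  have hTR : (2 : ℝ) ^ 10 ≤ T := by exact_mod_cast hT
  have hT0 : (0 : ℝ) < T := lt_of_lt_of_le (by norm_num) hTR
  have hTN : 0 < T ^ 37 := by positivity
  have hN0 : (0 : ℝ) < N := by exact_mod_cast hN
  have hN1 : (1 : ℝ) ≤ N := by exact_mod_cast hN
  -- Only the periods coming from `k'` are tested against `k`: in the application `gcd(k, k - h)` is
  -- already bounded.
  set bad : ι × ι → Prop := fun p => T ^ 37 < Int.gcd (κ p.2) (κ p.1) ∨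
    T ^ 37 < Int.gcd (κ p.2 - h) (κ p.1) with hbad
  classical
  have hb : (((𝒦 ×ˢ 𝒦).filter bad).card : ℝ) ≤ 72 * N ^ 2 / T ^ 37 := by
    have b1 := card_pairs_large_gcd_le hκ hκ 𝒦 (R := 3 * N) hTN (fun k hk' => by
      have := hk k hk'
      push_cast
      exact ⟨this.1, this.1, this.2.2.1, this.2.2.1⟩)
    have b2 := card_pairs_large_gcd_le hκ (μ := fun k => κ k - h)
      (fun i j hij => hκ (sub_left_injective hij)) 𝒦 (R := 3 * N) hTN (fun k hk' => by
      have := hk k hk'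
      push_cast
      exact ⟨this.1, this.2.1, this.2.2.1, this.2.2.2⟩)
    have b3 : (((𝒦 ×ˢ 𝒦).filter bad).card : ℝ) ≤
        (((𝒦 ×ˢ 𝒦).filter fun p => T ^ 37 < Int.gcd (κ p.2) (κ p.1)).card : ℝ) +
        ((𝒦 ×ˢ 𝒦).filter fun p => T ^ 37 < Int.gcd (κ p.2 - h) (κ p.1)).card := by
      rw [← Nat.cast_add]
      refine Nat.cast_le.2 ((Finset.card_le_card fun p hp => ?_).trans (Finset.card_union_le _ _))
      obtain ⟨hp1, hp2⟩ := Finset.mem_filter.1 hp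
      exact Finset.mem_union.2 (hp2.imp (fun hc => Finset.mem_filter.2 ⟨hp1, hc⟩)
        fun hc => Finset.mem_filter.2 ⟨hp1, hc⟩)
    push_cast at b1 b2
    refine b3.trans ((add_le_add b1 b2).trans (le_of_eq ?_))
    ring
  have hcard : (𝒦.card : ℝ) ≤ 7 * N := by
    have := card_le_of_abs_le hκ 𝒦 (N := 3 * N) (fun k hk' => by push_cast; exact (hk k hk').1)
    have h1 : (𝒦.card : ℝ) ≤ 2 * (3 * N) + 1 := by exact_mod_cast this
    linarith
  rw [← Finset.sum_product', ← Finset.sum_filter_add_sum_filter_not (𝒦 ×ˢ 𝒦) bad] at hX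
  have h1 : ∑ p ∈ (𝒦 ×ˢ 𝒦).filter bad, x p.1 p.2 ≤ (N : ℝ) ^ 4 / (4 * T ^ 36) := by
    calc ∑ p ∈ (𝒦 ×ˢ 𝒦).filter bad, x p.1 p.2 ≤ ((𝒦 ×ˢ 𝒦).filter bad).card • (2 * (N : ℝ) ^ 2) :=
          Finset.sum_le_card_nsmul _ _ _ fun p _ => hx _ _
      _ = ((𝒦 ×ˢ 𝒦).filter bad).card * (2 * (N : ℝ) ^ 2) := nsmul_eq_mul _ _
      _ ≤ 72 * (N : ℝ) ^ 2 / T ^ 37 * (2 * (N : ℝ) ^ 2) := by gcongr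
      _ = (N : ℝ) ^ 4 / (4 * T ^ 36) * (576 / T) := by field_simp; ring
      _ ≤ (N : ℝ) ^ 4 / (4 * T ^ 36) := by
        refine mul_le_of_le_one_right (by positivity) ?_
        rw [div_le_one hT0]
        linarith
  set g := (𝒦 ×ˢ 𝒦).filter fun p => ¬ bad p with hg
  have h2 : (N : ℝ) ^ 4 / (4 * T ^ 36) ≤ ∑ p ∈ g, x p.1 p.2 := by
    have e : (N : ℝ) ^ 4 / (2 * T ^ 36) = (N : ℝ) ^ 4 / (4 * T ^ 36) + (N : ℝ) ^ 4 / (4 * T ^ 36) := by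
      field_simp; norm_num
    linarith
  have hgc : (g.card : ℝ) ≤ 49 * N ^ 2 := by
    calc (g.card : ℝ) ≤ ((𝒦 ×ˢ 𝒦).card : ℝ) := Nat.cast_le.2 (Finset.card_filter_le _ _)
      _ = (𝒦.card : ℝ) * 𝒦.card := by rw [Finset.card_product, Nat.cast_mul]
      _ ≤ (7 * N) * (7 * N) := by gcongr
      _ = 49 * (N : ℝ) ^ 2 := by ring
  have h3 := le_card_popular g (fun p => x p.1 p.2) (by positivity) (by positivity) hgc
    (fun p _ => hx _ _) h2
  set P := g.filter fun p => (N : ℝ) ^ 4 / (4 * T ^ 36) ≤ 2 * (49 * N ^ 2) * x p.1 p.2 with hP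
  have hPg : ∀ p ∈ P, p ∈ g ∧ (N : ℝ) ^ 4 / (4 * T ^ 36) ≤ 2 * (49 * N ^ 2) * x p.1 p.2 :=
    fun p hp => Finset.mem_filter.1 hp
  refine ⟨P.image Prod.fst, ?_, ?_, ?_⟩
  · intro k hk'
    obtain ⟨p, hp, rfl⟩ := Finset.mem_image.1 hk'
    exact (Finset.mem_product.1 (Finset.mem_filter.1 (hPg p hp).1).1).1
  · have hPc : (P.card : ℝ) ≤ (P.image Prod.fst).card * (7 * N) := by
      have : P ⊆ P.image Prod.fst ×ˢ 𝒦 := fun p hp => Finset.mem_product.2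
        ⟨Finset.mem_image_of_mem _ hp,
          (Finset.mem_product.1 (Finset.mem_filter.1 (hPg p hp).1).1).2⟩
      calc (P.card : ℝ) ≤ ((P.image Prod.fst ×ˢ 𝒦).card : ℝ) :=
            Nat.cast_le.2 (Finset.card_le_card this)
        _ = ((P.image Prod.fst).card : ℝ) * 𝒦.card := by rw [Finset.card_product, Nat.cast_mul]
        _ ≤ _ := by gcongr
    have h4 : (N : ℝ) ^ 4 / (4 * T ^ 36) ≤
        2 * (2 * (N : ℝ) ^ 2) * ((P.image Prod.fst).card * (7 * N)) :=
      h3.trans (by gcongr)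
    rw [div_le_iff₀ (by positivity)] at h4
    have h5 : (N : ℝ) ^ 3 * N ≤ N ^ 3 * (112 * T ^ 36 * (P.image Prod.fst).card) := by
      refine le_trans (le_of_eq (by ring)) (h4.trans (le_of_eq (by ring)))
    refine (le_of_mul_le_mul_left h5 (by positivity)).trans ?_
    have : 112 * (T : ℝ) ^ 36 ≤ T ^ 37 := by
      calc 112 * (T : ℝ) ^ 36 ≤ T * T ^ 36 := by gcongr; linarith
        _ = (T : ℝ) ^ 37 := by ring
    gcongr
  · intro k hk'
    obtain ⟨⟨k, k'⟩, hp, rfl⟩ := Finset.mem_image.1 hk'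
    obtain ⟨h4, h5⟩ := hPg _ hp
    obtain ⟨h6, h7⟩ := Finset.mem_filter.1 h4
    simp only [hbad, not_or, not_lt] at h7
    refine ⟨k', (Finset.mem_product.1 h6).2, h7.1, h7.2, ?_⟩
    simp only at h5 ⊢
    rw [div_le_iff₀ (by positivity)] at h5 ⊢
    have h8 : (N : ℝ) ^ 2 * N ^ 2 ≤ N ^ 2 * (x k k' * (392 * T ^ 36)) :=
      le_trans (le_of_eq (by ring)) (h5.trans (le_of_eq (by ring)))
    have h9 := le_of_mul_le_mul_left h8 (by positivity)
    have hx0 : 0 ≤ x k k' := by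
      refine le_of_mul_le_mul_right (a := 392 * (T : ℝ) ^ 36) ?_ (by positivity)
      rw [zero_mul]
      exact le_trans (by positivity) h9
    refine h9.trans ?_
    gcongr
    calc 392 * (T : ℝ) ^ 36 ≤ T * T ^ 36 := by gcongr; linarith
      _ = (T : ℝ) ^ 37 := by ring

theorem periodic_conj {f : ℤ → ℂ} {c : ℤ} (hf : Function.Periodic f c) :
    Function.Periodic (fun z => conj (f z)) c := fun z => by
  simp only [hf z]

/-- Many periodic data for the same function give many large averages of Gowers sums. -/
theorem exists_many_le_sum_gowersRe {F : ℤ → ℂ} {h : ℤ} {N T A : ℕ} {W : ℝ} {𝒦 : Finset ℤ}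
    (D : ∀ k : 𝒦, PeriodicDatum F k (k - h) N W) (hT : 2 ^ 10 ≤ T) (hA : 0 < A)
    (hAT : A * T ^ 2548 ≤ N) (hW0 : 0 < W) (hW : W ≤ (T : ℝ) ^ 17) (hF : ∀ z, ‖F z‖ ≤ 1)
    (hsupp : Function.support F ⊆ Set.Icc 1 (2 * (N : ℤ) ^ 2))
    (hk : ∀ k ∈ 𝒦, |k| ≤ 3 * N ∧ |k - h| ≤ 3 * N ∧ (N : ℤ) ≤ T * |k| ∧ (N : ℤ) ≤ T * |k - h| ∧
      Int.gcd k (k - h) ≤ T) (hcard : N ≤ T * 𝒦.card) :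
    ∃ 𝒦' ⊆ 𝒦, (N : ℝ) ≤ T ^ 37 * 𝒦'.card ∧ ∀ k ∈ 𝒦', ∃ i ∈ Finset.range A,
      (A : ℝ) ^ 7 * (N ^ 2 / T ^ 5093) ≤
        ∑ i' ∈ Finset.range A, gowersRe 3 (multDiff (2 * (k - h) * i' - 2 * (k - h) * i) F) := by
  have hTR : (2 : ℝ) ^ 10 ≤ T := by exact_mod_cast hT
  have hT0 : (0 : ℝ) < T := lt_of_lt_of_le (by norm_num) hTR
  have hT1 : (1 : ℝ) ≤ T := le_trans (by norm_num) hTR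
  have hN : 0 < N := lt_of_lt_of_le (by positivity) hAT
  have hN0 : (0 : ℝ) < N := by exact_mod_cast hN
  have hM : Function.support F ⊆ Set.Icc 1 ((2 * N ^ 2 : ℕ) : ℤ) := by push_cast; exact hsupp
  have ne0 : ∀ m : ℤ, (N : ℤ) ≤ T * |m| → m ≠ 0 := by
    rintro m hm rfl
    simp at hm
    omega
  -- The product `conj (q k) * q k'` is `v_k` times `conj u_k`, `u_{k'}` and `conj v_{k'}`, of
  -- periods `2(k - h)`, `2(k' - h)` and `2k'`.
  set q : 𝒦 → ℤ → ℂ := fun k z => (D k).u z * conj ((D k).v z) with hq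
  have hqb : ∀ k z, ‖q k z‖ ≤ 1 := fun k z => by
    rw [hq]
    simp only [norm_mul, RCLike.norm_conj]
    exact mul_le_one₀ ((D k).norm_u_le z) (norm_nonneg _) ((D k).norm_v_le z)
  set α : 𝒦 → 𝒦 → ℤ := fun k k' => max 1 (max (D k).a (D k').a)
  set β : 𝒦 → 𝒦 → ℤ := fun k k' => min ((2 * N ^ 2 : ℕ) : ℤ) (min (D k).b (D k').b)
  set x : 𝒦 → 𝒦 → ℝ := fun k k' => ‖∑ z ∈ Finset.Icc (α k k') (β k k'), conj (q k z) * q k' z‖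
    with hx
  have s1 := sq_le_sum_norm_pairs hF hM 𝒦.attach (fun k => (D k).a) (fun k => (D k).b) q
    (X := 𝒦.card * (N ^ 2 / W)) (by positivity) (by
      rw [← Finset.card_attach, ← nsmul_eq_mul]
      refine Finset.card_nsmul_le_sum _ _ _ fun k _ => ?_
      rw [div_le_iff₀ hW0, mul_comm]
      refine (D k).le_correlation.trans (le_of_eq ?_)
      simp only [hq, mul_assoc])
  have hx2 : ∀ k k', x k k' ≤ 2 * (N : ℝ) ^ 2 := by
    intro k k'
    calc x k k' ≤ ∑ z ∈ Finset.Icc (α k k') (β k k'), (1 : ℝ) := by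
          refine norm_sum_le_of_le (n := fun _ => (1 : ℝ)) _ fun z _ => ?_
          rw [norm_mul, RCLike.norm_conj]
          exact mul_le_one₀ (hqb k z) (norm_nonneg _) (hqb k' z)
      _ = ((Finset.Icc (α k k') (β k k')).card : ℝ) := by simp
      _ ≤ ((Finset.Icc (1 : ℤ) ((2 * N ^ 2 : ℕ) : ℤ)).card : ℝ) :=
          Nat.cast_le.2 (Finset.card_le_card (Finset.Icc_subset_Icc (le_max_left _ _)
            (min_le_left _ _)))
      _ = 2 * (N : ℝ) ^ 2 := by
          rw [Int.card_Icc, add_sub_cancel_right, Int.toNat_natCast]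
          push_cast
          ring
  have hX : (N : ℝ) ^ 4 / (2 * T ^ 36) ≤ ∑ k ∈ 𝒦.attach, ∑ k' ∈ 𝒦.attach, x k k' := by
    have hcR : (N : ℝ) ≤ T * 𝒦.card := by exact_mod_cast hcard
    have h1 : (N : ℝ) ^ 3 / T ^ 18 ≤ 𝒦.card * (N ^ 2 / W) := by
      rw [← mul_div_assoc, div_le_div_iff₀ (by positivity) hW0]
      calc (N : ℝ) ^ 3 * W = N * ((N : ℝ) ^ 2 * W) := by ring
        _ ≤ (T * 𝒦.card) * ((N : ℝ) ^ 2 * T ^ 17) := by gcongr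
        _ = 𝒦.card * (N : ℝ) ^ 2 * T ^ 18 := by ring
    have h2 := (pow_le_pow_left₀ (by positivity) h1 2).trans s1
    push_cast at h2
    have e : ((N : ℝ) ^ 3 / T ^ 18) ^ 2 = 2 * (N : ℝ) ^ 2 * (N ^ 4 / (2 * T ^ 36)) := by
      field_simp
    rw [e] at h2
    refine (le_of_mul_le_mul_left h2 (by positivity)).trans (le_of_eq ?_)
    simp only [hx, α, β]
    push_cast
    rfl
  obtain ⟨𝒦', hsub, hc', hk'⟩ := exists_popular_coprime_pairs (κ := fun k : 𝒦 => (k : ℤ))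
    Subtype.val_injective h 𝒦.attach hT hN (fun k _ => by
      obtain ⟨h1, h2, h3, h4, _⟩ := hk k k.2
      exact ⟨h1, h2, ne0 _ h3, ne0 _ h4⟩) hx2 hX
  refine ⟨𝒦'.map ⟨Subtype.val, Subtype.val_injective⟩, ?_, by rwa [Finset.card_map], ?_⟩
  · intro k hk0
    obtain ⟨k, _, rfl⟩ := Finset.mem_map.1 hk0
    exact k.2
  intro k0 hk0
  obtain ⟨k, hkm, rfl⟩ := Finset.mem_map.1 hk0
  obtain ⟨k', _, hg1, hg2, hxk⟩ := hk' k hkm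
  obtain ⟨h1, h2, h3, h4, h5⟩ := hk k k.2
  obtain ⟨h1', h2', _⟩ := hk k' k'.2
  have hne : (Finset.Icc (α k k') (β k k')).Nonempty := by
    by_contra hc
    rw [Finset.not_nonempty_iff_eq_empty] at hc
    have : x k k' = 0 := by simp only [hx]; rw [hc]; simp
    rw [this] at hxk
    have : (0 : ℝ) < N ^ 2 / T ^ 37 := by positivity
    linarith
  have hαβ : α k k' ≤ β k k' := Finset.nonempty_Icc.1 hne
  have hα1 : 1 ≤ α k k' := le_max_left _ _
  have hβ1 : β k k' ≤ ((2 * N ^ 2 : ℕ) : ℤ) := min_le_left _ _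
  refine (D k).exists_le_sum_gowersRe hT hA hAT hW0 hW hF ((Set.finite_Icc _ _).subset hsupp) h1 h2
    h2' h1' h3 ?_ hg2 hg1 (q₁ := fun z => conj ((D k).u z)) (q₂ := (D k').u)
    (q₃ := fun z => conj ((D k').v z)) ?_ (D k').norm_u_le ?_ (periodic_conj (D k).periodic_u)
    (D k').periodic_u (periodic_conj (D k').periodic_v) (α := α k k') (β := β k k') (by linarith)
    ?_ ?_
  · rw [Int.gcd_comm]
    exact h5.trans (Nat.le_self_pow (by norm_num) T)
  · intro z; rw [RCLike.norm_conj]; exact (D k).norm_u_le z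
  · intro z; rw [RCLike.norm_conj]; exact (D k').norm_v_le z
  · have h6 : (1 : ℝ) ≤ α k k' := by exact_mod_cast hα1
    have h7 : (β k k' : ℝ) ≤ 2 * N ^ 2 := by exact_mod_cast hβ1
    linarith
  · refine hxk.trans (le_of_eq ?_)
    simp only [hx]
    congr 1
    refine Finset.sum_congr rfl fun z _ => ?_
    simp only [hq, map_mul, Complex.conj_conj]
    ring

/-! ### The `U⁴` bound. -/

theorem Nat.exists_mul_le_and_le_two_mul_mul {n m : ℕ} (hm : 0 < m) (h : m ≤ n) :
    ∃ a, 0 < a ∧ a * m ≤ n ∧ n ≤ 2 * (a * m) := by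
  refine ⟨n / m, Nat.div_pos h hm, Nat.div_mul_le_self _ _, ?_⟩
  have h1 := Nat.lt_div_mul_add (a := n) hm
  have h2 : m ≤ n / m * m := Nat.le_mul_of_pos_left _ (Nat.div_pos h hm)
  omega

theorem nonempty_periodicDatum_of_correlation {N T : ℕ} (hT : 2 ^ 10 ≤ T) (hTN : T ^ 4 ≤ N)
    {F φ ψ : ℤ → ℂ} (hF : ∀ z, ‖F z‖ ≤ 1) (hφ : ∀ z, ‖φ z‖ ≤ 1) (hψ : ∀ z, ‖ψ z‖ ≤ 1)
    (hsF : Function.support F ⊆ Set.Icc 1 (2 * (N : ℤ) ^ 2)) {k l : ℤ} (hk : |k| ≤ 3 * N)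
    (hl : |l| ≤ 3 * N) (hkT : (N : ℤ) ≤ T * |k|) (hlT : (N : ℤ) ≤ T * |l|) (hg : Int.gcd k l ≤ T)
    {a b : ℤ} (hI : (Finset.Icc a b).card ≤ 2 * N)
    (h : (N : ℝ) ^ 3 ≤
      T * ‖∑ d ∈ Finset.Icc a b, ∑' z, F z * φ (z - 2 * d * k) * ψ (z - 2 * d * l)‖) :
    Nonempty (PeriodicDatum F k l N (2 ^ 18 * T ^ 15)) := by
  -- `T⁴ M ≤ N` makes box points unique in the interval, while `N ≤ 2 T⁴ M` keeps the box large
  -- enough for the loss to be a power of `T`.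
  obtain ⟨M, hM, hM1, hM2⟩ := Nat.exists_mul_le_and_le_two_mul_mul (by positivity) hTN
  have hT4 : 32 * T ≤ T ^ 4 := by
    calc 32 * T ≤ T ^ 3 * T := by
          gcongr
          calc 32 ≤ T := by omega
            _ ≤ T ^ 3 := Nat.le_self_pow (by norm_num) T
      _ = T ^ 4 := by ring
  have h32 : 32 * T * M ≤ N := (Nat.mul_le_mul_right M hT4).trans (by linarith)
  obtain ⟨p, α, β, hα, hβ, h1⟩ := exists_box_correlation (M := M) (T := T)
    (by exact_mod_cast (by omega : 0 < T)) (by omega) hM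
    (by nlinarith) (by exact_mod_cast h32) hF hφ hψ hsF hk hl hI h
  obtain ⟨u, v₀, hu, hv₀, hup, hv₀p, e⟩ := exists_periodic_factors (p := p) hM (by omega)
    (by linarith) F hk hl hkT hlT hg hα hβ
  exact nonempty_periodicDatum hM (by omega) (by linarith) (by linarith) hF hk hkT hu hv₀ hup hv₀p
    (by rw [e]; exact h1)

/-- If the dual-type correlations of `F` are large for many `k`, then `F` has a large `U⁴`-norm. -/
theorem le_gowersRe_four {F : ℤ → ℂ} {h : ℤ} {N T : ℕ} (hT : 2 ^ 10 ≤ T) (hTN : T ^ 45940 ≤ N)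
    {𝒦 : Finset ℤ} (hF : ∀ z, ‖F z‖ ≤ 1)
    (hsupp : Function.support F ⊆ Set.Icc 1 (2 * (N : ℤ) ^ 2))
    (hk : ∀ k ∈ 𝒦, |k| ≤ 3 * N ∧ |k - h| ≤ 3 * N ∧ (N : ℤ) ≤ T * |k| ∧ (N : ℤ) ≤ T * |k - h| ∧
      Int.gcd k (k - h) ≤ T) (hcard : N ≤ T * 𝒦.card)
    (hE : ∀ k ∈ 𝒦, ∃ (φ ψ : ℤ → ℂ) (a b : ℤ), (∀ z, ‖φ z‖ ≤ 1) ∧ (∀ z, ‖ψ z‖ ≤ 1) ∧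
      (Finset.Icc a b).card ≤ 2 * N ∧ (N : ℝ) ^ 3 ≤ T *
        ‖∑ d ∈ Finset.Icc a b, ∑' z, F z * φ (z - 2 * d * k) * ψ (z - 2 * d * (k - h))‖) :
    (N : ℝ) ^ 10 ≤ T ^ 91876 * gowersRe 4 F := by
  have hTpos : 0 < T := by omega
  have hTR : (2 : ℝ) ^ 10 ≤ T := by exact_mod_cast hT
  have hT0 : (0 : ℝ) < T := lt_of_lt_of_le (by norm_num) hTR
  have hT1 : (1 : ℝ) ≤ T := le_trans (by norm_num) hTR
  have hD : ∀ k : 𝒦, Nonempty (PeriodicDatum F k (k - h) N (2 ^ 18 * T ^ 15)) := by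
    rintro ⟨k, hk'⟩
    obtain ⟨φ, ψ, a, b, hφ, hψ, hI, hEk⟩ := hE k hk'
    obtain ⟨h1, h2, h3, h4, h5⟩ := hk k hk'
    exact nonempty_periodicDatum_of_correlation hT
      ((Nat.pow_le_pow_right hTpos (by norm_num)).trans hTN) hF hφ hψ hsupp h1 h2 h3 h4 h5 hI hEk
  obtain ⟨A, hA, hA1, hA2⟩ := Nat.exists_mul_le_and_le_two_mul_mul (m := T ^ 2548) (n := N)
    (by positivity) ((Nat.pow_le_pow_right hTpos (by norm_num)).trans hTN)
  have hN : 0 < N := lt_of_lt_of_le (by positivity) hA1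
  have hN0 : (0 : ℝ) < N := by exact_mod_cast hN
  have hW : (2 : ℝ) ^ 18 * T ^ 15 ≤ T ^ 17 := by
    calc (2 : ℝ) ^ 18 * T ^ 15 ≤ (T : ℝ) ^ 2 * T ^ 15 := by gcongr; nlinarith
      _ = (T : ℝ) ^ 17 := by ring
  obtain ⟨𝒦', hsub, hc', hk'⟩ := exists_many_le_sum_gowersRe (T := T) (A := A)
    (fun k => (hD k).some) hT hA hA1
    (by positivity) hW hF hsupp hk hcard
  choose! i hi hsum using hk'
  -- The pairs `(l, a)` for the concatenation; each `k` carries its own base index `i k`.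
  set e : ℤ × ℕ → ℤ × ℤ := fun p => (p.1 - h, (p.2 : ℤ) - i p.1) with he
  have hinj : Function.Injective e := by
    rintro ⟨k, j⟩ ⟨k', j'⟩ hp
    simp only [he, Prod.mk.injEq] at hp
    obtain rfl : k = k' := by linarith [hp.1]
    have : (j : ℤ) = j' := by linarith [hp.2]
    rw [Nat.cast_injective this]
  set S := (𝒦' ×ˢ Finset.range A).map ⟨e, hinj⟩ with hS
  have hAN : A ≤ N := le_trans (Nat.le_mul_of_pos_right _ (by positivity)) hA1
  have hSmem : ∀ p ∈ S, (N : ℤ) ≤ T * |p.1| ∧ |p.1| ≤ 3 * N ∧ |p.2| ≤ 2 * N := by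
    intro p hp
    obtain ⟨⟨k, j⟩, hkj, rfl⟩ := Finset.mem_map.1 hp
    obtain ⟨hk1, hj⟩ := Finset.mem_product.1 hkj
    have hik := Finset.mem_range.1 (hi k hk1)
    have hj' := Finset.mem_range.1 hj
    obtain ⟨_, h2, _, h4, _⟩ := hk k (hsub hk1)
    refine ⟨h4, h2, ?_⟩
    simp only [he, Function.Embedding.coeFn_mk]
    rw [abs_le]
    simp only at hj' hik
    constructor <;> omega
  have hSsum : 𝒦'.card * ((A : ℝ) ^ 7 * (N ^ 2 / T ^ 5093)) ≤
      ∑ p ∈ S, gowersRe 3 (multDiff (2 * p.1 * p.2) F) := by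
    rw [hS, Finset.sum_map, Finset.sum_product, ← nsmul_eq_mul]
    refine Finset.card_nsmul_le_sum _ _ _ fun k hk1 => (hsum k hk1).trans (le_of_eq ?_)
    refine Finset.sum_congr rfl fun j _ => ?_
    simp only [he, Function.Embedding.coeFn_mk]
    rw [← mul_sub]
  have hY : ∀ n, gowersRe 3 (multDiff n F) ≤ 432 * (N : ℝ) ^ 8 := by
    intro n
    have := gowersRe_le (R := 2 * N ^ 2) (norm_multDiff_le hF n)
      ((multDiff_support_subset n F).trans (by push_cast; exact hsupp)) 3
    push_cast at this
    refine this.trans (le_of_eq ?_)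
    ring
  have hAR : (N : ℝ) ≤ 2 * (A * T ^ 2548) := by exact_mod_cast hA2
  -- The exponent is `22968 = 37 + 7·2548 + 5093 + 2`: the density of `𝒦'`, the seven powers of `A`,
  -- the loss in `hsum`, and the numerical constants.
  have hbig : (N : ℝ) ^ 2 * (432 * N ^ 8) ≤
      ((T ^ 22968 : ℕ) : ℝ) * ∑ p ∈ S, gowersRe 3 (multDiff (2 * p.1 * p.2) F) := by
    refine le_trans ?_ (mul_le_mul_of_nonneg_left hSsum (by positivity))
    have h1 : (N : ℝ) ^ 2 * (432 * N ^ 8) ≤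
        432 * ((T ^ 37 * 𝒦'.card) * (2 * (A * T ^ 2548)) ^ 7 * N ^ 2) := by
      calc (N : ℝ) ^ 2 * (432 * N ^ 8) = 432 * (N * (N : ℝ) ^ 7 * N ^ 2) := by ring
        _ ≤ _ := by gcongr
    refine h1.trans ?_
    have h2 : (432 * 2 ^ 7 : ℝ) ≤ T ^ 2 := by nlinarith
    push_cast
    calc 432 * ((T ^ 37 * 𝒦'.card) * (2 * (A * T ^ 2548)) ^ 7 * N ^ 2) =
        (432 * 2 ^ 7) * (T ^ 17873 * 𝒦'.card * A ^ 7 * (N : ℝ) ^ 2) := by ring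
      _ ≤ T ^ 2 * (T ^ 17873 * 𝒦'.card * A ^ 7 * (N : ℝ) ^ 2) := by gcongr
      _ = T ^ 17875 * (𝒦'.card * A ^ 7 * (N : ℝ) ^ 2) := by ring
      _ = (T : ℝ) ^ 22968 * (𝒦'.card * (A ^ 7 * (N ^ 2 / T ^ 5093))) := by
        field_simp
  have hfin := gowersRe_concatenation (U := T) (W := T ^ 22968) (by norm_num) hTpos
    (by positivity) (by
      refine le_trans ?_ hTN
      calc T * (1800 * (T ^ 22968) ^ 2) = 1800 * T ^ 45937 := by ring
        _ ≤ T ^ 3 * T ^ 45937 := by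
          gcongr
          calc 1800 ≤ (2 ^ 10) ^ 3 := by norm_num
            _ ≤ T ^ 3 := by gcongr
        _ = T ^ 45940 := by ring)
    ((Set.finite_Icc _ _).subset hsupp) (by positivity) hY S hSmem hbig
  have hg0 : 0 ≤ gowersRe 4 F := gowersRe_nonneg (by norm_num) ((Set.finite_Icc _ _).subset hsupp)
  have h3 : (N : ℝ) ^ 10 ≤ (N : ℝ) ^ 2 * (432 * N ^ 8) := by
    have : (0 : ℝ) ≤ N ^ 10 := by positivity
    calc (N : ℝ) ^ 10 ≤ 432 * (N : ℝ) ^ 10 := by linarith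
      _ = _ := by ring
  refine h3.trans (hfin.trans ?_)
  push_cast
  gcongr
  calc (2 : ℝ) ^ 22 * T * (T ^ 22968) ^ 4 = 2 ^ 22 * (T : ℝ) ^ 91873 := by ring
    _ ≤ (T : ℝ) ^ 3 * T ^ 91873 := by
      gcongr
      calc (2 : ℝ) ^ 22 ≤ (2 ^ 10) ^ 3 := by norm_num
        _ ≤ (T : ℝ) ^ 3 := by gcongr
    _ = (T : ℝ) ^ 91876 := by ring

/-! ### Linearising the parabola. -/

theorem sum_Icc_sum_Icc_eq_sum_shift {M : Type*} [AddCommMonoid M] {a b : ℤ} {n : ℕ}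
    (hab : b - a ≤ n) (f : ℤ → ℤ → M) :
    ∑ d ∈ Finset.Icc a b, ∑ e ∈ Finset.Icc a b, f d e =
      ∑ h ∈ Finset.Icc (-(n : ℤ)) n, ∑ d ∈ Finset.Icc (max a (a - h)) (min b (b - h)), f d (d + h) := by
  rw [Finset.sum_sigma', Finset.sum_sigma']
  refine Finset.sum_bij' (fun p _ => ⟨p.2 - p.1, p.1⟩) (fun p _ => ⟨p.2, p.2 + p.1⟩) ?_ ?_ ?_ ?_ ?_
  · rintro ⟨d, e⟩ h
    simp only [Finset.mem_sigma, Finset.mem_Icc] at h ⊢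
    omega
  · rintro ⟨d, e⟩ h
    simp only [Finset.mem_sigma, Finset.mem_Icc] at h ⊢
    omega
  · rintro ⟨d, e⟩ _
    simp
  · rintro ⟨d, e⟩ _
    simp
  · rintro ⟨d, e⟩ _
    simp

theorem hasSum_norm_sq_sum {ι : Type*} (s : Finset ι) {X : ι → ℤ → ℂ}
    (hX : ∀ d, (Function.support (X d)).Finite) :
    HasSum (fun y => ‖∑ d ∈ s, X d y‖ ^ 2)
      (∑ d ∈ s, ∑ e ∈ s, ∑' y, X d y * conj (X e y)).re := by
  have h1 : HasSum (fun y => ∑ d ∈ s, ∑ e ∈ s, X d y * conj (X e y))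
      (∑ d ∈ s, ∑ e ∈ s, ∑' y, X d y * conj (X e y)) := by
    refine hasSum_sum fun d _ => hasSum_sum fun e _ => ?_
    refine Summable.hasSum (summable_of_hasFiniteSupport ((hX d).subset ?_))
    exact Function.support_mul_subset_left _ _
  have h2 := Complex.hasSum_re h1
  refine h2.congr_fun fun y => ?_
  have h3 : ((‖∑ d ∈ s, X d y‖ ^ 2 : ℝ) : ℂ) = ∑ d ∈ s, ∑ e ∈ s, X d y * conj (X e y) := by
    rw [Complex.ofReal_pow, ← Complex.mul_conj', map_sum, Finset.sum_mul_sum]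
  rw [← h3, Complex.ofReal_re]

/-- The function whose sum over `d` is the coefficient of `conj (G (s + h²))` when the square of
`∑ d, G (y + d²) * R (y + (d - k)²)` is expanded. -/
noncomputable def dualTerm (G R : ℤ → ℂ) (k h d s : ℤ) : ℂ :=
  G (s - 2 * d * h) * R (s - 2 * d * (h + k) + k ^ 2) * conj (R (s - 2 * d * k + (h - k) ^ 2))

theorem dualTerm_finite_support {G : ℤ → ℂ} (hG : (Function.support G).Finite) (R : ℤ → ℂ)
    (k h d : ℤ) : (Function.support (dualTerm G R k h d)).Finite := by
  have h1 : (Function.support fun s => G (s - 2 * d * h)).Finite := by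
    have := hG.preimage ((sub_left_injective (b := 2 * d * h)).injOn)
    exact this
  refine h1.subset fun s hs h0 => hs ?_
  simp only [dualTerm]
  rw [show G (s - 2 * d * h) = 0 from h0]
  simp

/-- Expand the square over `d` and `d + h`, and put `s = y + d² + 2dh`. Then `y + (d + h)² = s + h²`
does not involve `d`, so that copy of `G` is bounded trivially, and the other three arguments are
linear in `d`. -/
theorem sum_norm_sq_le_sum_norm_dualTerm {G R : ℤ → ℂ} {M : ℤ} (hG : ∀ z, ‖G z‖ ≤ 1)
    (hsupp : Function.support G ⊆ Set.Icc 1 M) {a b : ℤ} {n : ℕ} (hab : b - a ≤ n) (k : ℤ)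
    (Y : Finset ℤ) :
    ∑ y ∈ Y, ‖∑ d ∈ Finset.Icc a b, G (y + d ^ 2) * R (y + (d - k) ^ 2)‖ ^ 2 ≤
      ∑ h ∈ Finset.Icc (-(n : ℤ)) n, ∑ s ∈ Finset.Icc (1 - h ^ 2) (M - h ^ 2),
        ‖∑ d ∈ Finset.Icc (max a (a - h)) (min b (b - h)), dualTerm G R k h d s‖ := by
  have hfin : (Function.support G).Finite := (Set.finite_Icc _ _).subset hsupp
  set X : ℤ → ℤ → ℂ := fun d y => G (y + d ^ 2) * R (y + (d - k) ^ 2) with hX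
  have hXfin : ∀ d, (Function.support (X d)).Finite := by
    intro d
    have h1 : (Function.support fun y => G (y + d ^ 2)).Finite :=
      hfin.preimage ((add_left_injective (d ^ 2)).injOn)
    exact h1.subset (Function.support_mul_subset_left _ _)
  refine (sum_le_hasSum Y (fun _ _ => by positivity)
    (hasSum_norm_sq_sum (Finset.Icc a b) hXfin)).trans ?_
  rw [sum_Icc_sum_Icc_eq_sum_shift hab (fun d e => ∑' y, X d y * conj (X e y)), Complex.re_sum]
  refine Finset.sum_le_sum fun h _ => ?_
  set I := Finset.Icc (max a (a - h)) (min b (b - h))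
  have h1 : ∀ d, ∑' y, X d y * conj (X (d + h) y) =
      ∑ s ∈ Finset.Icc (1 - h ^ 2) (M - h ^ 2), conj (G (s + h ^ 2)) * dualTerm G R k h d s := by
    intro d
    rw [← (Equiv.subRight (d ^ 2 + 2 * d * h)).tsum_eq,
      tsum_eq_sum (s := Finset.Icc (1 - h ^ 2) (M - h ^ 2))]
    · refine Finset.sum_congr rfl fun s _ => ?_
      simp only [hX, dualTerm, Equiv.subRight_apply, map_mul]
      rw [show s - (d ^ 2 + 2 * d * h) + d ^ 2 = s - 2 * d * h by ring,
        show s - (d ^ 2 + 2 * d * h) + (d - k) ^ 2 = s - 2 * d * (h + k) + k ^ 2 by ring,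
        show s - (d ^ 2 + 2 * d * h) + (d + h) ^ 2 = s + h ^ 2 by ring,
        show s - (d ^ 2 + 2 * d * h) + (d + h - k) ^ 2 = s - 2 * d * k + (h - k) ^ 2 by ring]
      ring
    · intro s hs
      have : G (s + h ^ 2) = 0 := by
        by_contra hc
        have := hsupp hc
        refine hs ?_
        simp only [Set.mem_Icc] at this
        rw [Finset.mem_Icc]
        constructor <;> linarith
      simp only [hX, Equiv.subRight_apply, map_mul]
      rw [show s - (d ^ 2 + 2 * d * h) + (d + h) ^ 2 = s + h ^ 2 by ring, this]
      simp
  simp only [h1]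
  rw [Finset.sum_comm]
  refine (Complex.re_le_norm _).trans ((norm_sum_le _ _).trans (Finset.sum_le_sum fun s _ => ?_))
  rw [← Finset.mul_sum, norm_mul, RCLike.norm_conj]
  exact mul_le_of_le_one_left (norm_nonneg _) (hG _)

/-- Expand the square over `d` and `d + c`, then centre at `z = s - 2dh`. By linearity the step from
`d` to `d + c` shifts every factor by a multiple of `2c` that does not depend on `d`, and the factor
from `G` loses `d` altogether. -/
theorem sum_norm_sq_dualTerm_le {G R : ℤ → ℂ} (hfin : (Function.support G).Finite)
    {a b : ℤ} {n : ℕ} (hab : b - a ≤ n) (k h : ℤ) (S : Finset ℤ) :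
    ∑ s ∈ S, ‖∑ d ∈ Finset.Icc a b, dualTerm G R k h d s‖ ^ 2 ≤
      ∑ c ∈ Finset.Icc (-(n : ℤ)) n, ‖∑ d ∈ Finset.Icc (max a (a - c)) (min b (b - c)),
        ∑' z, multDiff (-(2 * c * h)) G z *
          multDiff (-(2 * c * (h + k))) (fun w => R (w + k ^ 2)) (z - 2 * d * k) *
          multDiff (-(2 * c * k)) (fun w => conj (R (w + (h - k) ^ 2))) (z - 2 * d * (k - h))‖ := by
  refine (sum_le_hasSum S (fun _ _ => by positivity)
    (hasSum_norm_sq_sum (Finset.Icc a b) (dualTerm_finite_support hfin R k h))).trans ?_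
  rw [sum_Icc_sum_Icc_eq_sum_shift hab
    (fun d e => ∑' y, dualTerm G R k h d y * conj (dualTerm G R k h e y)), Complex.re_sum]
  refine Finset.sum_le_sum fun c _ => (Complex.re_le_norm _).trans (le_of_eq ?_)
  congr 1
  refine Finset.sum_congr rfl fun d _ => ?_
  rw [← (Equiv.addRight (2 * d * h)).tsum_eq]
  refine tsum_congr fun z => ?_
  simp only [dualTerm, multDiff, Equiv.coe_addRight, map_mul, Complex.conj_conj]
  rw [show z + 2 * d * h - 2 * d * h = z by ring,
    show z + 2 * d * h - 2 * d * (h + k) + k ^ 2 = z - 2 * d * k + k ^ 2 by ring,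
    show z + 2 * d * h - 2 * d * k + (h - k) ^ 2 = z - 2 * d * (k - h) + (h - k) ^ 2 by ring,
    show z + 2 * d * h - 2 * (d + c) * h = z + -(2 * c * h) by ring,
    show z + 2 * d * h - 2 * (d + c) * (h + k) + k ^ 2 =
      z - 2 * d * k + -(2 * c * (h + k)) + k ^ 2 by ring,
    show z + 2 * d * h - 2 * (d + c) * k + (h - k) ^ 2 =
      z - 2 * d * (k - h) + -(2 * c * k) + (h - k) ^ 2 by ring]
  ring

/-- The correlation of `multDiff (-(2 * c * h)) G` with two dual functions built from `R`, summed
over the interval of those `d` for which `d`, `d + h`, `d + c`, `d + h + c` all lie in `[a, b]`. -/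
noncomputable def columnCorr (G R : ℤ → ℂ) (a b k h c : ℤ) : ℂ :=
  ∑ d ∈ Finset.Icc (max (max a (a - h)) (max a (a - h) - c)) (min (min b (b - h)) (min b (b - h) - c)),
    ∑' z, multDiff (-(2 * c * h)) G z *
      multDiff (-(2 * c * (h + k))) (fun w => R (w + k ^ 2)) (z - 2 * d * k) *
      multDiff (-(2 * c * k)) (fun w => conj (R (w + (h - k) ^ 2))) (z - 2 * d * (k - h))

theorem card_Icc_columnCorr_le {a b : ℤ} {N : ℕ} (ha : -(N : ℤ) < a) (hb : b < N) (h c : ℤ) :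
    (Finset.Icc (max (max a (a - h)) (max a (a - h) - c))
      (min (min b (b - h)) (min b (b - h) - c))).card ≤ 2 * N := by
  rw [Int.card_Icc]
  omega

theorem norm_tsum_le_of_support {f : ℤ → ℂ} {M : ℕ} (hf : ∀ z, ‖f z‖ ≤ 1)
    (hsupp : Function.support f ⊆ Set.Icc 1 (M : ℤ)) : ‖∑' z, f z‖ ≤ M := by
  rw [tsum_eq_sum (s := Finset.Icc 1 (M : ℤ))]
  · refine (norm_sum_le_of_le (n := fun _ => (1 : ℝ)) _ fun z _ => hf z).trans (le_of_eq ?_)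
    simp
  · intro z hz
    by_contra hc
    exact hz (by simpa using hsupp hc)

theorem norm_columnCorr_le {G R : ℤ → ℂ} {N : ℕ} (hG : ∀ z, ‖G z‖ ≤ 1) (hR : ∀ z, ‖R z‖ ≤ 1)
    (hsupp : Function.support G ⊆ Set.Icc 1 (2 * (N : ℤ) ^ 2)) {a b : ℤ} (ha : -(N : ℤ) < a)
    (hb : b < N) (k h c : ℤ) : ‖columnCorr G R a b k h c‖ ≤ 4 * (N : ℝ) ^ 3 := by
  have h1 : ∀ d : ℤ, ‖∑' z, multDiff (-(2 * c * h)) G z *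
      multDiff (-(2 * c * (h + k))) (fun w => R (w + k ^ 2)) (z - 2 * d * k) *
      multDiff (-(2 * c * k)) (fun w => conj (R (w + (h - k) ^ 2))) (z - 2 * d * (k - h))‖ ≤
      2 * (N : ℝ) ^ 2 := by
    intro d
    refine (norm_tsum_le_of_support (M := 2 * N ^ 2) (fun z => ?_) ?_).trans
      (le_of_eq (by push_cast; ring))
    · rw [norm_mul, norm_mul]
      exact mul_le_one₀ (mul_le_one₀ (norm_multDiff_le hG _ _) (norm_nonneg _)
        (norm_multDiff_le (fun w => hR _) _ _)) (norm_nonneg _)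
        (norm_multDiff_le (fun w => by rw [RCLike.norm_conj]; exact hR _) _ _)
    · refine (Function.support_mul_subset_left _ _).trans
        ((Function.support_mul_subset_left _ _).trans
          ((multDiff_support_subset _ _).trans ?_))
      push_cast
      exact hsupp
  calc ‖columnCorr G R a b k h c‖ ≤ _ := norm_sum_le_of_le _ fun d _ => h1 d
    _ = ((Finset.Icc (max (max a (a - h)) (max a (a - h) - c))
      (min (min b (b - h)) (min b (b - h) - c))).card : ℝ) * (2 * (N : ℝ) ^ 2) := by
        rw [Finset.sum_const, nsmul_eq_mul]
    _ ≤ ((2 * N : ℕ) : ℝ) * (2 * (N : ℝ) ^ 2) := by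
        gcongr
        exact card_Icc_columnCorr_le ha hb h c
    _ = 4 * (N : ℝ) ^ 3 := by push_cast; ring

theorem card_Icc_neg_self_le {N : ℕ} (hN : 0 < N) (m : ℕ) :
    ((Finset.Icc (-((m * N : ℕ) : ℤ)) ((m * N : ℕ) : ℤ)).card : ℝ) ≤ (2 * m + 1) * N := by
  have h : (Finset.Icc (-((m * N : ℕ) : ℤ)) ((m * N : ℕ) : ℤ)).card ≤ (2 * m + 1) * N := by
    rw [Int.card_Icc]
    have : (2 * m + 1) * N = 2 * (m * N) + N := by ring
    omega
  exact_mod_cast h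

/-- The two expansions are joined by Cauchy–Schwarz over the triples `(k, h, s)`, at most `3N · 5N ·
2N² = 30N⁴` in number. -/
theorem le_sum_norm_columnCorr {G : ℤ → ℂ} {R : ℤ → ℤ → ℂ} {N : ℕ} {T : ℝ} (hN : 0 < N) (hT : 0 < T)
    (hG : ∀ z, ‖G z‖ ≤ 1) (hsupp : Function.support G ⊆ Set.Icc 1 (2 * (N : ℤ) ^ 2)) {a b : ℤ → ℤ}
    (ha : ∀ k, -(N : ℤ) < a k) (hb : ∀ k, b k < N) (Y : Finset ℤ)
    (h : (N : ℝ) ^ 5 ≤ T * ∑ k ∈ Finset.Icc (-(N : ℤ)) N, ∑ y ∈ Y,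
      ‖∑ d ∈ Finset.Icc (a k) (b k), G (y + d ^ 2) * R k (y + (d - k) ^ 2)‖ ^ 2) :
    (N : ℝ) ^ 6 ≤ 30 * T ^ 2 * ∑ k ∈ Finset.Icc (-(N : ℤ)) N,
      ∑ h ∈ Finset.Icc (-((2 * N : ℕ) : ℤ)) ((2 * N : ℕ) : ℤ),
      ∑ c ∈ Finset.Icc (-((2 * N : ℕ) : ℤ)) ((2 * N : ℕ) : ℤ),
        ‖columnCorr G (R k) (a k) (b k) k h c‖ := by
  have hN0 : (0 : ℝ) < N := by exact_mod_cast hN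
  set K := Finset.Icc (-(N : ℤ)) N with hK
  set H := Finset.Icc (-((2 * N : ℕ) : ℤ)) ((2 * N : ℕ) : ℤ) with hH
  set Ω : Finset ((_ : ℤ × ℤ) × ℤ) := (K ×ˢ H).sigma fun p =>
    Finset.Icc (1 - p.2 ^ 2) (2 * (N : ℤ) ^ 2 - p.2 ^ 2) with hΩ
  set Z : (_ : ℤ × ℤ) × ℤ → ℝ := fun p => ‖∑ d ∈ Finset.Icc (max (a p.1.1) (a p.1.1 - p.1.2))
    (min (b p.1.1) (b p.1.1 - p.1.2)), dualTerm G (R p.1.1) p.1.1 p.1.2 d p.2‖ with hZ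
  have hab : ∀ k, b k - a k ≤ ((2 * N : ℕ) : ℤ) := fun k => by
    have := ha k; have := hb k; push_cast; omega
  have h1 : (N : ℝ) ^ 5 ≤ T * ∑ p ∈ Ω, Z p := by
    refine h.trans (mul_le_mul_of_nonneg_left ?_ hT.le)
    rw [hΩ, Finset.sum_sigma, Finset.sum_product]
    exact Finset.sum_le_sum fun k _ => sum_norm_sq_le_sum_norm_dualTerm hG hsupp (hab k) k Y
  have hcard : (Ω.card : ℝ) ≤ 30 * N ^ 4 := by
    have c1 := card_Icc_neg_self_le hN 1
    have c2 := card_Icc_neg_self_le hN 2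
    rw [one_mul, ← hK] at c1
    rw [← hH] at c2
    have e : Ω.card = (K ×ˢ H).card * (2 * N ^ 2) := by
      rw [hΩ, Finset.card_sigma]
      refine Finset.sum_const_nat fun p _ => ?_
      rw [Int.card_Icc]
      rw [show 2 * (N : ℤ) ^ 2 - p.2 ^ 2 + 1 - (1 - p.2 ^ 2) = ((2 * N ^ 2 : ℕ) : ℤ) by push_cast; ring]
      exact Int.toNat_natCast _
    rw [e, Finset.card_product]
    push_cast
    calc (K.card : ℝ) * H.card * (2 * N ^ 2) ≤ ((2 * (1 : ℕ) + 1) * N) * ((2 * (2 : ℕ) + 1) * N) *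
          (2 * (N : ℝ) ^ 2) := by gcongr
      _ = 30 * (N : ℝ) ^ 4 := by push_cast; ring
  have h2 : ∑ p ∈ Ω, Z p ^ 2 ≤ ∑ k ∈ K, ∑ h ∈ H, ∑ c ∈ H,
      ‖columnCorr G (R k) (a k) (b k) k h c‖ := by
    rw [hΩ, Finset.sum_sigma, Finset.sum_product]
    refine Finset.sum_le_sum fun k _ => Finset.sum_le_sum fun h _ => ?_
    have h0 : min (b k) (b k - h) - max (a k) (a k - h) ≤ ((2 * N : ℕ) : ℤ) := by
      have := hab k
      omega
    exact sum_norm_sq_dualTerm_le (R := R k) ((Set.finite_Icc _ _).subset hsupp) h0 k h _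
  set S := ∑ k ∈ K, ∑ h ∈ H, ∑ c ∈ H, ‖columnCorr G (R k) (a k) (b k) k h c‖
  have h3 := sq_sum_le_card_mul_sum_sq (s := Ω) (f := Z)
  have hS0 : 0 ≤ ∑ p ∈ Ω, Z p ^ 2 := Finset.sum_nonneg fun _ _ => by positivity
  have h4 : (N : ℝ) ^ 4 * N ^ 6 ≤ N ^ 4 * (30 * T ^ 2 * S) := by
    calc (N : ℝ) ^ 4 * N ^ 6 = ((N : ℝ) ^ 5) ^ 2 := by ring
      _ ≤ (T * ∑ p ∈ Ω, Z p) ^ 2 := by gcongr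
      _ = T ^ 2 * (∑ p ∈ Ω, Z p) ^ 2 := by ring
      _ ≤ T ^ 2 * (30 * (N : ℝ) ^ 4 * S) := by
        gcongr
        refine h3.trans ?_
        gcongr
      _ = N ^ 4 * (30 * T ^ 2 * S) := by ring
  exact le_of_mul_le_mul_left h4 (by positivity)

/-! ### Generic parameters. -/

theorem card_small_le {N U : ℕ} (hU : 0 < U) (hUN : U ≤ N) (S : Finset ℤ) (m : ℤ) :
    ((S.filter fun h => (U : ℤ) * |m - h| < N).card : ℝ) ≤ 3 * N / U := by
  have h1 : (S.filter fun h => (U : ℤ) * |m - h| < N) ⊆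
      Finset.Icc (m - ((N / U : ℕ) : ℤ)) (m + ((N / U : ℕ) : ℤ)) := by
    intro h hh
    have h2 := (Finset.mem_filter.1 hh).2
    have h3 : |m - h| ≤ ((N / U : ℕ) : ℤ) := by
      push_cast
      rw [Int.le_ediv_iff_mul_le (by exact_mod_cast hU)]
      linarith
    rw [abs_le] at h3
    rw [Finset.mem_Icc]
    constructor <;> linarith [h3.1, h3.2]
  have h4 := Finset.card_le_card h1
  rw [Int.card_Icc] at h4
  have h5 : (S.filter fun h => (U : ℤ) * |m - h| < N).card ≤ 3 * (N / U) := by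
    have : 0 < N / U := Nat.div_pos hUN hU
    omega
  calc ((S.filter fun h => (U : ℤ) * |m - h| < N).card : ℝ) ≤ ((3 * (N / U) : ℕ) : ℝ) :=
        Nat.cast_le.2 h5
    _ = 3 * ((N / U : ℕ) : ℝ) := by push_cast; rfl
    _ ≤ 3 * (N / U : ℝ) := by gcongr; exact Nat.cast_div_le
    _ = 3 * (N : ℝ) / U := by ring

/-- `k`, `h` and `k - h` are of size at least `N / U`, and `k`, `k - h` are almost coprime. -/
def IsGenericPair (N U : ℕ) (k h : ℤ) : Prop :=
  (N : ℤ) ≤ U * |k| ∧ (N : ℤ) ≤ U * |k - h| ∧ (N : ℤ) ≤ U * |h| ∧ Int.gcd k (k - h) ≤ U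

open Classical in
theorem card_not_isGenericPair_le {N U : ℕ} (hU : 0 < U) (hUN : U ≤ N) :
    (((Finset.Icc (-(N : ℤ)) N ×ˢ Finset.Icc (-((2 * N : ℕ) : ℤ)) ((2 * N : ℕ) : ℤ)).filter
      fun p => ¬ IsGenericPair N U p.1 p.2).card : ℝ) ≤ 69 * (N : ℝ) ^ 2 / U := by
  have hN : 0 < N := by omega
  have c1 := card_Icc_neg_self_le hN 1
  have c2 := card_Icc_neg_self_le hN 2
  rw [one_mul] at c1
  set K := Finset.Icc (-(N : ℤ)) N with hK
  set H := Finset.Icc (-((2 * N : ℕ) : ℤ)) ((2 * N : ℕ) : ℤ) with hH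
  push_cast at c1 c2
  set B₁ := (K.filter fun k => (U : ℤ) * |0 - k| < N) ×ˢ H
  set B₂ := (K ×ˢ H).filter fun p => (U : ℤ) * |p.1 - p.2| < N
  set B₃ := K ×ˢ (H.filter fun h => (U : ℤ) * |0 - h| < N)
  set B₄ := (K ×ˢ H).filter fun p => p.1 ≠ 0 ∧ p.1 - p.2 ≠ 0 ∧ U < Int.gcd p.1 (p.1 - p.2)
  have hsub : ((K ×ˢ H).filter fun p => ¬ IsGenericPair N U p.1 p.2) ⊆ (B₁ ∪ B₂) ∪ (B₃ ∪ B₄) := by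
    rintro ⟨k, h⟩ hp
    obtain ⟨hkh, hbad⟩ := Finset.mem_filter.1 hp
    obtain ⟨hk, hh⟩ := Finset.mem_product.1 hkh
    simp only [Finset.mem_union, B₁, B₂, B₃, B₄, Finset.mem_product, Finset.mem_filter, zero_sub,
      abs_neg]
    simp only at hk hh hbad
    by_cases h1 : (U : ℤ) * |k| < N
    · exact Or.inl (Or.inl ⟨⟨hk, h1⟩, hh⟩)
    by_cases h2 : (U : ℤ) * |k - h| < N
    · exact Or.inl (Or.inr ⟨⟨hk, hh⟩, h2⟩)
    by_cases h3 : (U : ℤ) * |h| < N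
    · exact Or.inr (Or.inl ⟨hk, hh, h3⟩)
    refine Or.inr (Or.inr ⟨⟨hk, hh⟩, ?_, ?_, ?_⟩)
    · rintro rfl
      simp at h1
      omega
    · intro h0
      rw [h0] at h2
      simp at h2
      omega
    · by_contra h4
      exact hbad ⟨not_lt.1 h1, not_lt.1 h2, not_lt.1 h3, not_lt.1 h4⟩
  have b₁ : (B₁.card : ℝ) ≤ 3 * N / U * (5 * N) := by
    rw [Finset.card_product, Nat.cast_mul]
    gcongr
    · exact card_small_le hU hUN K 0
    · linarith
  have b₂ : (B₂.card : ℝ) ≤ 3 * N * (3 * N / U) := by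
    have e : B₂.card = ∑ k ∈ K, (H.filter fun h => (U : ℤ) * |k - h| < N).card := by
      simp only [B₂, Finset.card_filter, Finset.sum_product]
    rw [e]
    push_cast
    calc _ ≤ ∑ k ∈ K, (3 * N / U : ℝ) := Finset.sum_le_sum fun k _ => card_small_le hU hUN H k
      _ = K.card * (3 * N / U : ℝ) := by rw [Finset.sum_const, nsmul_eq_mul]
      _ ≤ 3 * N * (3 * N / U) := by
        gcongr
        linarith
  have b₃ : (B₃.card : ℝ) ≤ 3 * N * (3 * N / U) := by
    rw [Finset.card_product, Nat.cast_mul]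
    gcongr
    · linarith
    · exact card_small_le hU hUN H 0
  have b₄ : (B₄.card : ℝ) ≤ 36 * N ^ 2 / U := by
    have := card_large_gcd_le (3 * N) U hU
    refine le_trans (Nat.cast_le.2 (Finset.card_le_card_of_injOn (fun p => (p.1, p.1 - p.2)) ?_ ?_))
      (this.trans (le_of_eq (by push_cast; ring)))
    · rintro ⟨k, h⟩ hp
      simp only [B₄, hK, hH, Finset.coe_filter, Set.mem_ofPred_eq, Finset.mem_product,
        Finset.mem_Icc] at hp ⊢
      refine ⟨?_, hp.2⟩
      push_cast at hp ⊢
      omega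
    · rintro ⟨k, h⟩ _ ⟨k', h'⟩ _ hp
      simp only [Prod.mk.injEq] at hp
      obtain ⟨rfl, hp⟩ := hp
      rw [sub_right_injective hp]
  have hc : ((K ×ˢ H).filter fun p => ¬ IsGenericPair N U p.1 p.2).card ≤
      (B₁.card + B₂.card) + (B₃.card + B₄.card) :=
    (Finset.card_le_card hsub).trans ((Finset.card_union_le _ _).trans
      (add_le_add (Finset.card_union_le _ _) (Finset.card_union_le _ _)))
  have hcR : (((K ×ˢ H).filter fun p => ¬ IsGenericPair N U p.1 p.2).card : ℝ) ≤
      (B₁.card + B₂.card) + (B₃.card + B₄.card) := by exact_mod_cast hc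
  -- The four ways to fail contribute `15 + 9 + 9 + 36 = 69`.
  refine hcR.trans ((add_le_add (add_le_add b₁ b₂) (add_le_add b₃ b₄)).trans (le_of_eq ?_))
  ring

/-- Extracting many generic parameters from a large triple sum. -/
theorem exists_many_generic {N T : ℕ} (hT : 2 ^ 10 ≤ T) (hTN : T ^ 4 ≤ N) {e : ℤ → ℤ → ℤ → ℝ}
    (he0 : ∀ k h c, 0 ≤ e k h c) (he : ∀ k h c, e k h c ≤ 4 * (N : ℝ) ^ 3)
    (hsum : (N : ℝ) ^ 6 ≤ 30 * T ^ 2 * ∑ k ∈ Finset.Icc (-(N : ℤ)) N,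
      ∑ h ∈ Finset.Icc (-((2 * N : ℕ) : ℤ)) ((2 * N : ℕ) : ℤ),
      ∑ c ∈ Finset.Icc (-((2 * N : ℕ) : ℤ)) ((2 * N : ℕ) : ℤ), e k h c) :
    ∃ P ⊆ Finset.Icc (-((2 * N : ℕ) : ℤ)) ((2 * N : ℕ) : ℤ) ×ˢ
        Finset.Icc (-((2 * N : ℕ) : ℤ)) ((2 * N : ℕ) : ℤ),
      (N : ℝ) ^ 2 ≤ T ^ 4 * P.card ∧ ∀ p ∈ P, ∃ 𝒦 ⊆ Finset.Icc (-(N : ℤ)) N,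
        (N : ℝ) ≤ T ^ 4 * 𝒦.card ∧ ∀ k ∈ 𝒦, IsGenericPair N (T ^ 4) k p.1 ∧
          (N : ℝ) ^ 3 ≤ T ^ 4 * e k p.1 p.2 := by
  classical
  have hTR : (2 : ℝ) ^ 10 ≤ T := by exact_mod_cast hT
  have hT0 : (0 : ℝ) < T := lt_of_lt_of_le (by norm_num) hTR
  have hTpos : 0 < T := by omega
  have hT2 : (2 : ℝ) ^ 20 ≤ T ^ 2 := by nlinarith
  have hN : 0 < N := lt_of_lt_of_le (by positivity) hTN
  have hN0 : (0 : ℝ) < N := by exact_mod_cast hN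
  have hbad := card_not_isGenericPair_le (N := N) (U := T ^ 4) (by positivity) hTN
  have c1 := card_Icc_neg_self_le hN 1
  have c2 := card_Icc_neg_self_le hN 2
  rw [one_mul] at c1
  set K := Finset.Icc (-(N : ℤ)) N with hK
  set H := Finset.Icc (-((2 * N : ℕ) : ℤ)) ((2 * N : ℕ) : ℤ) with hH
  push_cast at c1 c2
  have hsum' : ∑ k ∈ K, ∑ h ∈ H, ∑ c ∈ H, e k h c =
      ∑ p ∈ (K ×ˢ H).filter (fun p => IsGenericPair N (T ^ 4) p.1 p.2), ∑ c ∈ H, e p.1 p.2 c +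
      ∑ p ∈ (K ×ˢ H).filter (fun p => ¬ IsGenericPair N (T ^ 4) p.1 p.2), ∑ c ∈ H, e p.1 p.2 c := by
    rw [Finset.sum_filter_add_sum_filter_not, Finset.sum_product]
  have hbadsum : ∑ p ∈ (K ×ˢ H).filter (fun p => ¬ IsGenericPair N (T ^ 4) p.1 p.2),
      ∑ c ∈ H, e p.1 p.2 c ≤ 1380 * (N : ℝ) ^ 6 / T ^ 4 := by
    have h1 : ∀ p : ℤ × ℤ, ∑ c ∈ H, e p.1 p.2 c ≤ 20 * (N : ℝ) ^ 4 := by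
      intro p
      calc ∑ c ∈ H, e p.1 p.2 c ≤ H.card • (4 * (N : ℝ) ^ 3) :=
            Finset.sum_le_card_nsmul _ _ _ fun c _ => he _ _ _
        _ = H.card * (4 * (N : ℝ) ^ 3) := nsmul_eq_mul _ _
        _ ≤ ((2 * 2 + 1) * N) * (4 * (N : ℝ) ^ 3) := by gcongr
        _ = 20 * (N : ℝ) ^ 4 := by ring
    refine (Finset.sum_le_card_nsmul _ _ _ fun p _ => h1 p).trans ?_
    rw [nsmul_eq_mul]
    refine (mul_le_mul_of_nonneg_right hbad (by positivity)).trans (le_of_eq ?_)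
    push_cast
    ring
  -- Here `p = (h, c)` is kept outside and `k` summed inside, because the function `Δ_{-2ch} G` to
  -- be controlled depends on `h` and `c` only.
  set g : ℤ × ℤ → ℝ := fun p => ∑ k ∈ K.filter (fun k => IsGenericPair N (T ^ 4) k p.1), e k p.1 p.2
    with hg
  have hgood : ∑ p ∈ (K ×ˢ H).filter (fun p => IsGenericPair N (T ^ 4) p.1 p.2),
      ∑ c ∈ H, e p.1 p.2 c = ∑ p ∈ H ×ˢ H, g p := by
    rw [Finset.sum_filter, Finset.sum_product, Finset.sum_product, Finset.sum_comm]
    refine Finset.sum_congr rfl fun h _ => ?_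
    simp only [hg]
    rw [Finset.sum_comm, Finset.sum_filter]
  have hX : (N : ℝ) ^ 6 / (60 * T ^ 2) ≤ ∑ p ∈ H ×ˢ H, g p := by
    rw [hsum', hgood] at hsum
    have h1 : 1380 * (N : ℝ) ^ 6 / T ^ 4 ≤ (N : ℝ) ^ 6 / (60 * T ^ 2) := by
      rw [div_le_div_iff₀ (by positivity) (by positivity)]
      calc 1380 * (N : ℝ) ^ 6 * (60 * T ^ 2) = N ^ 6 * (82800 * (T : ℝ) ^ 2) := by ring
        _ ≤ N ^ 6 * ((T : ℝ) ^ 2 * (T : ℝ) ^ 2) := by gcongr; linarith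
        _ = (N : ℝ) ^ 6 * T ^ 4 := by ring
    have h2 : (N : ℝ) ^ 6 / (30 * T ^ 2) ≤ ∑ p ∈ H ×ˢ H, g p + (N : ℝ) ^ 6 / (60 * T ^ 2) := by
      rw [div_le_iff₀ (by positivity), mul_comm]
      refine hsum.trans (mul_le_mul_of_nonneg_left ?_ (by positivity))
      linarith
    have h3 : (N : ℝ) ^ 6 / (30 * T ^ 2) = (N : ℝ) ^ 6 / (60 * T ^ 2) + (N : ℝ) ^ 6 / (60 * T ^ 2) := by
      field_simp
      norm_num
    linarith
  have hKc : ∀ p : ℤ × ℤ, ((K.filter fun k => IsGenericPair N (T ^ 4) k p.1).card : ℝ) ≤ 3 * N := by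
    intro p
    have : ((K.filter fun k => IsGenericPair N (T ^ 4) k p.1).card : ℝ) ≤ K.card :=
      Nat.cast_le.2 (Finset.card_filter_le _ _)
    linarith
  have hgY : ∀ p ∈ H ×ˢ H, g p ≤ 12 * (N : ℝ) ^ 4 := by
    intro p _
    calc g p ≤ (K.filter fun k => IsGenericPair N (T ^ 4) k p.1).card • (4 * (N : ℝ) ^ 3) :=
          Finset.sum_le_card_nsmul _ _ _ fun c _ => he _ _ _
      _ = (K.filter fun k => IsGenericPair N (T ^ 4) k p.1).card * (4 * (N : ℝ) ^ 3) :=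
          nsmul_eq_mul _ _
      _ ≤ (3 * N) * (4 * (N : ℝ) ^ 3) := by gcongr; exact hKc p
      _ = 12 * (N : ℝ) ^ 4 := by ring
  have hHH : ((H ×ˢ H).card : ℝ) ≤ 25 * N ^ 2 := by
    rw [Finset.card_product, Nat.cast_mul]
    calc (H.card : ℝ) * H.card ≤ ((2 * 2 + 1) * N) * ((2 * 2 + 1) * N) := by gcongr
      _ = 25 * (N : ℝ) ^ 2 := by ring
  have hpop := le_card_popular (H ×ˢ H) g (by positivity) (by positivity) hHH hgY hX
  refine ⟨_, Finset.filter_subset (fun p => (N : ℝ) ^ 6 / (60 * T ^ 2) ≤ 2 * (25 * N ^ 2) * g p) _,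
    ?_, fun p hp => ?_⟩
  · rw [div_le_iff₀ (by positivity)] at hpop
    refine le_of_mul_le_mul_left (a := (N : ℝ) ^ 4) ?_ (by positivity)
    refine le_trans (le_of_eq (by ring)) (hpop.trans ?_)
    set P := (((H ×ˢ H).filter fun p => (N : ℝ) ^ 6 / (60 * T ^ 2) ≤
      2 * (25 * N ^ 2) * g p).card : ℝ)
    have hP0 : 0 ≤ P := Nat.cast_nonneg _
    calc 2 * (12 * (N : ℝ) ^ 4) * P * (60 * T ^ 2) = N ^ 4 * (1440 * (T : ℝ) ^ 2 * P) := by ring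
      _ ≤ N ^ 4 * ((T : ℝ) ^ 2 * (T : ℝ) ^ 2 * P) := by gcongr; linarith
      _ = N ^ 4 * ((T : ℝ) ^ 4 * P) := by ring
  · obtain ⟨_, hp2⟩ := Finset.mem_filter.1 hp
    have hp3 : (N : ℝ) ^ 4 / (3000 * T ^ 2) ≤ g p := by
      rw [div_le_iff₀ (by positivity)] at hp2 ⊢
      refine le_of_mul_le_mul_left (a := (N : ℝ) ^ 2) ?_ (by positivity)
      exact le_trans (le_of_eq (by ring)) (hp2.trans (le_of_eq (by ring)))
    have hpop' := le_card_popular (K.filter fun k => IsGenericPair N (T ^ 4) k p.1)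
      (fun k => e k p.1 p.2) (by positivity) (by positivity) (hKc p) (fun k _ => he _ _ _) hp3
    set 𝒦 := (K.filter fun k => IsGenericPair N (T ^ 4) k p.1).filter fun k =>
      (N : ℝ) ^ 4 / (3000 * T ^ 2) ≤ 2 * (3 * N) * e k p.1 p.2 with h𝒦
    refine ⟨𝒦, (Finset.filter_subset _ _).trans (Finset.filter_subset _ _), ?_, fun k hk => ?_⟩
    · rw [div_le_iff₀ (by positivity)] at hpop'
      refine le_of_mul_le_mul_left (a := (N : ℝ) ^ 3) ?_ (by positivity)
      refine le_trans (le_of_eq (by ring)) (hpop'.trans ?_)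
      calc 2 * (4 * (N : ℝ) ^ 3) * 𝒦.card * (3000 * T ^ 2) =
            N ^ 3 * (24000 * (T : ℝ) ^ 2 * 𝒦.card) := by ring
        _ ≤ N ^ 3 * ((T : ℝ) ^ 2 * (T : ℝ) ^ 2 * 𝒦.card) := by gcongr; linarith
        _ = N ^ 3 * ((T : ℝ) ^ 4 * 𝒦.card) := by ring
    · obtain ⟨hk1, hk2⟩ := Finset.mem_filter.1 hk
      refine ⟨(Finset.mem_filter.1 hk1).2, ?_⟩
      rw [div_le_iff₀ (by positivity)] at hk2
      refine le_of_mul_le_mul_left (a := (N : ℝ)) ?_ (by positivity)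
      refine le_trans (le_of_eq (by ring)) (hk2.trans ?_)
      have := he0 k p.1 p.2
      calc 2 * (3 * (N : ℝ)) * e k p.1 p.2 * (3000 * T ^ 2) =
            N * (18000 * (T : ℝ) ^ 2 * e k p.1 p.2) := by ring
        _ ≤ N * ((T : ℝ) ^ 2 * (T : ℝ) ^ 2 * e k p.1 p.2) := by gcongr; linarith
        _ = N * ((T : ℝ) ^ 4 * e k p.1 p.2) := by ring

/-! ### The `U⁵` bound for one column. -/

/-- Control of a single column: the Gowers `U⁵`-norm of `G` is large if `G` correlates, along
parabolas, with translates of bounded functions. -/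
theorem le_gowersRe_five {G : ℤ → ℂ} {R : ℤ → ℤ → ℂ} {N T : ℕ} (hT : 2 ^ 10 ≤ T)
    (hTN : T ^ 735027 ≤ N) (hG : ∀ z, ‖G z‖ ≤ 1) (hR : ∀ k z, ‖R k z‖ ≤ 1)
    (hsupp : Function.support G ⊆ Set.Icc 1 (2 * (N : ℤ) ^ 2)) {a b : ℤ → ℤ}
    (ha : ∀ k, -(N : ℤ) < a k) (hb : ∀ k, b k < N) (Y : Finset ℤ)
    (h : (N : ℝ) ^ 5 ≤ T * ∑ k ∈ Finset.Icc (-(N : ℤ)) N, ∑ y ∈ Y,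
      ‖∑ d ∈ Finset.Icc (a k) (b k), G (y + d ^ 2) * R k (y + (d - k) ^ 2)‖ ^ 2) :
    (N : ℝ) ^ 12 ≤ T ^ 1470047 * gowersRe 5 G := by
  have hTpos : 0 < T := by omega
  have hTR : (2 : ℝ) ^ 10 ≤ T := by exact_mod_cast hT
  have hT0 : (0 : ℝ) < T := lt_of_lt_of_le (by norm_num) hTR
  have hN : 0 < N := lt_of_lt_of_le (Nat.pow_pos hTpos) hTN
  have hN0 : (0 : ℝ) < N := by exact_mod_cast hN
  have hfin : (Function.support G).Finite := (Set.finite_Icc _ _).subset hsupp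
  have s1 := le_sum_norm_columnCorr hN hT0 hG hsupp ha hb Y h
  obtain ⟨P, hPsub, hPcard, hP⟩ := exists_many_generic hT
    ((Nat.pow_le_pow_right hTpos (by norm_num)).trans hTN)
    (e := fun k h c => ‖columnCorr G (R k) (a k) (b k) k h c‖) (fun _ _ _ => norm_nonneg _)
    (fun k h c => norm_columnCorr_le hG (hR k) hsupp (ha k) (hb k) k h c) s1
  have hPmem : ∀ p ∈ P, |p.1| ≤ 2 * N ∧ |p.2| ≤ 2 * N := by
    intro p hp
    have := Finset.mem_product.1 (hPsub hp)
    simp only [Finset.mem_Icc] at this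
    push_cast at this
    exact ⟨abs_le.2 this.1, abs_le.2 this.2⟩
  have hT4 : 2 ^ 10 ≤ T ^ 4 := hT.trans (Nat.le_self_pow (by norm_num) T)
  -- The exponent is `4 · 91876`, as `le_gowersRe_four` is applied with `T⁴` in place of `T`.
  have hfour : ∀ p ∈ P, (N : ℝ) ^ 10 ≤ (T : ℝ) ^ 367504 *
      gowersRe 4 (multDiff (-(2 * p.2 * p.1)) G) := by
    intro p hp
    obtain ⟨𝒦, h𝒦, hcard, hk⟩ := hP p hp
    have := le_gowersRe_four (T := T ^ 4) (N := N) (h := p.1) (𝒦 := 𝒦) hT4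
      (by
        rw [← pow_mul]
        exact (Nat.pow_le_pow_right hTpos (by norm_num)).trans hTN)
      (norm_multDiff_le hG (-(2 * p.2 * p.1))) ((multDiff_support_subset _ _).trans hsupp)
      (fun k hkm => by
        obtain ⟨⟨g1, g2, g3, g4⟩, _⟩ := hk k hkm
        have hkN := abs_le.2 (Finset.mem_Icc.1 (h𝒦 hkm))
        have hp1 := (hPmem p hp).1
        exact ⟨by linarith, (abs_sub _ _).trans (by linarith), g1, g2, g4⟩)
      (by exact_mod_cast hcard)
      (fun k hkm => by
        obtain ⟨_, hE⟩ := hk k hkm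
        refine ⟨_, _, _, _, ?_, ?_, card_Icc_columnCorr_le (ha k) (hb k) p.1 p.2,
          by rw [Nat.cast_pow]; exact hE⟩
        · exact norm_multDiff_le (fun w => hR k _) _
        · exact norm_multDiff_le (fun w => by rw [RCLike.norm_conj]; exact hR k _) _)
    rw [Nat.cast_pow, ← pow_mul] at this
    exact this
  have hUp : ∀ p ∈ P, (N : ℤ) ≤ (T ^ 4 : ℕ) * |p.1| := by
    intro p hp
    obtain ⟨𝒦, _, hcard, hk⟩ := hP p hp
    obtain ⟨k, hkm⟩ : 𝒦.Nonempty := by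
      rw [Finset.nonempty_iff_ne_empty]
      rintro rfl
      simp only [Finset.card_empty, Nat.cast_zero, mul_zero] at hcard
      linarith
    exact (hk k hkm).1.2.2.1
  -- Negating `c` writes the step `-2ch` as the product `2 · h · (-c)` expected by the
  -- concatenation, where `h` must be the entry bounded below.
  set e : ℤ × ℤ → ℤ × ℤ := fun p => (p.1, -p.2) with he
  have hinj : Function.Injective e := by
    rintro ⟨p, q⟩ ⟨p', q'⟩ h0
    simp only [he, Prod.mk.injEq, neg_inj] at h0
    rw [h0.1, h0.2]
  set S := P.map ⟨e, hinj⟩ with hS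
  have hSmem : ∀ p ∈ S, (N : ℤ) ≤ (T ^ 4 : ℕ) * |p.1| ∧ |p.1| ≤ 3 * N ∧ |p.2| ≤ 2 * N := by
    intro q hq
    obtain ⟨p, hp, rfl⟩ := Finset.mem_map.1 hq
    simp only [he, Function.Embedding.coeFn_mk, abs_neg]
    exact ⟨hUp p hp, by linarith [(hPmem p hp).1], (hPmem p hp).2⟩
  have hSsum : P.card * ((N : ℝ) ^ 10 / T ^ 367504) ≤
      ∑ p ∈ S, gowersRe 4 (multDiff (2 * p.1 * p.2) G) := by
    rw [hS, Finset.sum_map, ← nsmul_eq_mul]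
    refine Finset.card_nsmul_le_sum _ _ _ fun p hp => ?_
    rw [div_le_iff₀ (by positivity), mul_comm _ ((T : ℝ) ^ 367504)]
    refine (hfour p hp).trans (le_of_eq ?_)
    simp only [he, Function.Embedding.coeFn_mk]
    rw [show 2 * p.1 * -p.2 = -(2 * p.2 * p.1) by ring]
  have hY : ∀ n, gowersRe 4 (multDiff n G) ≤ 2592 * (N : ℝ) ^ 10 := by
    intro n
    have := gowersRe_le (R := 2 * N ^ 2) (norm_multDiff_le hG n)
      ((multDiff_support_subset n G).trans (by push_cast; exact hsupp)) 4
    push_cast at this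
    refine this.trans (le_of_eq ?_)
    ring
  have hbig : (N : ℝ) ^ 2 * (2592 * N ^ 10) ≤
      ((T ^ 367510 : ℕ) : ℝ) * ∑ p ∈ S, gowersRe 4 (multDiff (2 * p.1 * p.2) G) := by
    refine le_trans ?_ (mul_le_mul_of_nonneg_left hSsum (by positivity))
    have h2 : (2592 : ℝ) ≤ T ^ 2 := by nlinarith
    rw [Nat.cast_pow]
    calc (N : ℝ) ^ 2 * (2592 * N ^ 10) ≤ (T ^ 4 * P.card) * ((T : ℝ) ^ 2 * (N : ℝ) ^ 10) := by gcongr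
      _ = T ^ 6 * (P.card * (N : ℝ) ^ 10) := by ring
      _ = (T : ℝ) ^ 367510 * (P.card * (N ^ 10 / T ^ 367504)) := by
        rw [show (T : ℝ) ^ 367510 = T ^ 6 * T ^ 367504 by rw [← pow_add]]
        field_simp
  have hfinal := gowersRe_concatenation (U := T ^ 4) (W := T ^ 367510) (by norm_num)
    (Nat.pow_pos hTpos) (Nat.pow_pos hTpos) (by
      refine le_trans ?_ hTN
      calc T ^ 4 * (1800 * (T ^ 367510) ^ 2) = 1800 * T ^ 735024 := by ring
        _ ≤ T ^ 3 * T ^ 735024 := by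
          gcongr
          calc 1800 ≤ (2 ^ 10) ^ 3 := by norm_num
            _ ≤ T ^ 3 := by gcongr
        _ = T ^ 735027 := by ring)
    hfin (by positivity) hY S hSmem hbig
  have hg0 : 0 ≤ gowersRe 5 G := gowersRe_nonneg (by norm_num) hfin
  have h3 : (N : ℝ) ^ 12 ≤ (N : ℝ) ^ 2 * (2592 * N ^ 10) := by
    have : (0 : ℝ) ≤ N ^ 12 := by positivity
    calc (N : ℝ) ^ 12 ≤ 2592 * (N : ℝ) ^ 12 := by linarith
      _ = _ := by ring
  refine h3.trans (hfinal.trans ?_)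
  rw [Nat.cast_pow, Nat.cast_pow]
  gcongr
  calc (2 : ℝ) ^ 22 * T ^ 4 * (T ^ 367510) ^ 4 = 2 ^ 22 * (T : ℝ) ^ 1470044 := by ring
    _ ≤ (T : ℝ) ^ 3 * T ^ 1470044 := by
      gcongr
      calc (2 : ℝ) ^ 22 ≤ (2 ^ 10) ^ 3 := by norm_num
        _ ≤ (T : ℝ) ^ 3 := by gcongr
    _ = (T : ℝ) ^ 1470047 := by ring

theorem multDiff_zero_apply (f : ℤ → ℂ) (z : ℤ) : multDiff 0 f z = ((‖f z‖ ^ 2 : ℝ) : ℂ) := by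
  rw [multDiff, add_zero, Complex.mul_conj', Complex.ofReal_pow]

theorem norm_multDiff_zero (f : ℤ → ℂ) (z : ℤ) : ‖multDiff 0 f z‖ = ‖f z‖ ^ 2 := by
  rw [multDiff_zero_apply, Complex.norm_real, Real.norm_of_nonneg (by positivity)]

theorem gowersRe_multDiff_zero_le {f : ℤ → ℂ} (hf : (Function.support f).Finite) {s : ℕ}
    (hs : 1 ≤ s) : gowersRe s (multDiff 0 f) ≤ gowersRe (s + 1) f :=
  le_hasSum (gowersRe_succ s hf) 0 fun n _ => gowersRe_nonneg hs (multDiff_finite_support hf n)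

/-- `multDiff 0 f` is `|f|²`, so every term of its Gowers sum is non-negative and the single term at
`z` with step `0` may be kept. -/
theorem norm_pow_le_gowersRe_one {f : ℤ → ℂ} (hf : (Function.support f).Finite) (z : ℤ) :
    ‖f z‖ ^ 4 ≤ gowersRe 1 (multDiff 0 f) := by
  have hf0 := multDiff_finite_support hf 0
  have e : ∀ n, gowersRe 0 (multDiff n (multDiff 0 f)) = ∑' z, ‖f z‖ ^ 2 * ‖f (z + n)‖ ^ 2 := by
    intro n
    rw [gowersRe, gowersSum_zero, ← Complex.ofReal_re (∑' z, ‖f z‖ ^ 2 * ‖f (z + n)‖ ^ 2),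
      Complex.ofReal_tsum]
    congr 1
    refine tsum_congr fun z => ?_
    rw [multDiff, multDiff_zero_apply, multDiff_zero_apply, Complex.conj_ofReal]
    push_cast
    rfl
  have h1 : gowersRe 0 (multDiff 0 (multDiff 0 f)) ≤ gowersRe 1 (multDiff 0 f) := by
    refine le_hasSum (gowersRe_succ 0 hf0) 0 fun n _ => ?_
    rw [e]
    exact tsum_nonneg fun z => by positivity
  refine le_trans ?_ h1
  rw [e]
  have hs : Summable fun z => ‖f z‖ ^ 2 * ‖f (z + 0)‖ ^ 2 := by
    refine summable_of_hasFiniteSupport (hf.subset fun z hz h0 => hz ?_)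
    simp [h0]
  refine le_trans (le_of_eq ?_) (hs.le_tsum z fun z _ => by positivity)
  rw [add_zero]
  ring

theorem norm_pow_le_gowersRe_five {f : ℤ → ℂ} (hf : (Function.support f).Finite) (z : ℤ) :
    ‖f z‖ ^ 32 ≤ gowersRe 5 f := by
  have h1 := multDiff_finite_support hf 0
  have h2 := multDiff_finite_support h1 0
  have h3 := multDiff_finite_support h2 0
  have := norm_pow_le_gowersRe_one h3 z
  simp only [norm_multDiff_zero, ← pow_mul] at this
  norm_num at this
  exact this.trans ((gowersRe_multDiff_zero_le h3 le_rfl).trans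
    ((gowersRe_multDiff_zero_le h2 (by norm_num)).trans
      ((gowersRe_multDiff_zero_le h1 (by norm_num)).trans
        (gowersRe_multDiff_zero_le hf (by norm_num)))))

/-- Trivial bound: if `|G|²` stayed below `1/(12T)`, then `3N` values of `k`, `N²` of `y` and fewer
than `2N` of `d` could not produce `N⁵/T`. -/
theorem exists_norm_sq_large {G : ℤ → ℂ} {R : ℤ → ℤ → ℂ} {N T : ℕ} (hN : 0 < N) (hTpos : 0 < T)
    (hR : ∀ k z, ‖R k z‖ ≤ 1) {a b : ℤ → ℤ} (ha : ∀ k, -(N : ℤ) < a k) (hb : ∀ k, b k < N)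
    {Y : Finset ℤ} (hY : Y.card ≤ N ^ 2)
    (h : (N : ℝ) ^ 5 ≤ T * ∑ k ∈ Finset.Icc (-(N : ℤ)) N, ∑ y ∈ Y,
      ‖∑ d ∈ Finset.Icc (a k) (b k), G (y + d ^ 2) * R k (y + (d - k) ^ 2)‖ ^ 2) :
    ∃ z, 1 ≤ 12 * T * ‖G z‖ ^ 2 := by
  by_contra! hc
  have hN0 : (0 : ℝ) < N := by exact_mod_cast hN
  have hT0 : (0 : ℝ) < T := by exact_mod_cast hTpos
  have c1 := card_Icc_neg_self_le hN 1
  rw [one_mul] at c1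
  push_cast at c1
  set ε : ℝ := 1 / (12 * T) with hε
  have hGε : ∀ z, ‖G z‖ ^ 2 < ε := fun z => by
    rw [hε, lt_div_iff₀ (by positivity)]
    have := hc z
    linarith
  have h1 : ∀ k y, ‖∑ d ∈ Finset.Icc (a k) (b k), G (y + d ^ 2) * R k (y + (d - k) ^ 2)‖ ^ 2 ≤
      (2 * N - 1) ^ 2 * ε := by
    intro k y
    have h2 : ‖∑ d ∈ Finset.Icc (a k) (b k), G (y + d ^ 2) * R k (y + (d - k) ^ 2)‖ ≤
        (2 * N - 1) * √ε := by
      refine (norm_sum_le_of_le (n := fun _ => √ε) _ fun d _ => ?_).trans ?_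
      · rw [norm_mul]
        refine (mul_le_of_le_one_right (norm_nonneg _) (hR _ _)).trans ?_
        exact Real.le_sqrt_of_sq_le (hGε _).le
      · rw [Finset.sum_const, nsmul_eq_mul]
        gcongr
        -- There are at most `2N - 1` values of `d`; the missing one makes the final inequality
        -- strict.
        have h3 : (Finset.Icc (a k) (b k)).card + 1 ≤ 2 * N := by
          have := ha k; have := hb k
          rw [Int.card_Icc]
          omega
        have h4 : ((Finset.Icc (a k) (b k)).card : ℝ) + 1 ≤ 2 * N := by exact_mod_cast h3
        linarith
    calc _ ≤ ((2 * N - 1) * √ε) ^ 2 := by gcongr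
      _ = (2 * N - 1) ^ 2 * ε := by rw [mul_pow, Real.sq_sqrt (by positivity)]
  have hN1 : (1 : ℝ) ≤ N := by exact_mod_cast hN
  have h5 : ∑ k ∈ Finset.Icc (-(N : ℤ)) N, ∑ y ∈ Y,
      ‖∑ d ∈ Finset.Icc (a k) (b k), G (y + d ^ 2) * R k (y + (d - k) ^ 2)‖ ^ 2 ≤
      (3 * N) * ((N : ℝ) ^ 2 * ((2 * N - 1) ^ 2 * ε)) := by
    calc _ ≤ ∑ k ∈ Finset.Icc (-(N : ℤ)) N, ∑ y ∈ Y, ((2 * (N : ℝ) - 1) ^ 2 * ε) :=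
          Finset.sum_le_sum fun k _ => Finset.sum_le_sum fun y _ => h1 k y
      _ = ((Finset.Icc (-(N : ℤ)) N).card : ℝ) * ((Y.card : ℝ) * ((2 * (N : ℝ) - 1) ^ 2 * ε)) := by
          simp only [Finset.sum_const, nsmul_eq_mul]
      _ ≤ _ := by
          gcongr
          · linarith
          · exact_mod_cast hY
  have h6 : (2 * (N : ℝ) - 1) ^ 2 < 4 * N ^ 2 := by nlinarith
  have h7 : (N : ℝ) ^ 5 < N ^ 5 := by
    calc (N : ℝ) ^ 5 ≤ T * ((3 * N) * ((N : ℝ) ^ 2 * ((2 * N - 1) ^ 2 * ε))) :=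
          h.trans (mul_le_mul_of_nonneg_left h5 hT0.le)
      _ < T * ((3 * N) * ((N : ℝ) ^ 2 * ((4 * (N : ℝ) ^ 2) * ε))) := by gcongr
      _ = (N : ℝ) ^ 5 := by
        rw [hε]
        field_simp
        norm_num
  exact lt_irrefl _ h7

/-- For `N` below the threshold of `le_gowersRe_five`, the left side is itself at most a power of
`T`, and one large value of `G` bounds the Gowers sum from below. -/
theorem exists_column_control : ∃ C : ℕ, ∀ (N T : ℕ) (G : ℤ → ℂ) (R : ℤ → ℤ → ℂ) (a b : ℤ → ℤ)
    (Y : Finset ℤ), 0 < N → 2 ^ 10 ≤ T → (∀ z, ‖G z‖ ≤ 1) → (∀ k z, ‖R k z‖ ≤ 1) →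
    Function.support G ⊆ Set.Icc 1 (2 * (N : ℤ) ^ 2) → (∀ k, -(N : ℤ) < a k) → (∀ k, b k < N) →
    Y.card ≤ N ^ 2 →
    (N : ℝ) ^ 5 ≤ T * ∑ k ∈ Finset.Icc (-(N : ℤ)) N, ∑ y ∈ Y,
      ‖∑ d ∈ Finset.Icc (a k) (b k), G (y + d ^ 2) * R k (y + (d - k) ^ 2)‖ ^ 2 →
    (N : ℝ) ^ 12 ≤ T ^ C * gowersRe 5 G := by
  refine ⟨12 * 735027 + 32, fun N T G R a b Y hN hT hG hR hsupp ha hb hY h => ?_⟩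
  have hfin : (Function.support G).Finite := (Set.finite_Icc _ _).subset hsupp
  have hg0 : 0 ≤ gowersRe 5 G := gowersRe_nonneg (by norm_num) hfin
  have hTR : (2 : ℝ) ^ 10 ≤ T := by exact_mod_cast hT
  have hT1 : (1 : ℝ) ≤ T := le_trans (by norm_num) hTR
  have hT0 : (0 : ℝ) < T := by linarith
  rcases le_or_gt (T ^ 735027) N with hTN | hTN
  · refine (le_gowersRe_five hT hTN hG hR hsupp ha hb Y h).trans ?_
    gcongr
    norm_num
  · obtain ⟨z, hz⟩ := exists_norm_sq_large hN (by omega) hR ha hb hY h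
    have h1 : (1 : ℝ) ≤ T ^ 32 * gowersRe 5 G := by
      calc (1 : ℝ) ≤ (12 * T * ‖G z‖ ^ 2) ^ 16 := one_le_pow₀ hz
        _ ≤ (T * T * ‖G z‖ ^ 2) ^ 16 := by
          gcongr
          linarith
        _ = T ^ 32 * ‖G z‖ ^ 32 := by ring
        _ ≤ T ^ 32 * gowersRe 5 G := by
          gcongr
          exact norm_pow_le_gowersRe_five hfin z
    have h2 : (N : ℝ) ≤ T ^ 735027 := by exact_mod_cast hTN.le
    calc (N : ℝ) ^ 12 ≤ ((T : ℝ) ^ 735027) ^ 12 * 1 := by rw [mul_one]; gcongr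
      _ ≤ ((T : ℝ) ^ 735027) ^ 12 * (T ^ 32 * gowersRe 5 G) := by gcongr
      _ = (T : ℝ) ^ (12 * 735027 + 32) * gowersRe 5 G := by
        rw [← mul_assoc, ← pow_mul, ← pow_add]

/-! ### From the counting operator to columns. -/

/-- The Fejér weight is the autocorrelation of the uniform measure on `[N]`: it counts the `t` with
both `t` and `t + d` in `[N]`. Hence it is an average of sharp cut-offs. -/
theorem fejer_eq_card {N : ℕ} (hN : 0 < N) (d : ℤ) :
    fejer N d = (((Finset.Icc (1 : ℤ) N).filter fun t : ℤ => d ∈ Finset.Icc (1 - t) ((N : ℤ) - t)).card : ℝ) /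
      N ^ 2 := by
  have hN0 : (0 : ℝ) < N := by exact_mod_cast hN
  have h1 : ((Finset.Icc (1 : ℤ) N).filter fun t : ℤ => d ∈ Finset.Icc (1 - t) ((N : ℤ) - t)) =
      Finset.Icc (max 1 (1 - d)) (min (N : ℤ) (N - d)) := by
    ext t
    simp only [Finset.mem_filter, Finset.mem_Icc]
    omega
  rw [h1, Int.card_Icc, show min (N : ℤ) (N - d) + 1 - max 1 (1 - d) = N - |d| by
    rcases abs_cases d with h | h <;> omega, fejer]
  have h2 : (((N - |d| : ℤ).toNat : ℤ) : ℝ) = max (N - |(d : ℝ)|) 0 := by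
    rw [Int.toNat_eq_max]
    push_cast
    rfl
  rw [Int.cast_natCast] at h2
  rw [h2, show (N - |(d : ℝ)|) = N * (1 - |(d : ℝ)| / N) by field_simp,
    show (0 : ℝ) = N * 0 by ring, ← mul_max_of_nonneg _ _ hN0.le]
  field_simp
  simp

theorem tsum_fejer_mul {N : ℕ} (hN : 0 < N) (φ : ℤ → ℂ) :
    ∑' d : ℤ, (fejer N d : ℂ) * φ d =
      (∑ t ∈ Finset.Icc (1 : ℤ) N, ∑ d ∈ Finset.Icc (1 - t) (N - t), φ d) / N ^ 2 := by
  rw [tsum_eq_sum (s := Finset.Icc (-(N : ℤ)) N)]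
  · have h1 : ∀ t ∈ Finset.Icc (1 : ℤ) N, ∑ d ∈ Finset.Icc (1 - t) (N - t), φ d =
        ∑ d ∈ Finset.Icc (-(N : ℤ)) N, if d ∈ Finset.Icc (1 - t) (N - t) then φ d else 0 := by
      intro t ht
      rw [Finset.mem_Icc] at ht
      rw [← Finset.sum_filter, Finset.filter_mem_eq_inter,
        Finset.inter_eq_right.2 (Finset.Icc_subset_Icc (by linarith) (by linarith))]
    rw [Finset.sum_congr rfl h1, Finset.sum_comm, Finset.sum_div]
    refine Finset.sum_congr rfl fun d _ => ?_
    rw [fejer_eq_card hN, ← Finset.sum_filter, Finset.sum_const, nsmul_eq_mul]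
    push_cast
    ring
  · intro d hd
    rw [fejer_eq_card hN, Finset.filter_false_of_mem]
    · simp
    · intro t ht ht'
      simp only [Finset.mem_Icc] at ht ht' hd
      omega

theorem exists_interval_correlation {N : ℕ} (hN : 0 < N) {f₀ f₁ g : ℤ × ℤ → ℂ} {δ : ℝ}
    (h : δ ≤ ‖countingOp N f₀ f₁ g‖) :
    ∃ t ∈ Finset.Icc (1 : ℤ) N, δ * N ^ 4 ≤ ‖∑ x ∈ Finset.Icc (1 : ℤ) N,
      ∑ y ∈ Finset.Icc (1 : ℤ) ((N : ℤ) ^ 2), f₀ (x, y) *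
        ∑ d ∈ Finset.Icc (1 - t) (N - t), f₁ (x + d, y) * g (x, y + d ^ 2)‖ := by
  have hN0 : (0 : ℝ) < N := by exact_mod_cast hN
  have hNC : (N : ℂ) ≠ 0 := by exact_mod_cast hN0.ne'
  have e : countingOp N f₀ f₁ g = (∑ t ∈ Finset.Icc (1 : ℤ) N, ∑ x ∈ Finset.Icc (1 : ℤ) N,
      ∑ y ∈ Finset.Icc (1 : ℤ) ((N : ℤ) ^ 2), f₀ (x, y) *
        ∑ d ∈ Finset.Icc (1 - t) (N - t), f₁ (x + d, y) * g (x, y + d ^ 2)) / N ^ 5 := by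
    have hc1 : ((Finset.Icc (1 : ℤ) N).card : ℂ) = N := by simp
    have hc2 : ((Finset.Icc (1 : ℤ) ((N : ℤ) ^ 2)).card : ℂ) = N ^ 2 := by
      rw [Int.card_Icc, add_sub_cancel_right, ← Nat.cast_pow, Int.toNat_natCast, Nat.cast_pow]
    simp only [countingOp, Finset.expect_eq_sum_div_card, hc1, hc2, mul_assoc, tsum_fejer_mul hN]
    have hm : ∀ x y : ℤ, ∀ S : ℤ → ℂ, f₀ (x, y) * ((∑ t ∈ Finset.Icc (1 : ℤ) N, S t) / (N : ℂ) ^ 2) =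
        (∑ t ∈ Finset.Icc (1 : ℤ) N, f₀ (x, y) * S t) / (N : ℂ) ^ 2 := fun x y S => by
      rw [← mul_div_assoc, Finset.mul_sum]
    simp only [hm, ← Finset.sum_div, div_div]
    congr 1
    · symm
      rw [Finset.sum_comm]
      refine Finset.sum_congr rfl fun x _ => ?_
      rw [Finset.sum_comm]
    · ring
  have h1 : ((Finset.Icc (1 : ℤ) N).card : ℝ) * (δ * N ^ 4) ≤ ∑ t ∈ Finset.Icc (1 : ℤ) N,
      ‖∑ x ∈ Finset.Icc (1 : ℤ) N, ∑ y ∈ Finset.Icc (1 : ℤ) ((N : ℤ) ^ 2), f₀ (x, y) *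
        ∑ d ∈ Finset.Icc (1 - t) (N - t), f₁ (x + d, y) * g (x, y + d ^ 2)‖ := by
    refine le_trans ?_ (norm_sum_le _ _)
    rw [e, norm_div, norm_pow, Complex.norm_natCast, le_div_iff₀ (by positivity)] at h
    refine le_trans (le_of_eq ?_) h
    simp
    ring
  exact exists_le_of_card_mul_le_sum ⟨1, by simp; omega⟩ h1

/-- Removing the two functions `f₀`, `f₁` by the Cauchy-Schwarz inequality. -/
theorem le_sum_norm_sq_columns {N : ℕ} (hN : 0 < N) {f₀ f₁ : ℤ × ℤ → ℂ} {G : ℤ → ℤ → ℂ} {δ : ℝ}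
    (hδ : 0 ≤ δ) (h₀ : ∀ p, ‖f₀ p‖ ≤ 1) (h₁ : ∀ p, ‖f₁ p‖ ≤ 1) {t : ℤ}
    (ht : t ∈ Finset.Icc (1 : ℤ) N)
    (h : δ * N ^ 4 ≤ ‖∑ x ∈ Finset.Icc (1 : ℤ) N, ∑ y ∈ Finset.Icc (1 : ℤ) ((N : ℤ) ^ 2), f₀ (x, y) *
        ∑ d ∈ Finset.Icc (1 - t) (N - t), f₁ (x + d, y) * G x (y + d ^ 2)‖) :
    δ ^ 4 * N ^ 6 / 9 ≤ ∑ x ∈ Finset.Icc (1 : ℤ) N, ∑ x' ∈ Finset.Icc (1 : ℤ) N,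
      ∑ y ∈ Finset.Icc (1 : ℤ) ((N : ℤ) ^ 2),
        ‖∑ d ∈ Finset.Icc (max (1 - t) (1 - t + (x' - x))) (min (N - t) (N - t + (x' - x))),
          G x (y + d ^ 2) * conj (G x' (y + (d - (x' - x)) ^ 2))‖ ^ 2 := by
  have hN0 : (0 : ℝ) < N := by exact_mod_cast hN
  set I := Finset.Icc (1 - t) (N - t) with hI
  set X := Finset.Icc (1 : ℤ) N with hX
  set Y := Finset.Icc (1 : ℤ) ((N : ℤ) ^ 2) with hY
  set Z := Finset.Icc (1 - N : ℤ) (2 * N) with hZ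
  have hXc : (X.card : ℝ) = N := by simp [hX]
  have hYc : (Y.card : ℝ) = N ^ 2 := by
    rw [hY, Int.card_Icc, add_sub_cancel_right, ← Nat.cast_pow, Int.toNat_natCast, Nat.cast_pow]
  have hZc : (Z.card : ℝ) = 3 * N := by
    rw [hZ, Int.card_Icc, show 2 * (N : ℤ) + 1 - (1 - N) = ((3 * N : ℕ) : ℤ) by push_cast; ring,
      Int.toNat_natCast]
    push_cast
    rfl
  rw [Finset.mem_Icc] at ht
  -- With `z = x + d` the factor `f₁ (z, y)` no longer involves `x`, so Cauchy–Schwarz over `(y, z)`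
  -- removes it.
  set Q : ℤ → ℤ → ℤ → ℂ := fun y x z =>
    if z - x ∈ I then f₀ (x, y) * G x (y + (z - x) ^ 2) else 0 with hQ
  have hQfin : ∀ y x, (Function.support (Q y x)).Finite := by
    intro y x
    refine (Set.finite_Icc (1 - t + x) (N - t + x)).subset fun z hz => ?_
    by_contra hc
    refine hz (if_neg fun hm => hc ?_)
    rw [hI, Finset.mem_Icc] at hm
    rw [Set.mem_Icc]
    constructor <;> linarith [hm.1, hm.2]
  set c : ℤ → ℤ → ℤ → ℂ := fun x x' y =>
    ∑ d ∈ Finset.Icc (max (1 - t) (1 - t + (x' - x))) (min (N - t) (N - t + (x' - x))),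
      G x (y + d ^ 2) * conj (G x' (y + (d - (x' - x)) ^ 2)) with hc
  have e1 : ∀ x ∈ X, ∀ y, f₀ (x, y) * ∑ d ∈ I, f₁ (x + d, y) * G x (y + d ^ 2) =
      ∑ z ∈ Z, f₁ (z, y) * Q y x z := by
    intro x hx y
    rw [hX, Finset.mem_Icc] at hx
    have hsub : I.map (addLeftEmbedding x) ⊆ Z := by
      intro z hz
      obtain ⟨d, hd, rfl⟩ := Finset.mem_map.1 hz
      rw [hI, Finset.mem_Icc] at hd
      rw [addLeftEmbedding_apply, hZ, Finset.mem_Icc]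
      constructor <;> linarith [hd.1, hd.2]
    rw [← Finset.sum_subset hsub, Finset.sum_map, Finset.mul_sum]
    · refine Finset.sum_congr rfl fun d hd => ?_
      simp only [hQ, addLeftEmbedding_apply, add_sub_cancel_left, if_pos hd]
      ring
    · intro z _ hz
      have : z - x ∉ I := fun hm => hz (Finset.mem_map.2 ⟨z - x, hm, by simp⟩)
      simp only [hQ, if_neg this, mul_zero]
  have s1 : δ * N ^ 4 ≤ ∑ p ∈ Y ×ˢ Z, ‖∑ x ∈ X, Q p.1 x p.2‖ := by
    refine h.trans ?_
    rw [Finset.sum_congr rfl fun x hx => Finset.sum_congr rfl fun y _ => e1 x hx y, Finset.sum_comm,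
      Finset.sum_product]
    refine (norm_sum_le _ _).trans (Finset.sum_le_sum fun y _ => ?_)
    rw [Finset.sum_comm]
    refine (norm_sum_le _ _).trans (Finset.sum_le_sum fun z _ => ?_)
    rw [← Finset.mul_sum, norm_mul]
    exact mul_le_of_le_one_left (norm_nonneg _) (h₁ _)
  have s2 : ∀ y, ∑ z ∈ Z, ‖∑ x ∈ X, Q y x z‖ ^ 2 ≤ ∑ x ∈ X, ∑ x' ∈ X, ‖c x x' y‖ := by
    intro y
    refine (sum_le_hasSum Z (fun _ _ => by positivity) (hasSum_norm_sq_sum X (hQfin y))).trans ?_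
    refine (Complex.re_le_norm _).trans ((norm_sum_le _ _).trans (Finset.sum_le_sum fun x _ =>
      (norm_sum_le _ _).trans (Finset.sum_le_sum fun x' _ => ?_)))
    have e2 : ∑' z, Q y x z * conj (Q y x' z) = f₀ (x, y) * conj (f₀ (x', y)) * c x x' y := by
      rw [← (Equiv.addLeft x).tsum_eq, tsum_eq_sum (s := Finset.Icc
        (max (1 - t) (1 - t + (x' - x))) (min (N - t) (N - t + (x' - x)))), hc, Finset.mul_sum]
      · refine Finset.sum_congr rfl fun d hd => ?_
        rw [Finset.mem_Icc] at hd
        have m1 : x + d - x ∈ I := by rw [hI, Finset.mem_Icc]; omega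
        have m2 : x + d - x' ∈ I := by rw [hI, Finset.mem_Icc]; omega
        simp only [hQ, Equiv.coe_addLeft, if_pos m1, if_pos m2, map_mul]
        rw [show x + d - x = d by ring, show x + d - x' = d - (x' - x) by ring]
        ring
      · intro d hd
        rw [Finset.mem_Icc] at hd
        by_cases m1 : x + d - x ∈ I
        · have m2 : x + d - x' ∉ I := by
            intro m2
            rw [hI, Finset.mem_Icc] at m1 m2
            omega
          simp only [hQ, Equiv.coe_addLeft, if_neg m2, map_zero, mul_zero]
        · simp only [hQ, Equiv.coe_addLeft, if_neg m1, zero_mul]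
    rw [e2, norm_mul, norm_mul, RCLike.norm_conj]
    exact mul_le_of_le_one_left (norm_nonneg _) (mul_le_one₀ (h₀ _) (norm_nonneg _) (h₀ _))
  have s3 : δ ^ 2 * N ^ 5 / 3 ≤ ∑ p ∈ X ×ˢ (X ×ˢ Y), ‖c p.1 p.2.1 p.2.2‖ := by
    have cs := sq_sum_le_card_mul_sum_sq (s := Y ×ˢ Z) (f := fun p => ‖∑ x ∈ X, Q p.1 x p.2‖)
    have s4 : ∑ p ∈ Y ×ˢ Z, ‖∑ x ∈ X, Q p.1 x p.2‖ ^ 2 ≤ ∑ p ∈ X ×ˢ (X ×ˢ Y), ‖c p.1 p.2.1 p.2.2‖ := by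
      simp only [Finset.sum_product]
      refine (Finset.sum_le_sum fun y _ => s2 y).trans (le_of_eq ?_)
      rw [Finset.sum_comm]
      refine Finset.sum_congr rfl fun x _ => ?_
      rw [Finset.sum_comm]
    rw [Finset.card_product, Nat.cast_mul, hYc, hZc] at cs
    have s5 : (δ * N ^ 4) ^ 2 ≤ (N : ℝ) ^ 2 * (3 * N) * ∑ p ∈ X ×ˢ (X ×ˢ Y), ‖c p.1 p.2.1 p.2.2‖ :=
      (pow_le_pow_left₀ (by positivity) s1 2).trans
        (cs.trans (mul_le_mul_of_nonneg_left s4 (by positivity)))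
    refine le_of_mul_le_mul_left (a := (N : ℝ) ^ 2 * (3 * N)) ?_ (by positivity)
    exact le_trans (le_of_eq (by ring)) s5
  -- `f₀` has already gone with the passage to moduli; this Cauchy–Schwarz supplies the squares that
  -- are expanded in the column estimate.
  have cs := sq_sum_le_card_mul_sum_sq (s := X ×ˢ (X ×ˢ Y)) (f := fun p => ‖c p.1 p.2.1 p.2.2‖)
  rw [Finset.card_product, Finset.card_product, Nat.cast_mul, Nat.cast_mul, hXc, hYc] at cs
  have s6 := (pow_le_pow_left₀ (by positivity) s3 2).trans cs
  refine le_of_mul_le_mul_left (a := (N : ℝ) * (N * N ^ 2)) ?_ (by positivity)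
  refine le_trans (le_of_eq (by ring)) (s6.trans (le_of_eq ?_))
  simp only [Finset.sum_product, hc]

theorem sum_translate_le_sum_Icc {N : ℕ} {f : ℤ → ℝ} (hf : ∀ k, 0 ≤ f k) {x : ℤ}
    (hx : x ∈ Finset.Icc (1 : ℤ) N) :
    ∑ x' ∈ Finset.Icc (1 : ℤ) N, f (x' - x) ≤ ∑ k ∈ Finset.Icc (-(N : ℤ)) N, f k := by
  have h1 : ∑ x' ∈ Finset.Icc (1 : ℤ) N, f (x' - x) =
      ∑ k ∈ (Finset.Icc (1 : ℤ) N).map (Equiv.subRight x).toEmbedding, f k := by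
    rw [Finset.sum_map]
    rfl
  rw [h1]
  refine Finset.sum_le_sum_of_subset_of_nonneg (fun k hk => ?_) fun k _ _ => hf k
  obtain ⟨x', hx', rfl⟩ := Finset.mem_map.1 hk
  simp only [Equiv.coe_toEmbedding, Equiv.subRight_apply, Finset.mem_Icc] at *
  omega

/-- This ensures that an integer `T` of order `δ⁻⁴` is large and that rounding it up costs only a
constant. -/
theorem delta_le_one_of_correlation {N : ℕ} (hN : 0 < N) {f₀ f₁ g : ℤ × ℤ → ℂ} {δ : ℝ}
    (h₀ : ∀ p, ‖f₀ p‖ ≤ 1) (h₁ : ∀ p, ‖f₁ p‖ ≤ 1) (hg : ∀ p, ‖g p‖ ≤ 1) {t : ℤ}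
    (h : δ * N ^ 4 ≤ ‖∑ x ∈ Finset.Icc (1 : ℤ) N, ∑ y ∈ Finset.Icc (1 : ℤ) ((N : ℤ) ^ 2), f₀ (x, y) *
        ∑ d ∈ Finset.Icc (1 - t) (N - t), f₁ (x + d, y) * g (x, y + d ^ 2)‖) : δ ≤ 1 := by
  have hN0 : (0 : ℝ) < N := by exact_mod_cast hN
  have hYc : ((Finset.Icc (1 : ℤ) ((N : ℤ) ^ 2)).card : ℝ) = N ^ 2 := by
    rw [Int.card_Icc, add_sub_cancel_right, ← Nat.cast_pow, Int.toNat_natCast, Nat.cast_pow]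
  have hIc : ((Finset.Icc (1 - t) (N - t)).card : ℝ) = N := by
    rw [Int.card_Icc, show (N : ℤ) - t + 1 - (1 - t) = N by ring, Int.toNat_natCast]
  have h2 : ∀ x y, ‖f₀ (x, y) * ∑ d ∈ Finset.Icc (1 - t) (N - t),
      f₁ (x + d, y) * g (x, y + d ^ 2)‖ ≤ N := by
    intro x y
    rw [norm_mul]
    refine (mul_le_of_le_one_left (norm_nonneg _) (h₀ _)).trans ?_
    refine (norm_sum_le_of_le (n := fun _ => (1 : ℝ)) _ fun d _ => ?_).trans (le_of_eq ?_)
    · rw [norm_mul]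
      exact mul_le_one₀ (h₁ _) (norm_nonneg _) (hg _)
    · rw [Finset.sum_const, nsmul_eq_mul, hIc, mul_one]
  have h3 := h.trans (norm_sum_le_of_le _ fun x _ => norm_sum_le_of_le _ fun y _ => h2 x y)
  simp only [Finset.sum_const, nsmul_eq_mul, hYc] at h3
  rw [Int.card_Icc, add_sub_cancel_right, Int.toNat_natCast] at h3
  refine le_of_mul_le_mul_right (a := (N : ℝ) ^ 4) ?_ (by positivity)
  refine h3.trans (le_of_eq (by ring))

/-- Fix a popular `x`. With `k = x' - x`, the conjugates of the columns `x + k` serve as the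
arbitrary bounded functions `R k`, and adding the values of `k` outside the translated range only
increases the sum. -/
theorem exists_many_large_columns {C : ℕ} (hC : ∀ (N T : ℕ) (G : ℤ → ℂ) (R : ℤ → ℤ → ℂ)
    (a b : ℤ → ℤ) (Y : Finset ℤ), 0 < N → 2 ^ 10 ≤ T → (∀ z, ‖G z‖ ≤ 1) → (∀ k z, ‖R k z‖ ≤ 1) →
    Function.support G ⊆ Set.Icc 1 (2 * (N : ℤ) ^ 2) → (∀ k, -(N : ℤ) < a k) → (∀ k, b k < N) →
    Y.card ≤ N ^ 2 →
    (N : ℝ) ^ 5 ≤ T * ∑ k ∈ Finset.Icc (-(N : ℤ)) N, ∑ y ∈ Y,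
      ‖∑ d ∈ Finset.Icc (a k) (b k), G (y + d ^ 2) * R k (y + (d - k) ^ 2)‖ ^ 2 →
    (N : ℝ) ^ 12 ≤ T ^ C * gowersRe 5 G) {N T : ℕ} (hN : 0 < N) (hT : 2 ^ 10 ≤ T) {δ : ℝ}
    (hδ : 0 < δ) (hδT : 18 ≤ T * δ ^ 4) {G : ℤ → ℤ → ℂ} (hG : ∀ x z, ‖G x z‖ ≤ 1)
    (hsupp : ∀ x, Function.support (G x) ⊆ Set.Icc 1 (2 * (N : ℤ) ^ 2)) {t : ℤ}
    (ht : t ∈ Finset.Icc (1 : ℤ) N)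
    (h : δ ^ 4 * N ^ 6 / 9 ≤ ∑ x ∈ Finset.Icc (1 : ℤ) N, ∑ x' ∈ Finset.Icc (1 : ℤ) N,
      ∑ y ∈ Finset.Icc (1 : ℤ) ((N : ℤ) ^ 2),
        ‖∑ d ∈ Finset.Icc (max (1 - t) (1 - t + (x' - x))) (min (N - t) (N - t + (x' - x))),
          G x (y + d ^ 2) * conj (G x' (y + (d - (x' - x)) ^ 2))‖ ^ 2) :
    ∃ P ⊆ Finset.Icc (1 : ℤ) N, δ ^ 4 * N ≤ 72 * P.card ∧
      ∀ x ∈ P, (N : ℝ) ^ 12 ≤ T ^ C * gowersRe 5 (G x) := by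
  have hN0 : (0 : ℝ) < N := by exact_mod_cast hN
  have hT0 : (0 : ℝ) < T := by exact_mod_cast (by omega : 0 < T)
  have ht' := Finset.mem_Icc.1 ht
  set X := Finset.Icc (1 : ℤ) N with hX
  set Y := Finset.Icc (1 : ℤ) ((N : ℤ) ^ 2) with hY
  have hXc : (X.card : ℝ) = N := by simp [hX]
  have hYn : Y.card = N ^ 2 := by
    rw [hY, Int.card_Icc, add_sub_cancel_right, ← Nat.cast_pow, Int.toNat_natCast]
  have hYc : (Y.card : ℝ) = N ^ 2 := by rw [hYn, Nat.cast_pow]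
  set a : ℤ → ℤ := fun k => max (1 - t) (1 - t + k) with ha
  set b : ℤ → ℤ := fun k => min (N - t) (N - t + k) with hb
  have ha' : ∀ k, -(N : ℤ) < a k := fun k => by simp only [ha]; omega
  have hb' : ∀ k, b k < N := fun k => by simp only [hb]; omega
  set B : ℤ → ℝ := fun x => ∑ x' ∈ X, ∑ y ∈ Y, ‖∑ d ∈ Finset.Icc (a (x' - x)) (b (x' - x)),
    G x (y + d ^ 2) * conj (G x' (y + (d - (x' - x)) ^ 2))‖ ^ 2 with hB
  have hBle : ∀ x ∈ X, B x ≤ 4 * (N : ℝ) ^ 5 := by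
    intro x _
    have h1 : ∀ x' y, ‖∑ d ∈ Finset.Icc (a (x' - x)) (b (x' - x)),
        G x (y + d ^ 2) * conj (G x' (y + (d - (x' - x)) ^ 2))‖ ^ 2 ≤ (2 * (N : ℝ)) ^ 2 := by
      intro x' y
      gcongr
      refine (norm_sum_le_of_le (n := fun _ => (1 : ℝ)) _ fun d _ => ?_).trans ?_
      · rw [norm_mul, RCLike.norm_conj]
        exact mul_le_one₀ (hG _ _) (norm_nonneg _) (hG _ _)
      · rw [Finset.sum_const, nsmul_eq_mul, mul_one]
        have : (Finset.Icc (a (x' - x)) (b (x' - x))).card ≤ 2 * N := by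
          have := ha' (x' - x)
          have := hb' (x' - x)
          rw [Int.card_Icc]
          omega
        exact_mod_cast this
    calc B x ≤ ∑ x' ∈ X, ∑ y ∈ Y, (2 * (N : ℝ)) ^ 2 :=
          Finset.sum_le_sum fun x' _ => Finset.sum_le_sum fun y _ => h1 x' y
      _ = 4 * (N : ℝ) ^ 5 := by
          simp only [Finset.sum_const, nsmul_eq_mul, hXc, hYc]
          ring
  have hpop := le_card_popular X B (by positivity) hN0 hXc.le hBle h
  refine ⟨_, Finset.filter_subset (fun x => δ ^ 4 * N ^ 6 / 9 ≤ 2 * N * B x) _, ?_, fun x hx => ?_⟩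
  · refine le_of_mul_le_mul_left (a := (N : ℝ) ^ 5 / 9) ?_ (by positivity)
    refine le_trans (le_of_eq (by ring)) (hpop.trans (le_of_eq (by ring)))
  obtain ⟨hxX, hxB⟩ := Finset.mem_filter.1 hx
  refine hC N T (G x) (fun k z => conj (G (x + k) z)) a b Y hN hT (hG x)
    (fun k z => by rw [RCLike.norm_conj]; exact hG _ _) (hsupp x) ha' hb' hYn.le ?_
  have h2 : B x ≤ ∑ k ∈ Finset.Icc (-(N : ℤ)) N, ∑ y ∈ Y, ‖∑ d ∈ Finset.Icc (a k) (b k),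
      G x (y + d ^ 2) * conj (G (x + k) (y + (d - k) ^ 2))‖ ^ 2 := by
    refine le_trans (le_of_eq ?_) (sum_translate_le_sum_Icc (f := fun k => ∑ y ∈ Y,
      ‖∑ d ∈ Finset.Icc (a k) (b k), G x (y + d ^ 2) * conj (G (x + k) (y + (d - k) ^ 2))‖ ^ 2)
      (fun k => Finset.sum_nonneg fun _ _ => by positivity) hxX)
    simp only [hB, add_sub_cancel]
    rfl
  refine le_trans ?_ (mul_le_mul_of_nonneg_left h2 hT0.le)
  have h3 : δ ^ 4 * (N : ℝ) ^ 5 ≤ 18 * B x := by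
    refine le_of_mul_le_mul_left (a := (N : ℝ) / 9) ?_ (by positivity)
    exact le_trans (le_of_eq (by ring)) (hxB.trans (le_of_eq (by ring)))
  have h4 : 18 * (N : ℝ) ^ 5 ≤ 18 * (T * B x) := by
    calc 18 * (N : ℝ) ^ 5 ≤ (T * δ ^ 4) * N ^ 5 := by gcongr
      _ = T * (δ ^ 4 * (N : ℝ) ^ 5) := by ring
      _ ≤ T * (18 * B x) := by gcongr
      _ = 18 * (T * B x) := by ring
  linarith

/-! ### Proof of the theorem. -/

theorem theorem3p1 :
    ∃ c : ℝ, 0 < c ∧ ∃ C : ℕ,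
      ∀ (N : ℕ), 1 ≤ N → ∀ (δ : ℝ), 0 < δ →
      ∀ (f₀ f₁ g : ℤ × ℤ → ℂ),
        (∀ p, ‖f₀ p‖ ≤ 1) → (∀ p, ‖f₁ p‖ ≤ 1) → (∀ p, ‖g p‖ ≤ 1) →
        δ ≤ ‖countingOp N f₀ f₁ g‖ →
        c * δ ^ C *
            gowersNorm 5 ((Set.Icc (1 : ℤ) (2 * (N : ℤ) ^ 2)).indicator fun _ => (1 : ℂ))
              ^ (2 ^ 5) ≤
          𝔼 x ∈ Finset.Icc (1 : ℤ) (N : ℤ),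
            gowersNorm 5 ((Set.Icc (1 : ℤ) (2 * (N : ℤ) ^ 2)).indicator fun y => g (x, y))
              ^ (2 ^ 5) := by
  obtain ⟨C, hC⟩ := exists_column_control
  -- `15552 = 2 · 6⁵` is the trivial bound for the Gowers sum of `1_{[2N²]}` divided by `N^12`; `72`
  -- is the loss in the number of large columns, and `2^11` bounds `T δ⁴`.
  refine ⟨1 / (72 * 15552 * (2 ^ 11) ^ C), by positivity, 4 + 4 * C, ?_⟩
  intro N hN δ hδ f₀ f₁ g h₀ h₁ hg hΛ
  have hNpos : 0 < N := hN
  have hN0 : (0 : ℝ) < N := by exact_mod_cast hNpos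
  obtain ⟨t, ht, hcorr⟩ := exists_interval_correlation hNpos hΛ
  have hδ1 : δ ≤ 1 := delta_le_one_of_correlation hNpos h₀ h₁ hg hcorr
  set G : ℤ → ℤ → ℂ := fun x => (Set.Icc (1 : ℤ) (2 * (N : ℤ) ^ 2)).indicator fun y => g (x, y)
    with hGdef
  have hG : ∀ x z, ‖G x z‖ ≤ 1 := fun x z =>
    (norm_indicator_le_norm_self _ _).trans (hg _)
  have hsupp : ∀ x, Function.support (G x) ⊆ Set.Icc 1 (2 * (N : ℤ) ^ 2) := fun x =>
    Set.support_indicator_subset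
  -- Cutting `g` off to `[2N²]` changes nothing, because `y ≤ N²` and `|d| ≤ N`.
  have hcorr' : δ * N ^ 4 ≤ ‖∑ x ∈ Finset.Icc (1 : ℤ) N,
      ∑ y ∈ Finset.Icc (1 : ℤ) ((N : ℤ) ^ 2), f₀ (x, y) *
        ∑ d ∈ Finset.Icc (1 - t) (N - t), f₁ (x + d, y) * G x (y + d ^ 2)‖ := by
    refine hcorr.trans (le_of_eq ?_)
    congr 1
    refine Finset.sum_congr rfl fun x _ => Finset.sum_congr rfl fun y hy => ?_
    congr 1
    refine Finset.sum_congr rfl fun d hd => ?_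
    rw [Finset.mem_Icc] at ht hy hd
    have hd2 : d ^ 2 ≤ (N : ℤ) ^ 2 := sq_le_sq' (by linarith) (by linarith)
    have hmem : y + d ^ 2 ∈ Set.Icc (1 : ℤ) (2 * (N : ℤ) ^ 2) := by
      have := sq_nonneg d
      rw [Set.mem_Icc]
      constructor <;> linarith
    simp only [hGdef, Set.indicator_of_mem hmem]
  have hcols := le_sum_norm_sq_columns hNpos hδ.le h₀ h₁ ht hcorr'
  obtain ⟨T, hT1, hT2⟩ : ∃ T : ℕ, (2 : ℝ) ^ 10 ≤ T * δ ^ 4 ∧ T * δ ^ 4 ≤ 2 ^ 11 := by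
    have hδ4 : δ ^ 4 ≤ 1 := pow_le_one₀ hδ.le hδ1
    refine ⟨⌈(2 : ℝ) ^ 10 / δ ^ 4⌉₊, ?_, ?_⟩
    · rw [← div_le_iff₀ (by positivity)]
      exact Nat.le_ceil _
    · have := (Nat.ceil_lt_add_one (show (0 : ℝ) ≤ 2 ^ 10 / δ ^ 4 by positivity)).le
      calc (⌈(2 : ℝ) ^ 10 / δ ^ 4⌉₊ : ℝ) * δ ^ 4 ≤ (2 ^ 10 / δ ^ 4 + 1) * δ ^ 4 := by gcongr
        _ = 2 ^ 10 + δ ^ 4 := by field_simp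
        _ ≤ 2 ^ 11 := by linarith
  have hT : 2 ^ 10 ≤ T := by
    have : (2 : ℝ) ^ 10 ≤ T :=
      hT1.trans (mul_le_of_le_one_right (Nat.cast_nonneg _) (pow_le_one₀ hδ.le hδ1))
    exact_mod_cast this
  obtain ⟨P, hPX, hPc, hP⟩ := exists_many_large_columns hC hNpos hT hδ
    (le_trans (by norm_num) hT1) hG hsupp ht hcols
  have hfin : ∀ x, (Function.support (G x)).Finite := fun x =>
    (Set.finite_Icc _ _).subset (hsupp x)
  have hT0 : (0 : ℝ) < T := by exact_mod_cast (by omega : 0 < T)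
  rw [gowersNorm_pow (by norm_num) ((Set.finite_Icc _ _).subset Set.support_indicator_subset)]
  have hone := gowersRe_le (R := 2 * N ^ 2)
    (f := (Set.Icc (1 : ℤ) (2 * (N : ℤ) ^ 2)).indicator fun _ => (1 : ℂ))
    (fun x => (norm_indicator_le_norm_self _ _).trans (by simp))
    (by push_cast; exact Set.support_indicator_subset) 5
  rw [Finset.expect_eq_sum_div_card,
    Finset.sum_congr rfl fun x _ => gowersNorm_pow (by norm_num) (hfin x)]
  have hXc : ((Finset.Icc (1 : ℤ) N).card : ℝ) = N := by simp
  rw [hXc, le_div_iff₀ hN0]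
  have hsum : P.card * ((N : ℝ) ^ 12 / T ^ C) ≤ ∑ x ∈ Finset.Icc (1 : ℤ) N, gowersRe 5 (G x) := by
    refine le_trans ?_ (Finset.sum_le_sum_of_subset_of_nonneg hPX fun x _ _ =>
      gowersRe_nonneg (by norm_num) (hfin x))
    rw [← nsmul_eq_mul]
    refine Finset.card_nsmul_le_sum _ _ _ fun x hx => ?_
    rw [div_le_iff₀ (by positivity), mul_comm]
    exact hP x hx
  refine le_trans ?_ hsum
  have hTC : (T : ℝ) ^ C * δ ^ (4 * C) ≤ (2 ^ 11) ^ C := by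
    rw [pow_mul, ← mul_pow]
    exact pow_le_pow_left₀ (by positivity) hT2 C
  push_cast at hone
  calc 1 / (72 * 15552 * (2 ^ 11) ^ C) * δ ^ (4 + 4 * C) *
        gowersRe 5 ((Set.Icc (1 : ℤ) (2 * (N : ℤ) ^ 2)).indicator fun _ => (1 : ℂ)) * N ≤
      1 / (72 * 15552 * (2 ^ 11) ^ C) * δ ^ (4 + 4 * C) *
        (2 * (N : ℝ) ^ 2 * (3 * (2 * (N : ℝ) ^ 2)) ^ 5) * N := by gcongr
    _ = (δ ^ 4 * N / 72) * (N : ℝ) ^ 12 * (δ ^ (4 * C) / (2 ^ 11) ^ C) := by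
      rw [pow_add]
      field_simp
      ring
    _ ≤ P.card * (N : ℝ) ^ 12 * (1 / T ^ C) := by
      gcongr ?_ * _ * ?_
      · linarith
      · rw [div_le_div_iff₀ (by positivity) (by positivity)]
        linarith
    _ = P.card * ((N : ℝ) ^ 12 / T ^ C) := by ring
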